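/- Let $(E,\rho)$ be a metric space in which every closed ball is compact, and let $(X(t))_{t\ge 0}$ be a standard Markov process with values in $E$ (no killing), with laws $\mathbb P^x$ ($X(0)=x$ $\mathbb P^x$-a.s.) and filtration $(\mathcal F_t)$: it is strong Markov with respect to $(\mathcal F_t)$, c\`adl\`ag and quasi-left-continuous, and $(\mathcal F_t)$ is right-continuous and complete. Assume that $X$ is weakly Feller: for every $t\ge 0$, $P_t h(x)=\mathbb E^x\{h(X(t))\}$ maps the space $C_0(E)$ of continuous functions vanishing at infinity into itself. Let $\mathcal O\subseteq E$ be open, $\tau_{\mathcal O}=\inf\{t\ge 0: X(t)\notin\mathcal O\}$ (with $\inf\emptyset=\infty$), $\alpha>0$, and let $f,G,H:[0,\infty)\times E\to\mathbb R$ be continuous and bounded. For $(s,x)\in[0,\infty)\times E$ and an $(\mathcal F_t)$-stopping time $\tau$ with values in $[0,\infty]$ let $$J(s,x,\tau)=\mathbb E^x\Big\{\int_0^{\tau\wedge\tau_{\mathcal O}}e^{-\alpha u}f(s+u,X(u))\,du+1_{\{\tau<\tau_{\mathcal O}\}}e^{-\alpha\tau}G(s+\tau,X(\tau))+1_{\{\tau\ge\tau_{\mathcal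 O}\}}e^{-\alpha\tau_{\mathcal O}}H(s+\tau_{\mathcal O},X(\tau_{\mathcal O}))\Big\},$$ where the last term is $0$ if $\tau_{\mathcal O}=\infty$, and let $w(s,x)=\sup_\tau J(s,x,\tau)$, the supremum being over all such stopping times. Assume (A1) for every $t>0$ the operator $h\mapsto \mathbb E^x\{1_{\{t<\tau_{\mathcal O}\}}h(X(t))\}$ maps bounded continuous functions on $E$ to bounded continuous functions on $E$; and that $G\le H$ on $[0,\infty)\times E$. Then $w$ is continuous on $[0,\infty)\times E$, and for every $s\ge 0$ $$\tau^*(s)=\inf\{t\ge 0:\ w(s+t,X(t))\le G(s+t,X(t))\ \text{ or }\ X(t)\notin\mathcal O\}$$ is an optimal stopping time: it is an $(\mathcal F_t)$-stopping time and $J(s,x,\tau^*(s))=w(s,x)$ for all $x\in E$. -/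

import Mathlib

open MeasureTheory Filter Topology Set
open scoped NNReal BoundedContinuousFunction ZeroAtInfty

noncomputable section

namespace BoundaryStopping

variable {E Ω : Type*}

/-- A conservative standard Markov process with state space `E`, given on the sample space `Ω` by
the process `X`, the laws `P x` (the process started at `x`) and the filtration `ℱ`. -/
structure IsStandardProcess [TopologicalSpace E] [MeasurableSpace E] {mΩ : MeasurableSpace Ω}
    (X : ℝ≥0 → Ω → E) (P : E → Measure Ω) (ℱ : Filtration ℝ≥0 mΩ) : Prop where
  /-- Every `P x` is a probability measure. -/
  isProbabilityMeasure : ∀ x, IsProbabilityMeasure (P x)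
  /-- The transition function `(x, B) ↦ P x {X t ∈ B}` is measurable in `x`. -/
  measurable_transition : ∀ (t : ℝ≥0) (B : Set E), MeasurableSet B →
    Measurable fun x => P x (X t ⁻¹' B)
  /-- Under `P x` the process starts at `x`. -/
  start : ∀ x, ∀ᵐ ω ∂P x, X 0 ω = x
  adapted : Adapted ℱ X
  /-- Paths are right-continuous. -/
  right_continuous : ∀ ω t, ContinuousWithinAt (fun u => X u ω) (Ici t) t
  /-- Paths have left limits in `E`. -/
  left_limits : ∀ ω t, ∃ l, Tendsto (fun u => X u ω) (𝓝[<] t) (𝓝 l)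
  /-- The filtration is right-continuous. -/
  filtration_right_continuous : ℱ.IsRightContinuous
  /-- The filtration is complete: it contains every subset of an event that is null under all
  the laws `P x`. -/
  filtration_complete : ∀ N A : Set Ω, MeasurableSet N → (∀ x, P x N = 0) → A ⊆ N →
    ∀ t, MeasurableSet[ℱ t] A
  /-- The strong Markov property: for every stopping time `τ`, on `{τ < ∞}` the conditional law of
  `X (τ + t)` given `ℱ_τ` is the law of `X t` under `P (X τ)`. -/
  strong_markov : ∀ (x : E) (τ : Ω → WithTop ℝ≥0) (hτ : IsStoppingTime ℱ τ) (t : ℝ≥0) (B : Set E),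
    MeasurableSet B → ∀ A : Set Ω, MeasurableSet[hτ.measurableSpace] A →
      P x (A ∩ {ω | τ ω ≠ ⊤ ∧ X ((τ ω).untopA + t) ω ∈ B}) =
        ∫⁻ ω in A ∩ {ω | τ ω ≠ ⊤}, P (stoppedValue X τ ω) (X t ⁻¹' B) ∂P x
  /-- Quasi-left-continuity: if stopping times `τ n` increase to `τ`, then `X (τ n)` converges to
  `X τ` almost surely on `{τ < ∞}`. -/
  quasi_left_continuous : ∀ (x : E) (τ : ℕ → Ω → WithTop ℝ≥0), (∀ n, IsStoppingTime ℱ (τ n)) →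
    Monotone τ → ∀ᵐ ω ∂P x, (⨆ n, τ n ω) ≠ ⊤ →
      Tendsto (fun n => stoppedValue X (τ n) ω) atTop
        (𝓝 (stoppedValue X (fun ω => ⨆ n, τ n ω) ω))

/-- The weak Feller property: the transition semigroup `P_t h x = 𝔼ˣ[h (X t)]` maps continuous
functions vanishing at infinity to such functions. -/
def IsWeakFeller [TopologicalSpace E] {mΩ : MeasurableSpace Ω}
    (X : ℝ≥0 → Ω → E) (P : E → Measure Ω) : Prop :=
  ∀ (t : ℝ≥0) (h : C₀(E, ℝ)), ∃ g : C₀(E, ℝ), ∀ x, g x = ∫ ω, h (X t ω) ∂P x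

/-- The first exit time `inf {t ≥ 0 : X t ∉ O}`, equal to `⊤` if the path never leaves `O`. -/
def exitTime (X : ℝ≥0 → Ω → E) (O : Set E) : Ω → WithTop ℝ≥0 :=
  hittingAfter X Oᶜ 0

open Classical in
/-- The semigroup of the process stopped at the exit from `O`:
`h ↦ 𝔼ˣ[1_{t < exit time} h (X t)]`. -/
def stoppedSemigroup {mΩ : MeasurableSpace Ω} (X : ℝ≥0 → Ω → E) (P : E → Measure Ω) (O : Set E)
    (t : ℝ≥0) (h : E → ℝ) (x : E) : ℝ :=
  ∫ ω, (if (t : WithTop ℝ≥0) < exitTime X O ω then h (X t ω) else 0) ∂P x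

/-- For every `t > 0` the stopped semigroup maps bounded continuous functions to bounded continuous
functions. -/
def StoppedSemigroupFeller [TopologicalSpace E] {mΩ : MeasurableSpace Ω}
    (X : ℝ≥0 → Ω → E) (P : E → Measure Ω) (O : Set E) : Prop :=
  ∀ t : ℝ≥0, 0 < t → ∀ h : E →ᵇ ℝ, ∃ g : E →ᵇ ℝ, ∀ x, g x = stoppedSemigroup X P O t h x

open Classical in
/-- The discounted payoff `e^{-αθ} h (s + θ, X θ)` collected at time `θ`; it is `0` if `θ = ∞`. -/
def discountedPayoff (X : ℝ≥0 → Ω → E) (α : ℝ) (h : ℝ≥0 × E → ℝ) (s : ℝ≥0)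
    (θ : WithTop ℝ≥0) (ω : Ω) : ℝ :=
  if θ = ⊤ then 0
  else Real.exp (-α * (θ.untopA : ℝ≥0)) * h (s + θ.untopA, X θ.untopA ω)

/-- The discounted running reward `∫₀^θ e^{-αu} f (s + u, X u) du`. -/
def runningReward (X : ℝ≥0 → Ω → E) (α : ℝ) (f : ℝ≥0 × E → ℝ) (s : ℝ≥0)
    (θ : WithTop ℝ≥0) (ω : Ω) : ℝ :=
  ∫ u in {u : ℝ | 0 ≤ u ∧ (u.toNNReal : WithTop ℝ≥0) < θ},
    Real.exp (-α * u) * f (s + u.toNNReal, X u.toNNReal ω)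

open Classical in
/-- The functional `J(s, x, τ)`: running reward `f` up to `τ ∧ τ_O`, payoff `G` at `τ` if
`τ < τ_O`, payoff `H` at `τ_O` if `τ ≥ τ_O`. -/
def J {mΩ : MeasurableSpace Ω} (X : ℝ≥0 → Ω → E) (P : E → Measure Ω) (O : Set E) (α : ℝ)
    (f G H : ℝ≥0 × E → ℝ) (s : ℝ≥0) (x : E) (τ : Ω → WithTop ℝ≥0) : ℝ :=
  ∫ ω, (runningReward X α f s (min (τ ω) (exitTime X O ω)) ω +
    if τ ω < exitTime X O ω then discountedPayoff X α G s (τ ω) ω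
    else discountedPayoff X α H s (exitTime X O ω) ω) ∂P x

/-- The value function `w(s, x) = sup_τ J(s, x, τ)`, over all `[0, ∞]`-valued stopping times. -/
def valueFunction {mΩ : MeasurableSpace Ω} (X : ℝ≥0 → Ω → E) (P : E → Measure Ω)
    (ℱ : Filtration ℝ≥0 mΩ) (O : Set E) (α : ℝ) (f G H : ℝ≥0 × E → ℝ) (p : ℝ≥0 × E) : ℝ :=
  ⨆ τ : {τ : Ω → WithTop ℝ≥0 // IsStoppingTime ℱ τ}, J X P O α f G H p.1 p.2 τ

/-- The time `inf {t ≥ 0 : w (s + t, X t) ≤ G (s + t, X t) or X t ∉ O}`, where `w` is the value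
function; `⊤` if there is no such `t`. -/
def optimalTime {mΩ : MeasurableSpace Ω} (X : ℝ≥0 → Ω → E) (P : E → Measure Ω)
    (ℱ : Filtration ℝ≥0 mΩ) (O : Set E) (α : ℝ) (f G H : ℝ≥0 × E → ℝ) (s : ℝ≥0) :
    Ω → WithTop ℝ≥0 :=
  hittingAfter (fun t ω => (s + t, X t ω))
    {p | valueFunction X P ℱ O α f G H p ≤ G p ∨ p.2 ∉ O} 0

end BoundaryStopping

end

/-!
The proof combines penalization with the resolvents of the space-time process `(s + t, X t)`. Let
`R` be the resolvent of the process killed at the exit from `O` and `U` that of the process without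
killing; both preserve bounded continuous functions, by the continuity assumption on the killed
semigroup and by the weak Feller property (`FellerData.res`).

*Resolvents as payoffs.* Suppose first that `G = U g` and `H = U k`. By Dynkin's formula
(`FellerData.J_res`, which rests on the strong Markov property of the killed process,
`IsStandardProcess.lintegral_killed`) a solution `v` of `v = R (f - k + q)` with penalty
`q = β (G - H - v)⁺` gives `u = H + v` with `u(s, x) = J(f + q, u, H)(s, x, τ)` for every stopping
time `τ`. Such a `v` is the fixed point of a contraction. As `G - H ≤ 0` lies below its own killed
counterpart, `u ≥ G - ε` if `β` is large (`FellerData.exists_penalized`). Since the penalty is paid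
only where `u < G`, stopping when `u ≤ G` shows that `u` is within `ε` of the value function
(`FellerData.abs_valueFunction_sub_le_of_penalized`).

*General payoffs.* The functions `(n + 1) U_{n + 1} G` are resolvents below `(n + 1) U_{n + 1} H`,
and they converge to `G` locally uniformly (`FellerData.tendstoLocallyUniformly_smooth`). For
excessive functions the convergence is monotone, hence locally uniform by Dini's theorem; the
differences of excessive functions form a lattice which is dense on compact sets by the
Stone–Weierstrass theorem; and the rest is controlled by local tightness
(`FellerData.exists_compact_stoppingTime`): started near a given point, the process stays in a
compact set up to a time whose expected discount is small. The same tightness makes the penalized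
solutions converge locally uniformly to the value function `w`, which is therefore continuous.

*Optimality.* Hitting times of closed sets are stopping times, by quasi-left-continuity and the
completeness of the filtration. Up to the entrance time `τ_ε` of `{w ≤ G + ε}` or of the complement
of `O`, the penalties of the approximations vanish eventually, so `w(s, x) = J(f, w, H)(s, x, τ_ε)`
(`FellerData.J_value`), which is at most `J(f, G, H)(s, x, τ_ε) + ε`. As `ε` decreases to `0`, these
times increase to the time in the theorem, and by quasi-left-continuity the payoffs converge, except
that `G` may be replaced by `H ≥ G` if the limit is the exit time
(`FellerData.valueFunction_le_J_optimalTime`).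
-/

open scoped ENNReal

namespace BoundaryStopping

set_option linter.unusedSectionVars false

/-! ### Right-continuous processes and stopping times -/

/-- A discretization of time from the right: the points `k / (n + 1)` strictly above `t`. -/
@[irreducible] noncomputable def rightApprox (n : ℕ) (t : ℝ≥0) : ℝ≥0 :=
  (⌊(n + 1) * t⌋₊ + 1) / (n + 1)

lemma lt_rightApprox (n : ℕ) (t : ℝ≥0) : t < rightApprox n t := by
  rw [rightApprox, lt_div_iff₀ (by positivity), mul_comm]
  exact Nat.lt_floor_add_one _

lemma rightApprox_le (n : ℕ) (t : ℝ≥0) : rightApprox n t ≤ t + 1 / (n + 1) := by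
  rw [rightApprox, add_div]
  gcongr
  rw [div_le_iff₀ (by positivity), mul_comm]
  exact Nat.floor_le (zero_le)

lemma tendsto_rightApprox (t : ℝ≥0) : Tendsto (fun n => rightApprox n t) atTop (𝓝[≥] t) := by
  refine tendsto_nhdsWithin_iff.2 ⟨?_, Eventually.of_forall fun n => (lt_rightApprox n t).le⟩
  refine tendsto_of_tendsto_of_tendsto_of_le_of_le tendsto_const_nhds
    (h := fun n : ℕ => t + 1 / ((n : ℝ≥0) + 1)) ?_ (fun n => (lt_rightApprox n t).le)
    (fun n => rightApprox_le n t)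
  have h : Tendsto (fun n : ℕ => 1 / ((n : ℝ≥0) + 1)) atTop (𝓝 0) :=
    tendsto_one_div_add_atTop_nhds_zero_nat
  simpa using h.const_add t

lemma measurable_comp_rightApprox {Ω β : Type*} [MeasurableSpace Ω] [MeasurableSpace β]
    {w : ℝ≥0 → Ω → β} (hw : ∀ t, Measurable (w t)) (n : ℕ) :
    Measurable fun p : ℝ≥0 × Ω => w (rightApprox n p.1) p.2 := by
  let g : ℕ × Ω → β := fun q => w (((q.1 : ℝ≥0) + 1) / (n + 1)) q.2
  have h1 : Measurable g :=
    measurable_from_prod_countable_right fun k => hw (((k : ℝ≥0) + 1) / (n + 1))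
  have h2 : Measurable fun p : ℝ≥0 × Ω => (⌊((n : ℝ≥0) + 1) * p.1⌋₊, p.2) :=
    (Nat.measurable_floor.comp (measurable_fst.const_mul _)).prodMk measurable_snd
  have h3 : (fun p : ℝ≥0 × Ω => w (rightApprox n p.1) p.2) =
      fun p => g (⌊((n : ℝ≥0) + 1) * p.1⌋₊, p.2) := by
    funext p
    simp only [rightApprox, g]
  rw [h3]
  exact h1.comp h2

/-- A process with right-continuous paths is jointly measurable. -/
lemma measurable_uncurry_of_rightContinuous {Ω β : Type*} [MeasurableSpace Ω]
    [TopologicalSpace β] [TopologicalSpace.PseudoMetrizableSpace β] [MeasurableSpace β] [BorelSpace β]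
    {u : ℝ≥0 → Ω → β} (hm : ∀ t, Measurable (u t))
    (hr : ∀ ω t, ContinuousWithinAt (fun r => u r ω) (Ici t) t) :
    Measurable fun p : ℝ≥0 × Ω => u p.1 p.2 := by
  refine measurable_of_tendsto_metrizable (fun n => measurable_comp_rightApprox hm n) ?_
  rw [tendsto_pi_nhds]
  exact fun p => (hr p.2 p.1).tendsto.comp (tendsto_rightApprox p.1)

/-- An adapted process with right-continuous paths is progressively measurable. -/
lemma isStronglyProgressive_of_rightContinuous {Ω β : Type*} {mΩ : MeasurableSpace Ω}
    [TopologicalSpace β] [TopologicalSpace.PseudoMetrizableSpace β] [SecondCountableTopology β]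
    [MeasurableSpace β] [BorelSpace β] {ℱ : Filtration ℝ≥0 mΩ}
    {u : ℝ≥0 → Ω → β} (hu : Adapted ℱ u)
    (hr : ∀ ω t, ContinuousWithinAt (fun r => u r ω) (Ici t) t) :
    IsStronglyProgressive ℱ u := by
  intro i
  refine @Measurable.stronglyMeasurable _ _ (_) _ _ _ _ _ _ ?_
  refine @measurable_of_tendsto_metrizable _ _ (_) _ _ _ _
    (fun (n : ℕ) (p : Iic i × Ω) => u (min (rightApprox n p.1) i) p.2) _ (fun n => ?_) ?_
  · have h := @measurable_comp_rightApprox Ω β (ℱ i) _ (fun t => u (min t i))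
      (fun t => (hu (min t i)).mono (ℱ.mono (min_le_right _ _)) le_rfl) n
    exact h.comp (@Measurable.prodMap _ _ _ _ _ _ (ℱ i) (ℱ i) _ _ measurable_subtype_coe
      (@measurable_id _ (ℱ i)))
  · rw [tendsto_pi_nhds]
    rintro ⟨⟨t, ht⟩, ω⟩
    refine (hr ω t).tendsto.comp (tendsto_nhdsWithin_iff.2 ⟨?_, ?_⟩)
    · have h : Tendsto (fun n => min (rightApprox n t) i) atTop (𝓝 (min t i)) :=
        ((tendsto_nhdsWithin_iff.1 (tendsto_rightApprox t)).1).min tendsto_const_nhds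
      rwa [min_eq_left ht] at h
    · exact Eventually.of_forall fun n => le_min (lt_rightApprox n t).le ht

lemma isStoppingTime_add_const {Ω : Type*} {mΩ : MeasurableSpace Ω} {ℱ : Filtration ℝ≥0 mΩ}
    {τ : Ω → WithTop ℝ≥0} (hτ : IsStoppingTime ℱ τ) (t : ℝ≥0) :
    IsStoppingTime ℱ fun ω => τ ω + t := by
  intro j
  by_cases h : t ≤ j
  · have : {ω | τ ω + (t : WithTop ℝ≥0) ≤ j} = {ω | τ ω ≤ (j - t : ℝ≥0)} := by
      ext ω
      cases hω : τ ω with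
      | top =>
        simp only [mem_ofPred_eq, hω, WithTop.top_add, top_le_iff, WithTop.coe_ne_top]
      | coe a =>
        simp only [mem_ofPred_eq, hω]
        norm_cast
        exact (le_tsub_iff_right h).symm
    rw [this]
    exact ℱ.mono tsub_le_self _ (hτ _)
  · have : {ω | τ ω + (t : WithTop ℝ≥0) ≤ j} = ∅ := by
      ext ω
      simp only [mem_ofPred_eq, mem_empty_iff_false, iff_false]
      intro h'
      cases hω : τ ω with
      | top => simp only [hω, WithTop.top_add, top_le_iff, WithTop.coe_ne_top] at h'
      | coe a =>
        rw [hω] at h'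
        norm_cast at h'
        exact h (le_trans le_add_self h')
    rw [this]
    exact @MeasurableSet.empty _ (ℱ j)

lemma isStoppingTime_top {Ω : Type*} {mΩ : MeasurableSpace Ω} (ℱ : Filtration ℝ≥0 mΩ) :
    IsStoppingTime ℱ fun _ => ⊤ := by
  intro j
  simp

section StandardProcess

variable {E Ω : Type*} [MetricSpace E] [ProperSpace E] [MeasurableSpace E] [BorelSpace E]
  {mΩ : MeasurableSpace Ω} {X : ℝ≥0 → Ω → E} {P : E → Measure Ω} {ℱ : Filtration ℝ≥0 mΩ}

lemma IsStandardProcess.progressive (hX : IsStandardProcess X P ℱ) :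
    IsStronglyProgressive ℱ X :=
  isStronglyProgressive_of_rightContinuous hX.adapted hX.right_continuous

lemma IsStandardProcess.measurable_at (hX : IsStandardProcess X P ℱ) (t : ℝ≥0) :
    Measurable (X t) := (hX.adapted t).mono (ℱ.le t) le_rfl

lemma IsStandardProcess.measurable_uncurry (hX : IsStandardProcess X P ℱ) :
    Measurable fun p : ℝ≥0 × Ω => X p.1 p.2 :=
  measurable_uncurry_of_rightContinuous hX.measurable_at hX.right_continuous

lemma IsStandardProcess.measurable_stoppedValue_sub (hX : IsStandardProcess X P ℱ)
    {τ : Ω → WithTop ℝ≥0} (hτ : IsStoppingTime ℱ τ) :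
    Measurable[hτ.measurableSpace] (stoppedValue X τ) :=
  measurable_stoppedValue hX.progressive hτ

lemma IsStandardProcess.measurable_stoppedValue (hX : IsStandardProcess X P ℱ)
    {τ : Ω → WithTop ℝ≥0} (hτ : IsStoppingTime ℱ τ) : Measurable (stoppedValue X τ) :=
  (hX.measurable_stoppedValue_sub hτ).mono hτ.measurableSpace_le le_rfl

/-- The value of the process at an arbitrary measurable random time. -/
lemma IsStandardProcess.measurable_comp (hX : IsStandardProcess X P ℱ) {r : Ω → ℝ≥0}
    (hr : Measurable r) : Measurable fun ω => X (r ω) ω :=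
  hX.measurable_uncurry.comp (hr.prodMk measurable_id)

lemma measurable_untopA_of_isStoppingTime {τ : Ω → WithTop ℝ≥0} (hτ : IsStoppingTime ℱ τ) :
    Measurable fun ω => (τ ω).untopA :=
  hτ.measurable'.untopA

end StandardProcess

/-! ### Hitting times -/

lemma untopA_coe (t : ℝ≥0) : ((t : WithTop ℝ≥0)).untopA = t := rfl

section Hitting

variable {Ω β : Type*} {u : ℝ≥0 → Ω → β} {D D' : Set β} {ω : Ω}

lemma hittingAfter_zero_lt_iff {t : WithTop ℝ≥0} :
    hittingAfter u D 0 ω < t ↔ ∃ r : ℝ≥0, (r : WithTop ℝ≥0) < t ∧ u r ω ∈ D := by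
  constructor
  · intro h
    by_contra! hcon
    have hne : hittingAfter u D 0 ω ≠ ⊤ := (lt_of_lt_of_le h le_top).ne
    rw [Ne, hittingAfter_eq_top_iff] at hne
    push Not at hne
    obtain ⟨j, -, hj⟩ := hne
    rw [hittingAfter, if_pos ⟨j, zero_le, hj⟩] at h
    have hlt : ∃ b ∈ {i : ℝ≥0 | 0 ≤ i ∧ u i ω ∈ D}, (b : WithTop ℝ≥0) < t := by
      cases t with
      | top => exact ⟨j, ⟨zero_le, hj⟩, WithTop.coe_lt_top j⟩
      | coe t =>
        obtain ⟨b, hb, hbt⟩ := exists_lt_of_csInf_lt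
          (s := {i : ℝ≥0 | 0 ≤ i ∧ u i ω ∈ D}) ⟨j, zero_le, hj⟩ (WithTop.coe_lt_coe.1 h)
        exact ⟨b, hb, WithTop.coe_lt_coe.2 hbt⟩
    obtain ⟨b, hb, hbt⟩ := hlt
    exact hcon b hbt hb.2
  · rintro ⟨r, hr, hrD⟩
    exact (hittingAfter_le_of_mem zero_le hrD).trans_lt hr

lemma hittingAfter_zero_anti (h : D ⊆ D') :
    hittingAfter u D' 0 ω ≤ hittingAfter u D 0 ω := by
  refine le_of_forall_gt fun t ht => ?_
  rw [hittingAfter_zero_lt_iff] at ht ⊢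
  obtain ⟨r, hr, hrD⟩ := ht
  exact ⟨r, hr, h hrD⟩

variable [TopologicalSpace β]

lemma mem_closure_of_hittingAfter_ne_top
    (hr : ∀ t, ContinuousWithinAt (fun r => u r ω) (Ici t) t)
    (h : hittingAfter u D 0 ω ≠ ⊤) : u (hittingAfter u D 0 ω).untopA ω ∈ closure D := by
  obtain ⟨t, ht⟩ := WithTop.ne_top_iff_exists.1 h
  rw [← ht, untopA_coe]
  have hfreq : ∃ᶠ r in 𝓝[≥] t, u r ω ∈ D := by
    rw [frequently_iff]
    intro V hV
    obtain ⟨b, hb, hbV⟩ := (mem_nhdsGE_iff_exists_Ico_subset' (lt_add_one t)).1 hV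
    obtain ⟨r, hrb, hrD⟩ := (hittingAfter_zero_lt_iff (u := u) (D := D) (ω := ω)
      (t := (b : WithTop ℝ≥0))).1 (by rw [← ht]; exact WithTop.coe_lt_coe.2 hb)
    refine ⟨r, hbV ⟨?_, WithTop.coe_lt_coe.1 hrb⟩, hrD⟩
    have := hittingAfter_le_of_mem (n := (0 : ℝ≥0)) zero_le hrD
    rw [← ht] at this
    exact WithTop.coe_le_coe.1 this
  exact mem_closure_of_frequently_of_tendsto hfreq (hr t)

lemma mem_of_hittingAfter_ne_top (hD : IsClosed D)
    (hr : ∀ t, ContinuousWithinAt (fun r => u r ω) (Ici t) t)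
    (h : hittingAfter u D 0 ω ≠ ⊤) : u (hittingAfter u D 0 ω).untopA ω ∈ D := by
  simpa [hD.closure_eq] using mem_closure_of_hittingAfter_ne_top hr h

/-- The hitting time of an open set by a right-continuous process is a stopping time of a
right-continuous filtration. -/
lemma isStoppingTime_hittingAfter_of_isOpen [MeasurableSpace β] [BorelSpace β]
    {mΩ : MeasurableSpace Ω} {ℱ : Filtration ℝ≥0 mΩ} [ℱ.IsRightContinuous]
    (hu : Adapted ℱ u) (hr : ∀ ω t, ContinuousWithinAt (fun r => u r ω) (Ici t) t)
    (hD : IsOpen D) : IsStoppingTime ℱ (hittingAfter u D 0) := by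
  refine isStoppingTime_of_measurableSet_lt_of_isRightContinuous fun t => ?_
  obtain ⟨Q, hQc, hQd⟩ := TopologicalSpace.exists_countable_dense ℝ≥0
  have hset : {ω | hittingAfter u D 0 ω < t} =
      ⋃ q ∈ {q ∈ Q | q < t}, u q ⁻¹' D := by
    ext ω
    simp only [mem_ofPred_eq, hittingAfter_zero_lt_iff, mem_iUnion, mem_preimage,
      WithTop.coe_lt_coe, exists_prop]
    constructor
    · rintro ⟨r, hrt, hrD⟩
      have h1 : ∀ᶠ r' in 𝓝[≥] r, u r' ω ∈ D := (hr ω r).eventually (hD.mem_nhds hrD)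
      obtain ⟨b, hb, hbV⟩ := (mem_nhdsGE_iff_exists_Ico_subset' hrt).1 h1
      obtain ⟨q, hqQ, hq⟩ := hQd.exists_between (lt_min hb hrt)
      exact ⟨q, ⟨hqQ, hq.2.trans_le (min_le_right _ _)⟩,
        hbV ⟨hq.1.le, hq.2.trans_le (min_le_left _ _)⟩⟩
    · rintro ⟨q, ⟨-, hqt⟩, hqD⟩
      exact ⟨q, hqt, hqD⟩
  rw [hset]
  refine MeasurableSet.biUnion (hQc.mono fun q hq => hq.1) fun q hq => ?_
  exact ℱ.mono hq.2.le _ (hu q hD.measurableSet)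

end Hitting

lemma tendsto_untopA_of_monotone {τ : ℕ → WithTop ℝ≥0} (hτ : Monotone τ) (h : (⨆ n, τ n) ≠ ⊤) :
    Tendsto (fun n => (τ n).untopA) atTop (𝓝 (⨆ n, τ n).untopA) := by
  have hn : ∀ n, τ n ≠ ⊤ := fun n hn => h (top_le_iff.1 (hn ▸ le_iSup τ n))
  choose t ht using fun n => WithTop.ne_top_iff_exists.1 (hn n)
  obtain ⟨T, hT⟩ := WithTop.ne_top_iff_exists.1 h
  have h1 : ∀ n, (τ n).untopA = t n := fun n => by rw [← ht n, untopA_coe]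
  have hmono : Monotone t := fun i j hij => by
    have := hτ hij
    rw [← ht i, ← ht j] at this
    exact WithTop.coe_le_coe.1 this
  rw [← hT, untopA_coe]
  simp only [h1]
  refine tendsto_atTop_isLUB hmono ⟨?_, ?_⟩
  · rintro _ ⟨n, rfl⟩
    rw [← WithTop.coe_le_coe, ht n, hT]
    exact le_iSup τ n
  · intro B hB
    rw [← WithTop.coe_le_coe, hT]
    refine iSup_le fun n => ?_
    rw [← ht n]
    exact WithTop.coe_le_coe.2 (hB ⟨n, rfl⟩)

section StandardProcess

variable {E Ω : Type*} [MetricSpace E] [ProperSpace E] [MeasurableSpace E] [BorelSpace E]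
  {mΩ : MeasurableSpace Ω} {X : ℝ≥0 → Ω → E} {P : E → Measure Ω} {ℱ : Filtration ℝ≥0 mΩ}

/-- The space-time process `(s + t, X t)`. -/
def spaceTime (X : ℝ≥0 → Ω → E) (s : ℝ≥0) (t : ℝ≥0) (ω : Ω) : ℝ≥0 × E := (s + t, X t ω)

lemma IsStandardProcess.spaceTime_rightContinuous (hX : IsStandardProcess X P ℱ) (s : ℝ≥0) (ω : Ω)
    (t : ℝ≥0) : ContinuousWithinAt (fun r => spaceTime X s r ω) (Ici t) t :=
  ((continuous_const_add s).continuousWithinAt).prodMk (hX.right_continuous ω t)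

lemma IsStandardProcess.spaceTime_adapted (hX : IsStandardProcess X P ℱ) (s : ℝ≥0) :
    Adapted ℱ (spaceTime X s) :=
  fun t => Measurable.prodMk measurable_const (hX.adapted t)

lemma exitTime_eq_hittingAfter (X : ℝ≥0 → Ω → E) (O : Set E) (s : ℝ≥0) :
    exitTime X O = hittingAfter (spaceTime X s) (Prod.snd ⁻¹' Oᶜ) 0 := rfl

lemma isStoppingTime_iSup {τ : ℕ → Ω → WithTop ℝ≥0} (hτ : ∀ n, IsStoppingTime ℱ (τ n)) :
    IsStoppingTime ℱ fun ω => ⨆ n, τ n ω := by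
  intro i
  simp only [iSup_le_iff, ofPred_forall]
  exact MeasurableSet.iInter fun n => hτ n i

/-- The event on which quasi-left-continuity along `τ n` fails. -/
def qlcFailure (X : ℝ≥0 → Ω → E) (τ : ℕ → Ω → WithTop ℝ≥0) : Set Ω :=
  {ω | (⨆ n, τ n ω) ≠ ⊤ ∧ ¬ Tendsto (fun n => stoppedValue X (τ n) ω) atTop
    (𝓝 (stoppedValue X (fun ω => ⨆ n, τ n ω) ω))}

lemma IsStandardProcess.measurableSet_qlcFailure (hX : IsStandardProcess X P ℱ)
    {τ : ℕ → Ω → WithTop ℝ≥0} (hτ : ∀ n, IsStoppingTime ℱ (τ n)) :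
    MeasurableSet (qlcFailure X τ) := by
  refine MeasurableSet.inter (isStoppingTime_iSup hτ).measurableSet_eq_top.compl
    (MeasurableSet.compl ?_)
  change MeasurableSet {ω | Tendsto (fun n => stoppedValue X (τ n) ω) atTop
    (𝓝 (stoppedValue X (fun ω => ⨆ n, τ n ω) ω))}
  have h : ∀ ω, Tendsto (fun n => stoppedValue X (τ n) ω) atTop
      (𝓝 (stoppedValue X (fun ω => ⨆ n, τ n ω) ω)) ↔
      Tendsto (fun n => dist (stoppedValue X (τ n) ω)
        (stoppedValue X (fun ω => ⨆ n, τ n ω) ω)) atTop (𝓝 0) :=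
    fun ω => tendsto_iff_dist_tendsto_zero
  simp only [h]
  exact measurableSet_tendsto _ fun n => (hX.measurable_stoppedValue (hτ n)).dist
    (hX.measurable_stoppedValue (isStoppingTime_iSup hτ))

lemma IsStandardProcess.measure_qlcFailure (hX : IsStandardProcess X P ℱ)
    {τ : ℕ → Ω → WithTop ℝ≥0} (hτ : ∀ n, IsStoppingTime ℱ (τ n)) (hmono : Monotone τ) (x : E) :
    P x (qlcFailure X τ) = 0 := by
  have h := hX.quasi_left_continuous x τ hτ hmono
  rw [ae_iff] at h
  convert h using 2
  ext ω
  simp [qlcFailure]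

/-- Off the exceptional event of quasi-left-continuity, the hitting times of sets `C n` decreasing
to a closed set `D` increase to the hitting time of `D`. -/
lemma IsStandardProcess.iSup_hittingAfter (hX : IsStandardProcess X P ℱ) {s : ℝ≥0}
    {D : Set (ℝ≥0 × E)} {C : ℕ → Set (ℝ≥0 × E)} (hC : Antitone C)
    (hDC : ∀ n, D ⊆ C n) (hCD : ⋂ n, closure (C n) ⊆ D) {ω : Ω}
    (hω : ω ∉ qlcFailure X fun n => hittingAfter (spaceTime X s) (C n) 0) :
    ⨆ n, hittingAfter (spaceTime X s) (C n) 0 ω = hittingAfter (spaceTime X s) D 0 ω := by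
  refine le_antisymm (iSup_le fun n => hittingAfter_zero_anti (hDC n)) ?_
  by_cases htop : (⨆ n, hittingAfter (spaceTime X s) (C n) 0 ω) = ⊤
  · rw [htop]; exact le_top
  have hlim : Tendsto (fun n => stoppedValue X (hittingAfter (spaceTime X s) (C n) 0) ω) atTop
      (𝓝 (stoppedValue X (fun ω => ⨆ n, hittingAfter (spaceTime X s) (C n) 0 ω) ω)) := by
    by_contra hcon
    exact hω ⟨htop, hcon⟩
  have hmono : Monotone fun n => hittingAfter (spaceTime X s) (C n) 0 ω :=
    fun i j hij => hittingAfter_zero_anti (hC hij)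
  have ht := tendsto_untopA_of_monotone hmono htop
  have hY : Tendsto (fun n => spaceTime X s (hittingAfter (spaceTime X s) (C n) 0 ω).untopA ω)
      atTop (𝓝 (spaceTime X s (⨆ n, hittingAfter (spaceTime X s) (C n) 0 ω).untopA ω)) :=
    ((continuous_const_add s).continuousAt.tendsto.comp ht).prodMk_nhds hlim
  have hmem : spaceTime X s (⨆ n, hittingAfter (spaceTime X s) (C n) 0 ω).untopA ω ∈ D := by
    refine hCD (mem_iInter.2 fun m => ?_)
    refine isClosed_closure.mem_of_tendsto hY ?_
    filter_upwards [eventually_ge_atTop m] with n hn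
    refine closure_mono (hC hn) (mem_closure_of_hittingAfter_ne_top
      (hX.spaceTime_rightContinuous s ω) fun h => htop ?_)
    exact top_le_iff.1 (h ▸ le_iSup (fun n => hittingAfter (spaceTime X s) (C n) 0 ω) n)
  have := hittingAfter_le_of_mem (n := (0 : ℝ≥0)) zero_le hmem
  rwa [WithTop.untopA_eq_untop htop, WithTop.coe_untop] at this

/-- The limit of an increasing sequence of hitting times which agrees with a hitting time off the
exceptional event of quasi-left-continuity: completeness of the filtration turns the latter into a
stopping time. -/
lemma IsStandardProcess.isStoppingTime_of_iSup (hX : IsStandardProcess X P ℱ)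
    {τ : ℕ → Ω → WithTop ℝ≥0} (hτ : ∀ n, IsStoppingTime ℱ (τ n)) (hmono : Monotone τ)
    {σ : Ω → WithTop ℝ≥0} (hσ : ∀ ω ∉ qlcFailure X τ, ⨆ n, τ n ω = σ ω) :
    IsStoppingTime ℱ σ := by
  intro t
  have hcompl : ∀ A ⊆ qlcFailure X τ, MeasurableSet[ℱ t] A := fun A hA =>
    hX.filtration_complete _ A (hX.measurableSet_qlcFailure hτ) (hX.measure_qlcFailure hτ hmono)
      hA t
  have hset : {ω | σ ω ≤ t} = ({ω | (⨆ n, τ n ω) ≤ t} \ qlcFailure X τ) ∪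
      ({ω | σ ω ≤ t} ∩ qlcFailure X τ) := by
    ext ω
    by_cases h : ω ∈ qlcFailure X τ
    · simp [h]
    · simp [h, ← hσ ω h]
  rw [hset]
  exact (((isStoppingTime_iSup hτ) t).diff (hcompl _ subset_rfl)).union
    (hcompl _ inter_subset_right)

/-- Open sets decreasing to a closed set. -/
lemma exists_isOpen_antitone_closure {β : Type*} [PseudoMetricSpace β] {D : Set β}
    (hD : IsClosed D) : ∃ C : ℕ → Set β, (∀ n, IsOpen (C n)) ∧ Antitone C ∧ (∀ n, D ⊆ C n) ∧
      ⋂ n, closure (C n) ⊆ D := by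
  refine ⟨fun n => Metric.thickening (1 / ((n : ℝ) + 1)) D, fun n => Metric.isOpen_thickening,
    fun i j hij => Metric.thickening_mono (one_div_le_one_div_of_le (by positivity)
      (by simpa using hij)) D,
    fun n => Metric.self_subset_thickening (by positivity) D, fun y hy => ?_⟩
  rw [← hD.closure_eq, Metric.closure_eq_iInter_cthickening, mem_iInter₂]
  intro ε hε
  obtain ⟨n, hn⟩ := exists_nat_one_div_lt hε
  exact Metric.cthickening_mono hn.le D
    (Metric.closure_thickening_subset_cthickening _ _ (mem_iInter.1 hy n))

/-- The hitting time of a closed set by the space-time process is a stopping time. -/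
lemma IsStandardProcess.isStoppingTime_hittingAfter (hX : IsStandardProcess X P ℱ) (s : ℝ≥0)
    {D : Set (ℝ≥0 × E)} (hD : IsClosed D) :
    IsStoppingTime ℱ (hittingAfter (spaceTime X s) D 0) := by
  obtain ⟨C, hCo, hC, hDC, hCD⟩ := exists_isOpen_antitone_closure hD
  have := hX.filtration_right_continuous
  exact hX.isStoppingTime_of_iSup
    (fun n => isStoppingTime_hittingAfter_of_isOpen (hX.spaceTime_adapted s)
      (hX.spaceTime_rightContinuous s) (hCo n))
    (fun i j hij ω => hittingAfter_zero_anti (hC hij))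
    (fun ω hω => hX.iSup_hittingAfter hC hDC hCD hω)

/-- The hitting times of closed sets `C n` decreasing to `D` increase to the hitting time of `D`
almost surely, and the process converges along them. -/
lemma IsStandardProcess.ae_tendsto_hittingAfter (hX : IsStandardProcess X P ℱ) (s : ℝ≥0)
    {D : Set (ℝ≥0 × E)} {C : ℕ → Set (ℝ≥0 × E)} (hC : Antitone C) (hCc : ∀ n, IsClosed (C n))
    (hCD : ⋂ n, C n = D) (x : E) :
    ∀ᵐ ω ∂P x, ⨆ n, hittingAfter (spaceTime X s) (C n) 0 ω = hittingAfter (spaceTime X s) D 0 ω ∧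
      (hittingAfter (spaceTime X s) D 0 ω ≠ ⊤ →
        Tendsto (fun n => X (hittingAfter (spaceTime X s) (C n) 0 ω).untopA ω) atTop
          (𝓝 (X (hittingAfter (spaceTime X s) D 0 ω).untopA ω))) := by
  have hτ := fun n => hX.isStoppingTime_hittingAfter s (hCc n)
  have hmono : Monotone fun n => hittingAfter (spaceTime X s) (C n) 0 :=
    fun i j hij ω => hittingAfter_zero_anti (hC hij)
  have hDC : ∀ n, D ⊆ C n := fun n => hCD ▸ iInter_subset C n
  have hnull := hX.measure_qlcFailure hτ hmono x
  filter_upwards [measure_eq_zero_iff_ae_notMem.1 hnull] with ω hω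
  have hsup := hX.iSup_hittingAfter hC hDC
    (by simp only [fun n => (hCc n).closure_eq]; exact hCD.subset) hω
  refine ⟨hsup, fun hne => ?_⟩
  by_contra hcon
  refine hω ⟨by rwa [hsup], fun h => hcon ?_⟩
  simp only [stoppedValue, hsup] at h
  exact h

lemma IsStandardProcess.isStoppingTime_exitTime (hX : IsStandardProcess X P ℱ) {O : Set E}
    (hO : IsOpen O) : IsStoppingTime ℱ (exitTime X O) :=
  hX.isStoppingTime_hittingAfter 0 (hO.isClosed_compl.preimage continuous_snd)

lemma mem_of_lt_exitTime {O : Set E} {t : ℝ≥0} {ω : Ω}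
    (h : (t : WithTop ℝ≥0) < exitTime X O ω) : X t ω ∈ O := by
  simpa using notMem_of_lt_hittingAfter h zero_le

lemma IsStandardProcess.notMem_exitTime (hX : IsStandardProcess X P ℱ) {O : Set E}
    (hO : IsOpen O) {ω : Ω} (h : exitTime X O ω ≠ ⊤) : X (exitTime X O ω).untopA ω ∉ O :=
  mem_of_hittingAfter_ne_top hO.isClosed_compl (hX.right_continuous ω) h

lemma exitTime_univ (X : ℝ≥0 → Ω → E) : exitTime X univ = fun _ => ⊤ := by
  simp [exitTime]

end StandardProcess

/-! ### The strong Markov property for path functionals -/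

section Markov

variable {E Ω : Type*} [MetricSpace E] [ProperSpace E] [MeasurableSpace E] [BorelSpace E]
  {mΩ : MeasurableSpace Ω} {X : ℝ≥0 → Ω → E} {P : E → Measure Ω} {ℱ : Filtration ℝ≥0 mΩ}

/-- The transition kernel: the law of `X t` under `P x`. -/
noncomputable def IsStandardProcess.kernel (hX : IsStandardProcess X P ℱ) (t : ℝ≥0) :
    ProbabilityTheory.Kernel E E where
  toFun x := (P x).map (X t)
  measurable' := by
    refine Measure.measurable_of_measurable_coe _ fun B hB => ?_
    simp only [Measure.map_apply (hX.measurable_at t) hB]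
    exact hX.measurable_transition t B hB

lemma IsStandardProcess.kernel_apply (hX : IsStandardProcess X P ℱ) (t : ℝ≥0) (x : E) :
    hX.kernel t x = (P x).map (X t) := rfl

instance IsStandardProcess.isMarkovKernel_kernel (hX : IsStandardProcess X P ℱ) (t : ℝ≥0) :
    ProbabilityTheory.IsMarkovKernel (hX.kernel t) where
  isProbabilityMeasure x := by
    have := hX.isProbabilityMeasure x
    rw [hX.kernel_apply]
    exact Measure.isProbabilityMeasure_map (hX.measurable_at t).aemeasurable

lemma IsStandardProcess.measurable_lintegral (hX : IsStandardProcess X P ℱ) (t : ℝ≥0)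
    {h : ℝ≥0 × E → ℝ≥0∞} (hh : Measurable h) :
    Measurable fun p : ℝ≥0 × E => ∫⁻ ω, h (p.1, X t ω) ∂P p.2 := by
  have h1 : Measurable fun p : ℝ≥0 × E => ∫⁻ y, h (p.1, y) ∂(hX.kernel t p.2) :=
    Measurable.lintegral_kernel_prod_right' (κ := (hX.kernel t).comap Prod.snd measurable_snd)
      (f := fun q : (ℝ≥0 × E) × E => h (q.1.1, q.2)) (by fun_prop)
  convert h1 using 2 with p
  rw [hX.kernel_apply, lintegral_map (by fun_prop) (hX.measurable_at t)]

/-- The strong Markov property for functions of the state at one time after `τ` and of the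
clock. -/
lemma IsStandardProcess.lintegral_strongMarkov (hX : IsStandardProcess X P ℱ) (x : E)
    {τ : Ω → WithTop ℝ≥0} (hτ : IsStoppingTime ℱ τ) (t : ℝ≥0) {A : Set Ω}
    (hA : MeasurableSet[hτ.measurableSpace] A) {h : ℝ≥0 × E → ℝ≥0∞} (hh : Measurable h) :
    ∫⁻ ω in A ∩ {ω | τ ω ≠ ⊤}, h ((τ ω).untopA + t, X ((τ ω).untopA + t) ω) ∂P x =
      ∫⁻ ω in A ∩ {ω | τ ω ≠ ⊤},
        ∫⁻ ω', h ((τ ω).untopA + t, X t ω') ∂P (stoppedValue X τ ω) ∂P x := by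
  have := hX.isProbabilityMeasure x
  have hτm := measurable_untopA_of_isStoppingTime hτ
  have hτt : Measurable fun ω => (τ ω).untopA + t := hτm.add_const t
  have hXτ := hX.measurable_stoppedValue hτ
  have htop : MeasurableSet {ω | τ ω ≠ ⊤} := hτ.measurableSet_eq_top.compl
  have hXt : Measurable fun ω => X ((τ ω).untopA + t) ω := hX.measurable_comp hτt
  set μ := (P x).restrict (A ∩ {ω | τ ω ≠ ⊤}) with hμ
  set η : ProbabilityTheory.Kernel Ω E := (hX.kernel t).comap (stoppedValue X τ) hXτ with hη
  set g : Ω × E → ℝ≥0 × E := fun q => ((τ q.1).untopA + t, q.2) with hg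
  have hgm : Measurable g := (hτt.comp measurable_fst).prodMk measurable_snd
  have hpair : Measurable fun ω => ((τ ω).untopA + t, X ((τ ω).untopA + t) ω) := hτt.prodMk hXt
  have key : μ.map (fun ω => ((τ ω).untopA + t, X ((τ ω).untopA + t) ω)) =
      (μ.compProd η).map g := by
    refine Measure.ext_prod fun {B₁ B₂} hB₁ hB₂ => ?_
    have hA' : MeasurableSet[hτ.measurableSpace] (A ∩ {ω | (τ ω).untopA + t ∈ B₁}) :=
      hA.inter ((hτ.measurable.untopA.add_const t) hB₁)
    have hsm := hX.strong_markov x τ hτ t B₂ hB₂ _ hA'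
    rw [Measure.map_apply hpair (hB₁.prod hB₂), Measure.map_apply hgm (hB₁.prod hB₂),
      Measure.compProd_apply (hgm (hB₁.prod hB₂)), hμ,
      Measure.restrict_apply (hpair (hB₁.prod hB₂))]
    have e1 : (fun ω => ((τ ω).untopA + t, X ((τ ω).untopA + t) ω)) ⁻¹' B₁ ×ˢ B₂ ∩
        (A ∩ {ω | τ ω ≠ ⊤}) = A ∩ {ω | (τ ω).untopA + t ∈ B₁} ∩
        {ω | τ ω ≠ ⊤ ∧ X ((τ ω).untopA + t) ω ∈ B₂} := by
      ext ω
      simp only [mem_inter_iff, mem_preimage, mem_prod, mem_ofPred_eq]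
      tauto
    rw [e1, hsm]
    have e2 : A ∩ {ω | (τ ω).untopA + t ∈ B₁} ∩ {ω | τ ω ≠ ⊤} =
        {ω | (τ ω).untopA + t ∈ B₁} ∩ (A ∩ {ω | τ ω ≠ ⊤}) := by
      ext ω
      simp only [mem_inter_iff, mem_ofPred_eq]
      tauto
    have hB : MeasurableSet {ω | (τ ω).untopA + t ∈ B₁} := hτt hB₁
    rw [e2, ← Measure.restrict_restrict hB, ← lintegral_indicator hB]
    refine lintegral_congr fun ω => ?_
    by_cases hω : (τ ω).untopA + t ∈ B₁
    · rw [indicator_of_mem (by exact hω), hη, ProbabilityTheory.Kernel.comap_apply,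
        hX.kernel_apply, Measure.map_apply (hX.measurable_at t)]
      · congr 1
        ext ω'
        simp [hg, hω]
      · exact measurable_prodMk_left (hgm (hB₁.prod hB₂))
    · rw [indicator_of_notMem (by exact hω)]
      symm
      convert measure_empty (μ := η ω)
      ext y
      simp [hg, hω]
  calc ∫⁻ ω, h ((τ ω).untopA + t, X ((τ ω).untopA + t) ω) ∂μ
      = ∫⁻ q, h q ∂(μ.map fun ω => ((τ ω).untopA + t, X ((τ ω).untopA + t) ω)) :=
        (lintegral_map hh hpair).symm
    _ = ∫⁻ ω, ∫⁻ y, h (g (ω, y)) ∂(η ω) ∂μ := by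
        rw [key, lintegral_map hh hgm, Measure.lintegral_compProd (f := fun q => h (g q)) (by fun_prop)]
    _ = _ := by
        refine lintegral_congr fun ω => ?_
        rw [hη, ProbabilityTheory.Kernel.comap_apply, hX.kernel_apply,
          lintegral_map (f := fun y => h (g (ω, y))) (by fun_prop) (hX.measurable_at t)]

/-- A functional `Θ s r` of the path after time `r`, with the clock started at `s`, that obeys the
strong Markov property: given the past of a stopping time `τ`, the conditional expectation of
`Θ s τ` is the expectation of `Θ (s + τ) 0` for the process started afresh at `X τ`. -/
structure IsMarkovFunctional (X : ℝ≥0 → Ω → E) (P : E → Measure Ω) (ℱ : Filtration ℝ≥0 mΩ)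
    (Θ : ℝ≥0 → ℝ≥0 → Ω → ℝ≥0∞) : Prop where
  measurable : Measurable fun p : ℝ≥0 × ℝ≥0 × Ω => Θ p.1 p.2.1 p.2.2
  measurable_lintegral : Measurable fun p : ℝ≥0 × E => ∫⁻ ω, Θ p.1 0 ω ∂P p.2
  markov : ∀ (s : ℝ≥0) (x : E) (τ : Ω → WithTop ℝ≥0) (hτ : IsStoppingTime ℱ τ) (A : Set Ω),
    MeasurableSet[hτ.measurableSpace] A →
      ∫⁻ ω in A ∩ {ω | τ ω ≠ ⊤}, Θ s (τ ω).untopA ω ∂P x =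
        ∫⁻ ω in A ∩ {ω | τ ω ≠ ⊤},
          ∫⁻ ω', Θ (s + (τ ω).untopA) 0 ω' ∂P (stoppedValue X τ ω) ∂P x

lemma IsStandardProcess.isMarkovFunctional_zero (hX : IsStandardProcess X P ℱ)
    {h : ℝ≥0 × E → ℝ≥0∞} (hh : Measurable h) :
    IsMarkovFunctional X P ℱ fun s r ω => h (s + r, X r ω) where
  measurable := by
    refine hh.comp (Measurable.prodMk (by fun_prop) ?_)
    exact hX.measurable_uncurry.comp measurable_snd
  measurable_lintegral := by simpa using hX.measurable_lintegral 0 hh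
  markov s x τ hτ A hA := by
    have := hX.lintegral_strongMarkov x hτ 0 hA (h := fun p => h (s + p.1, p.2)) (by fun_prop)
    simpa using this

open Classical in
/-- If `Θ` obeys the strong Markov property, so does `Θ` evaluated `δ` later on the event that the
process is then in `F`: apply the property of `Θ` at `τ + δ` and at the constant time `δ`. -/
lemma IsStandardProcess.isMarkovFunctional_step (hX : IsStandardProcess X P ℱ)
    {Θ : ℝ≥0 → ℝ≥0 → Ω → ℝ≥0∞} (hΘ : IsMarkovFunctional X P ℱ Θ) {F : Set E}
    (hF : MeasurableSet F) (δ : ℝ≥0) :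
    IsMarkovFunctional X P ℱ fun s r ω => if X (r + δ) ω ∈ F then Θ s (r + δ) ω else 0 := by
  set φ : ℝ≥0 × E → ℝ≥0∞ := fun p => ∫⁻ ω, Θ p.1 0 ω ∂P p.2 with hφ
  have hφm : Measurable φ := hΘ.measurable_lintegral
  have hm : Measurable fun p : ℝ≥0 × ℝ≥0 × Ω =>
      if X (p.2.1 + δ) p.2.2 ∈ F then Θ p.1 (p.2.1 + δ) p.2.2 else 0 := by
    refine Measurable.ite ?_ ?_ measurable_const
    · have : Measurable fun p : ℝ≥0 × ℝ≥0 × Ω => X (p.2.1 + δ) p.2.2 :=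
        hX.measurable_uncurry.comp
          (f := fun p : ℝ≥0 × ℝ≥0 × Ω => (p.2.1 + δ, p.2.2)) (by fun_prop)
      exact this hF
    · exact hΘ.measurable.comp (f := fun p : ℝ≥0 × ℝ≥0 × Ω => (p.1, p.2.1 + δ, p.2.2))
        (by fun_prop)
  -- the Markov property of `Θ` at `τ + δ`
  have h1 : ∀ (s : ℝ≥0) (x : E) (τ : Ω → WithTop ℝ≥0) (hτ : IsStoppingTime ℱ τ) (A : Set Ω),
      MeasurableSet[hτ.measurableSpace] A →
      ∫⁻ ω in A ∩ {ω | τ ω ≠ ⊤},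
          (if X ((τ ω).untopA + δ) ω ∈ F then Θ s ((τ ω).untopA + δ) ω else 0) ∂P x =
        ∫⁻ ω in A ∩ {ω | τ ω ≠ ⊤}, ∫⁻ ω',
          (if X δ ω' ∈ F then φ (s + ((τ ω).untopA + δ), X δ ω') else 0)
            ∂P (stoppedValue X τ ω) ∂P x := by
    intro s x τ hτ A hA
    have hτδ := isStoppingTime_add_const hτ δ
    have hle : ∀ ω, τ ω ≤ τ ω + δ := fun ω => le_self_add
    have htop : ∀ ω, τ ω + (δ : WithTop ℝ≥0) ≠ ⊤ ↔ τ ω ≠ ⊤ :=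
      fun ω => by rw [Ne, Ne, WithTop.add_eq_top]; simp only [WithTop.coe_ne_top, or_false]
    have hA1 : MeasurableSet[hτδ.measurableSpace] A :=
      IsStoppingTime.measurableSpace_mono hτ hτδ hle _ hA
    have hF1 : MeasurableSet[hτδ.measurableSpace]
        (stoppedValue X (fun ω => τ ω + (δ : WithTop ℝ≥0)) ⁻¹' F) :=
      hX.measurable_stoppedValue_sub hτδ hF
    have huntop : ∀ ω, τ ω ≠ ⊤ → (τ ω + (δ : WithTop ℝ≥0)).untopA = (τ ω).untopA + δ := by
      intro ω hω
      obtain ⟨t, ht⟩ := WithTop.ne_top_iff_exists.1 hω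
      rw [← ht, ← WithTop.coe_add, untopA_coe, untopA_coe]
    have hsm := hΘ.markov s x _ hτδ _ (hA1.inter hF1)
    have hAm : MeasurableSet (A ∩ {ω | τ ω ≠ ⊤}) :=
      (hτ.measurableSpace_le _ hA).inter hτ.measurableSet_eq_top.compl
    have hB : MeasurableSet {ω | X ((τ ω).untopA + δ) ω ∈ F} :=
      hX.measurable_comp ((measurable_untopA_of_isStoppingTime hτ).add_const δ) hF
    have hset : A ∩ stoppedValue X (fun ω => τ ω + (δ : WithTop ℝ≥0)) ⁻¹' F ∩
        {ω | τ ω + (δ : WithTop ℝ≥0) ≠ ⊤} =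
        (A ∩ {ω | τ ω ≠ ⊤}) ∩ {ω | X ((τ ω).untopA + δ) ω ∈ F} := by
      ext ω
      by_cases hω : τ ω = ⊤
      · have h0 := (htop ω).not.2 (not_not.2 hω)
        exact iff_of_false (fun h => h0 h.2) (fun h => h.1.2 hω)
      · simp only [mem_inter_iff, mem_preimage, stoppedValue, huntop ω hω, mem_ofPred_eq,
          htop ω]
        tauto
    have hind : ∀ f : Ω → ℝ≥0∞, ∫⁻ ω in (A ∩ {ω | τ ω ≠ ⊤}) ∩
        {ω | X ((τ ω).untopA + δ) ω ∈ F}, f ω ∂P x =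
        ∫⁻ ω in A ∩ {ω | τ ω ≠ ⊤},
          (if X ((τ ω).untopA + δ) ω ∈ F then f ω else 0) ∂P x := by
      intro f
      rw [inter_comm, ← Measure.restrict_restrict hB, ← lintegral_indicator hB]
      refine lintegral_congr fun ω => ?_
      simp [indicator_apply]
    rw [hset, hind, hind] at hsm
    have hcongr : ∀ f g : Ω → ℝ≥0∞, (∀ ω, τ ω ≠ ⊤ → f ω = g ω) →
        ∫⁻ ω in A ∩ {ω | τ ω ≠ ⊤}, f ω ∂P x = ∫⁻ ω in A ∩ {ω | τ ω ≠ ⊤}, g ω ∂P x :=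
      fun f g hfg => setLIntegral_congr_fun hAm fun ω hω => hfg ω hω.2
    have hM := hX.lintegral_strongMarkov x hτ δ hA
      (h := fun p => if p.2 ∈ F then φ (s + p.1, p.2) else 0)
      (Measurable.ite (measurable_snd hF) (by fun_prop) measurable_const)
    refine Eq.trans ?_ (hsm.trans (Eq.trans ?_ hM))
    · exact hcongr _ _ fun ω hω => by simp only [huntop ω hω]
    · refine hcongr _ _ fun ω hω => ?_
      simp only [huntop ω hω, stoppedValue, hφ]
  -- the same for the process started afresh
  have h2 : ∀ (s : ℝ≥0) (y : E),
      ∫⁻ ω', (if X δ ω' ∈ F then Θ s δ ω' else 0) ∂P y =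
        ∫⁻ ω', (if X δ ω' ∈ F then φ (s + δ, X δ ω') else 0) ∂P y := by
    intro s y
    have := hΘ.markov s y (fun _ => (δ : WithTop ℝ≥0)) (isStoppingTime_const ℱ δ) (X δ ⁻¹' F)
      (hX.measurable_stoppedValue_sub (isStoppingTime_const ℱ δ) hF)
    simp only [untopA_coe, stoppedValue, ne_eq, WithTop.coe_ne_top, not_false_eq_true,
      ofPred_true, inter_univ] at this
    rw [← lintegral_indicator (hX.measurable_at δ hF),
      ← lintegral_indicator (hX.measurable_at δ hF)] at this
    simpa [indicator_apply] using this
  refine ⟨hm, ?_, ?_⟩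
  · simp only [zero_add, h2]
    exact hX.measurable_lintegral δ
      (h := fun p => if p.2 ∈ F then φ (p.1 + δ, p.2) else 0)
      (Measurable.ite (measurable_snd hF) (by fun_prop) measurable_const)
  · intro s x τ hτ A hA
    rw [h1 s x τ hτ A hA]
    simp only [zero_add, h2, add_assoc]

/-- Bounded pointwise limits of Markov functionals are Markov functionals. -/
lemma IsStandardProcess.isMarkovFunctional_of_tendsto (hX : IsStandardProcess X P ℱ)
    {Θ : ℕ → ℝ≥0 → ℝ≥0 → Ω → ℝ≥0∞} {Θ' : ℝ≥0 → ℝ≥0 → Ω → ℝ≥0∞} {C : ℝ≥0∞} (hC : C ≠ ⊤)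
    (hΘ : ∀ k, IsMarkovFunctional X P ℱ (Θ k)) (hbd : ∀ k s r ω, Θ k s r ω ≤ C)
    (hlim : ∀ s r ω, Tendsto (fun k => Θ k s r ω) atTop (𝓝 (Θ' s r ω))) :
    IsMarkovFunctional X P ℱ Θ' := by
  have hP := hX.isProbabilityMeasure
  have hm (k : ℕ) (s : ℝ≥0) {r : Ω → ℝ≥0} (hr : Measurable r) :
      Measurable fun ω => Θ k s (r ω) ω :=
    (hΘ k).measurable.comp (f := fun ω => (s, r ω, ω)) (by fun_prop)
  have hin : ∀ s y, Tendsto (fun k => ∫⁻ ω, Θ k s 0 ω ∂P y) atTop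
      (𝓝 (∫⁻ ω, Θ' s 0 ω ∂P y)) := fun s y =>
    tendsto_lintegral_of_dominated_convergence (fun _ => C)
      (fun k => hm k s measurable_const) (fun k => ae_of_all _ fun ω => hbd k s 0 ω)
      (by simp [hC]) (ae_of_all _ fun ω => hlim s 0 ω)
  refine ⟨?_, ?_, ?_⟩
  · exact measurable_of_tendsto_metrizable (fun k => (hΘ k).measurable)
      (tendsto_pi_nhds.2 fun p => hlim _ _ _)
  · exact measurable_of_tendsto_metrizable (fun k => (hΘ k).measurable_lintegral)
      (tendsto_pi_nhds.2 fun p => hin _ _)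
  · intro s x τ hτ A hA
    have hr := measurable_untopA_of_isStoppingTime hτ
    refine tendsto_nhds_unique (f := fun k => ∫⁻ ω in A ∩ {ω | τ ω ≠ ⊤},
      Θ k s (τ ω).untopA ω ∂P x) (l := atTop) ?_ ?_
    · exact tendsto_lintegral_of_dominated_convergence (fun _ => C) (fun k => hm k s hr)
        (fun k => ae_of_all _ fun ω => hbd k _ _ ω)
        (by simp [hC, ENNReal.mul_eq_top, measure_ne_top]) (ae_of_all _ fun ω => hlim _ _ ω)
    · simp only [(hΘ _).markov s x τ hτ A hA]
      refine tendsto_lintegral_of_dominated_convergence (fun _ => C) (fun k => ?_)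
        (fun k => ae_of_all _ fun ω => ?_)
        (by simp [hC, ENNReal.mul_eq_top, measure_ne_top]) (ae_of_all _ fun ω => hin _ _)
      · exact (hΘ k).measurable_lintegral.comp
          (f := fun ω => (s + (τ ω).untopA, stoppedValue X τ ω))
          ((measurable_const.add hr).prodMk (hX.measurable_stoppedValue hτ))
      · refine (lintegral_mono fun ω' => hbd k _ _ ω').trans ?_
        simp

end Markov

/-! ### The strong Markov property of the killed process -/

section Killed

variable {E Ω : Type*} [MetricSpace E] [ProperSpace E] [MeasurableSpace E] [BorelSpace E]
  {mΩ : MeasurableSpace Ω} {X : ℝ≥0 → Ω → E} {P : E → Measure Ω} {ℱ : Filtration ℝ≥0 mΩ}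

open Classical in
/-- The strong Markov property for the event that the process is in `F` at finitely many equally
spaced times. -/
lemma IsStandardProcess.isMarkovFunctional_grid (hX : IsStandardProcess X P ℱ)
    {F : Set E} (hF : MeasurableSet F) (δ : ℝ≥0) {h : ℝ≥0 × E → ℝ≥0∞} (hh : Measurable h) (N : ℕ) :
    IsMarkovFunctional X P ℱ fun s r ω =>
      if ∀ j < N, X (r + (j + 1) * δ) ω ∈ F then h (s + (r + N * δ), X (r + N * δ) ω) else 0 := by
  induction N with
  | zero => simpa using hX.isMarkovFunctional_zero hh
  | succ N ih =>
    convert hX.isMarkovFunctional_step ih hF δ using 4 with s r ω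
    have e : ∀ j : ℕ, r + δ + (j + 1) * δ = r + ((j + 1 : ℕ) + 1) * δ := fun j => by
      push_cast; ring
    have e' : r + δ + N * δ = r + ((N + 1 : ℕ) : ℝ≥0) * δ := by push_cast; ring
    have hiff : (∀ j < N + 1, X (r + (j + 1) * δ) ω ∈ F) ↔
        X (r + δ) ω ∈ F ∧ ∀ j < N, X (r + δ + (j + 1) * δ) ω ∈ F := by
      simp only [e]
      constructor
      · exact fun H => ⟨by simpa using H 0 (Nat.succ_pos N), fun j hj => H (j + 1) (by omega)⟩
      · rintro ⟨H0, H⟩ (_ | j) hj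
        · simpa using H0
        · exact H j (by omega)
    rw [e']
    by_cases h1 : X (r + δ) ω ∈ F <;> by_cases h2 : ∀ j < N, X (r + δ + (j + 1) * δ) ω ∈ F
    · rw [if_pos (hiff.2 ⟨h1, h2⟩), if_pos h1, if_pos h2]
    · rw [if_neg (fun H => h2 (hiff.1 H).2), if_pos h1, if_neg h2]
    · rw [if_neg (fun H => h1 (hiff.1 H).1), if_neg h1]
    · rw [if_neg (fun H => h1 (hiff.1 H).1), if_neg h1]

/-- A right-continuous path stays in a closed set on `[r, r + t]` as soon as it does so on all
dyadic subdivisions; the left end point may be omitted. -/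
lemma forall_mem_Icc_iff_dyadic {β : Type*} [TopologicalSpace β] {x : ℝ≥0 → β} {F : Set β}
    (hF : IsClosed F) (hx : ∀ t, ContinuousWithinAt x (Ici t) t) (r t : ℝ≥0) :
    (∀ u ∈ Icc r (r + t), x u ∈ F) ↔
      ∀ k j : ℕ, j < 2 ^ k → x (r + (j + 1) * (t / 2 ^ k)) ∈ F := by
  constructor
  · intro h k j hj
    refine h _ ⟨le_self_add, ?_⟩
    have : (j + 1 : ℝ≥0) ≤ 2 ^ k := by exact_mod_cast hj
    calc r + (j + 1) * (t / 2 ^ k) ≤ r + 2 ^ k * (t / 2 ^ k) := by gcongr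
      _ = r + t := by rw [mul_div_cancel₀ _ (by positivity)]
  · intro h u hu
    obtain ⟨v, rfl⟩ := exists_add_of_le hu.1
    have hv : v ≤ t := by simpa using hu.2
    rcases hv.eq_or_lt with rfl | hvt
    · simpa using h 0 0 (by simp)
    have ht : 0 < t := lt_of_le_of_lt zero_le hvt
    set j : ℕ → ℕ := fun k => ⌊v * 2 ^ k / t⌋₊ with hj
    have hjlt : ∀ k, j k < 2 ^ k := fun k => by
      rw [hj, Nat.floor_lt (by positivity)]
      rw [div_lt_iff₀ ht, mul_comm]
      push_cast
      gcongr
    have hlow : ∀ k, v ≤ (j k + 1) * (t / 2 ^ k) := fun k => by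
      have := (Nat.lt_floor_add_one (v * 2 ^ k / t)).le
      rw [div_le_iff₀ ht] at this
      rw [← mul_div_assoc, le_div_iff₀ (by positivity)]
      exact this
    have hup : ∀ k, (j k + 1) * (t / 2 ^ k) ≤ v + t / 2 ^ k := fun k => by
      have := Nat.floor_le (a := v * 2 ^ k / t) zero_le
      rw [add_mul, one_mul]
      gcongr
      rw [le_div_iff₀ ht] at this
      rw [← mul_div_assoc, div_le_iff₀ (by positivity)]
      exact this
    have hlim : Tendsto (fun k => r + (j k + 1) * (t / 2 ^ k)) atTop (𝓝[≥] (r + v)) := by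
      refine tendsto_nhdsWithin_iff.2 ⟨?_, Eventually.of_forall fun k => ?_⟩
      · refine Tendsto.const_add r ?_
        refine tendsto_of_tendsto_of_tendsto_of_le_of_le tendsto_const_nhds
          (h := fun k : ℕ => v + t / 2 ^ k) ?_ hlow hup
        have h0 : Tendsto (fun k : ℕ => t * (1 / 2 : ℝ≥0) ^ k) atTop (𝓝 (t * 0)) :=
          (tendsto_pow_atTop_nhds_zero_of_lt_one zero_le (by norm_num)).const_mul t
        simpa [div_eq_mul_inv] using h0.const_add v
      · exact add_le_add_right (hlow k) r
    exact hF.mem_of_tendsto ((hx (r + v)).tendsto.comp hlim)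
      (Eventually.of_forall fun k => h k (j k) (hjlt k))

lemma dyadic_antitone {β : Type*} {x : ℝ≥0 → β} {F : Set β} {r t : ℝ≥0} {k l : ℕ} (hkl : k ≤ l)
    (h : ∀ j : ℕ, j < 2 ^ l → x (r + (j + 1) * (t / 2 ^ l)) ∈ F) :
    ∀ j : ℕ, j < 2 ^ k → x (r + (j + 1) * (t / 2 ^ k)) ∈ F := by
  intro j hj
  obtain ⟨m, rfl⟩ := Nat.exists_eq_add_of_le hkl
  have hpos : 0 < (j + 1) * 2 ^ m := by positivity
  have hlt : (j + 1) * 2 ^ m - 1 < 2 ^ (k + m) := by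
    have : (j + 1) * 2 ^ m ≤ 2 ^ k * 2 ^ m := Nat.mul_le_mul_right _ hj
    rw [pow_add]
    omega
  have h1 := h _ hlt
  have e : (((j + 1) * 2 ^ m - 1 : ℕ) : ℝ≥0) + 1 = (j + 1) * 2 ^ m := by
    rw [← Nat.cast_succ, Nat.succ_eq_add_one, Nat.sub_add_cancel hpos]
    push_cast
    rfl
  rw [e] at h1
  convert h1 using 3
  rw [pow_add]
  field_simp

open Classical in
/-- The strong Markov property for the event that the process stays in a closed set for a time `t`,
as a limit over dyadic grids. -/
lemma IsStandardProcess.isMarkovFunctional_stay (hX : IsStandardProcess X P ℱ)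
    {F : Set E} (hF : IsClosed F) (t : ℝ≥0) {h : ℝ≥0 × E → ℝ≥0∞} (hh : Measurable h)
    {C : ℝ≥0∞} (hC : C ≠ ⊤) (hhC : ∀ p, h p ≤ C) :
    IsMarkovFunctional X P ℱ fun s r ω =>
      if ∀ u ∈ Icc r (r + t), X u ω ∈ F then h (s + (r + t), X (r + t) ω) else 0 := by
  refine hX.isMarkovFunctional_of_tendsto hC
    (fun k => hX.isMarkovFunctional_grid hF.measurableSet (t / 2 ^ k) hh (2 ^ k)) ?_ ?_
  · intro k s r ω
    split_ifs
    exacts [hhC _, zero_le]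
  · intro s r ω
    have e : ∀ k : ℕ, ((2 ^ k : ℕ) : ℝ≥0) * (t / 2 ^ k) = t := fun k => by
      push_cast
      rw [mul_div_cancel₀ _ (by positivity)]
    simp only [e, forall_mem_Icc_iff_dyadic hF (hX.right_continuous ω) r t]
    by_cases hall : ∀ k j : ℕ, j < 2 ^ k → X (r + (j + 1) * (t / 2 ^ k)) ω ∈ F
    · rw [if_pos hall]
      refine tendsto_const_nhds.congr fun k => ?_
      rw [if_pos (hall k)]
    · rw [if_neg hall]
      push Not at hall
      obtain ⟨k, j, hj, hjF⟩ := hall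
      refine tendsto_const_nhds.congr' ?_
      filter_upwards [eventually_ge_atTop k] with l hl
      rw [if_neg]
      exact fun H => hjF (dyadic_antitone (x := fun u => X u ω) hl H j hj)

open Classical in
/-- The strong Markov property for the event that the process stays in one of the closed sets `F n`
for a time `t`. For an exhaustion of `O` this is survival in `O`. -/
lemma IsStandardProcess.isMarkovFunctional_survive (hX : IsStandardProcess X P ℱ)
    {F : ℕ → Set E} (hF : ∀ n, IsClosed (F n)) (hmono : Monotone F) (t : ℝ≥0)
    {h : ℝ≥0 × E → ℝ≥0∞} (hh : Measurable h) {C : ℝ≥0∞} (hC : C ≠ ⊤) (hhC : ∀ p, h p ≤ C) :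
    IsMarkovFunctional X P ℱ fun s r ω =>
      if ∃ n, ∀ u ∈ Icc r (r + t), X u ω ∈ F n then h (s + (r + t), X (r + t) ω) else 0 := by
  refine hX.isMarkovFunctional_of_tendsto hC
    (fun n => hX.isMarkovFunctional_stay (hF n) t hh hC hhC) ?_ ?_
  · intro k s r ω
    split_ifs
    exacts [hhC _, zero_le]
  · intro s r ω
    by_cases hex : ∃ n, ∀ u ∈ Icc r (r + t), X u ω ∈ F n
    · obtain ⟨n, hn⟩ := hex
      refine tendsto_const_nhds.congr' ?_
      filter_upwards [eventually_ge_atTop n] with m hm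
      rw [if_pos ⟨n, hn⟩, if_pos fun u hu => hmono hm (hn u hu)]
    · rw [if_neg hex]
      push Not at hex
      refine tendsto_const_nhds.congr fun m => ?_
      rw [if_neg]
      push Not
      exact hex m

/-- The open set `O` is exhausted by closed sets `F n` such that almost surely a path that has not
left `O` by time `t` has spent the time up to `t` in one of the `F n`: by quasi-left-continuity it
cannot reach the complement of `O` through its left limits only. -/
lemma IsStandardProcess.exists_exhaustion (hX : IsStandardProcess X P ℱ) {O : Set E}
    (hO : IsOpen O) : ∃ F : ℕ → Set E, (∀ n, IsClosed (F n)) ∧ Monotone F ∧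
      ∀ x, ∀ᵐ ω ∂P x, ∀ t : ℝ≥0, (t : WithTop ℝ≥0) < exitTime X O ω ↔
        ∃ n, ∀ u ≤ t, X u ω ∈ F n := by
  obtain ⟨C, hCo, hC, hDC, hCD⟩ := exists_isOpen_antitone_closure hO.isClosed_compl
  refine ⟨fun n => (C n)ᶜ, fun n => (hCo n).isClosed_compl,
    fun i j hij => compl_subset_compl.2 (hC hij), fun x => ?_⟩
  set C' : ℕ → Set (ℝ≥0 × E) := fun n => Prod.snd ⁻¹' C n with hC'
  have := hX.filtration_right_continuous
  have hτ : ∀ n, IsStoppingTime ℱ (hittingAfter (spaceTime X 0) (C' n) 0) := fun n =>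
    isStoppingTime_hittingAfter_of_isOpen (hX.spaceTime_adapted 0)
      (hX.spaceTime_rightContinuous 0) ((hCo n).preimage continuous_snd)
  have hmono : Monotone fun n => hittingAfter (spaceTime X 0) (C' n) 0 :=
    fun i j hij ω => hittingAfter_zero_anti (preimage_mono (hC hij))
  have hsub : ⋂ n, closure (C' n) ⊆ Prod.snd ⁻¹' Oᶜ := fun y hy =>
    hCD (mem_iInter.2 fun n => (continuous_snd.closure_preimage_subset (C n)) (mem_iInter.1 hy n))
  filter_upwards [measure_eq_zero_iff_ae_notMem.1 (hX.measure_qlcFailure hτ hmono x)] with ω hω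
  have hsup : ⨆ n, hittingAfter (spaceTime X 0) (C' n) 0 ω = exitTime X O ω :=
    hX.iSup_hittingAfter (fun i j hij => preimage_mono (hC hij))
      (fun n => preimage_mono (hDC n)) hsub hω
  intro t
  constructor
  · intro ht
    rw [← hsup, lt_iSup_iff] at ht
    obtain ⟨n, hn⟩ := ht
    refine ⟨n, fun u hu => ?_⟩
    exact notMem_of_lt_hittingAfter (lt_of_le_of_lt (WithTop.coe_le_coe.2 hu) hn) zero_le
  · rintro ⟨n, hn⟩
    by_contra hcon
    rw [not_lt] at hcon
    obtain ⟨e, he⟩ := WithTop.ne_top_iff_exists.1 (ne_top_of_le_ne_top WithTop.coe_ne_top hcon)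
    have hX' := hX.notMem_exitTime hO (by rw [← he]; exact WithTop.coe_ne_top)
    rw [← he] at hX' hcon
    exact hn e (WithTop.coe_le_coe.1 hcon) (hDC n hX')

open Classical in
/-- The strong Markov property of the process killed at the exit from `O`. -/
lemma IsStandardProcess.lintegral_killed (hX : IsStandardProcess X P ℱ) {O : Set E}
    (hO : IsOpen O) (t : ℝ≥0) {h : ℝ≥0 × E → ℝ≥0∞} (hh : Measurable h) {C : ℝ≥0∞} (hC : C ≠ ⊤)
    (hhC : ∀ p, h p ≤ C) (s : ℝ≥0) (x : E) {τ : Ω → WithTop ℝ≥0} (hτ : IsStoppingTime ℱ τ) :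
    ∫⁻ ω, (if τ ω + t < exitTime X O ω then
        h (s + ((τ ω).untopA + t), X ((τ ω).untopA + t) ω) else 0) ∂P x =
      ∫⁻ ω, (if τ ω < exitTime X O ω then
        ∫⁻ ω', (if (t : WithTop ℝ≥0) < exitTime X O ω' then
          h (s + (τ ω).untopA + t, X t ω') else 0) ∂P (stoppedValue X τ ω) else 0) ∂P x := by
  obtain ⟨F, hF, hmono, hFO⟩ := hX.exists_exhaustion hO
  have hMF := hX.isMarkovFunctional_survive hF hmono t hh hC hhC
  have hexit := hX.isStoppingTime_exitTime hO
  have hA : MeasurableSet[hτ.measurableSpace] {ω | τ ω < exitTime X O ω} := by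
    have := (IsStoppingTime.measurableSet_stopping_time_le hexit hτ).compl
    convert this using 1
    ext ω
    simp
  have hA' : MeasurableSet {ω | τ ω < exitTime X O ω} := hτ.measurableSpace_le _ hA
  have key := hMF.markov s x τ hτ _ hA
  have hsub : {ω | τ ω < exitTime X O ω} ∩ {ω | τ ω ≠ ⊤} = {ω | τ ω < exitTime X O ω} :=
    inter_eq_left.2 fun ω hω => ne_top_of_lt hω
  rw [hsub, ← lintegral_indicator hA', ← lintegral_indicator hA'] at key
  refine Eq.trans (lintegral_congr_ae ?_) (key.trans (lintegral_congr fun ω => ?_))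
  · filter_upwards [hFO x] with ω hω
    simp only [indicator_apply, mem_ofPred_eq]
    by_cases h1 : τ ω < exitTime X O ω
    · rw [if_pos h1]
      obtain ⟨r, hr⟩ := WithTop.ne_top_iff_exists.1 (ne_top_of_lt h1)
      rw [← hr] at h1 ⊢
      rw [untopA_coe, ← WithTop.coe_add]
      refine if_congr ((hω (r + t)).trans ⟨?_, ?_⟩) rfl rfl
      · rintro ⟨n, hn⟩
        exact ⟨n, fun u hu => hn u hu.2⟩
      · rintro ⟨n, hn⟩
        obtain ⟨m, hm⟩ := (hω r).1 h1
        refine ⟨max m n, fun u hu => ?_⟩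
        rcases le_total u r with h | h
        · exact hmono (le_max_left _ _) (hm u h)
        · exact hmono (le_max_right _ _) (hn u ⟨h, hu⟩)
    · rw [if_neg h1, if_neg fun h => h1 (lt_of_le_of_lt le_self_add h)]
  · simp only [indicator_apply, mem_ofPred_eq]
    refine if_congr Iff.rfl ?_ rfl
    refine lintegral_congr_ae ?_
    filter_upwards [hFO (stoppedValue X τ ω)] with ω' hω'
    simp only [hω' t, zero_add, mem_Icc, zero_le, true_and]

end Killed

/-! ### The payoff along a path -/

section Payoff

variable {E Ω : Type*} [MetricSpace E] [ProperSpace E] [MeasurableSpace E] [BorelSpace E]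
  {mΩ : MeasurableSpace Ω} {X : ℝ≥0 → Ω → E} {P : E → Measure Ω} {ℱ : Filtration ℝ≥0 mΩ}
  {O : Set E} {α : ℝ}

lemma integrableOn_exp_neg (hα : 0 < α) : IntegrableOn (fun u => Real.exp (-α * u)) (Ioi 0) := by
  simpa using exp_neg_integrableOn_Ioi 0 hα

lemma integral_exp_neg (hα : 0 < α) : ∫ u in Ioi (0 : ℝ), Real.exp (-α * u) = 1 / α := by
  rw [integral_exp_mul_Ioi (neg_lt_zero.2 hα)]
  simp [neg_div_neg_eq]

lemma measurableSet_lt_withTop (θ : WithTop ℝ≥0) :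
    MeasurableSet {u : ℝ | ((u.toNNReal : ℝ≥0) : WithTop ℝ≥0) < θ} := by
  cases θ with
  | top => simp only [WithTop.coe_lt_top, ofPred_true, MeasurableSet.univ]
  | coe a =>
    simp only [WithTop.coe_lt_coe]
    exact measurableSet_lt measurable_real_toNNReal measurable_const

open Classical in
lemma runningReward_eq (X : ℝ≥0 → Ω → E) (α : ℝ) (f : ℝ≥0 × E → ℝ) (s : ℝ≥0) (θ : WithTop ℝ≥0)
    (ω : Ω) : runningReward X α f s θ ω = ∫ u in Ioi (0 : ℝ),
      if ((u.toNNReal : ℝ≥0) : WithTop ℝ≥0) < θ then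
        Real.exp (-α * u) * f (s + u.toNNReal, X u.toNNReal ω) else 0 := by
  have hm := measurableSet_lt_withTop θ
  have hset : {u : ℝ | 0 ≤ u ∧ (u.toNNReal : WithTop ℝ≥0) < θ} =
      Ici 0 ∩ {u : ℝ | ((u.toNNReal : ℝ≥0) : WithTop ℝ≥0) < θ} := rfl
  rw [runningReward, hset, ← setIntegral_indicator hm, integral_Ici_eq_integral_Ioi]
  simp only [indicator_apply, mem_ofPred_eq]

lemma abs_exp_mul_le {f : ℝ≥0 × E → ℝ} {C : ℝ} (hf : ∀ p, |f p| ≤ C) (u : ℝ) (p : ℝ≥0 × E) :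
    |Real.exp (-α * u) * f p| ≤ C * Real.exp (-α * u) := by
  rw [abs_mul, abs_of_pos (Real.exp_pos _), mul_comm]
  exact mul_le_mul_of_nonneg_right (hf p) (Real.exp_pos _).le

lemma IsStandardProcess.measurable_integrand (hX : IsStandardProcess X P ℱ) (α : ℝ)
    {f : ℝ≥0 × E → ℝ} (hf : Measurable f) (s : ℝ≥0) :
    Measurable fun q : ℝ × Ω =>
      Real.exp (-α * q.1) * f (s + q.1.toNNReal, X q.1.toNNReal q.2) := by
  have h1 : Measurable fun q : ℝ × Ω => X q.1.toNNReal q.2 :=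
    hX.measurable_uncurry.comp (f := fun q : ℝ × Ω => (q.1.toNNReal, q.2)) (by fun_prop)
  have h2 : Measurable fun q : ℝ × Ω => f (s + q.1.toNNReal, X q.1.toNNReal q.2) :=
    hf.comp (Measurable.prodMk (by fun_prop) h1)
  exact Measurable.mul (by fun_prop) h2

lemma measurableSet_lt_comp {θ : Ω → WithTop ℝ≥0} (hθ : Measurable θ) :
    MeasurableSet {q : ℝ × Ω | ((q.1.toNNReal : ℝ≥0) : WithTop ℝ≥0) < θ q.2} :=
  measurableSet_lt (measurable_fst.real_toNNReal.withTop_coe) (hθ.comp measurable_snd)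

open Classical in
lemma IsStandardProcess.measurable_integrand_ite (hX : IsStandardProcess X P ℱ) (α : ℝ)
    {f : ℝ≥0 × E → ℝ} (hf : Measurable f) (s : ℝ≥0) {θ : Ω → WithTop ℝ≥0} (hθ : Measurable θ) :
    Measurable fun q : ℝ × Ω => if ((q.1.toNNReal : ℝ≥0) : WithTop ℝ≥0) < θ q.2 then
      Real.exp (-α * q.1) * f (s + q.1.toNNReal, X q.1.toNNReal q.2) else 0 :=
  Measurable.ite (measurableSet_lt_comp hθ) (hX.measurable_integrand α hf s) measurable_const

lemma IsStandardProcess.measurable_runningReward (hX : IsStandardProcess X P ℱ) (α : ℝ)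
    {f : ℝ≥0 × E → ℝ} (hf : Measurable f) (s : ℝ≥0) {θ : Ω → WithTop ℝ≥0} (hθ : Measurable θ) :
    Measurable fun ω => runningReward X α f s (θ ω) ω := by
  simp only [runningReward_eq]
  exact ((hX.measurable_integrand_ite α hf s hθ).stronglyMeasurable.integral_prod_left').measurable

lemma abs_ite_le {p : Prop} [Decidable p] {a c : ℝ} (hc : 0 ≤ c) (h : |a| ≤ c) :
    |if p then a else 0| ≤ c := by
  split_ifs
  · exact h
  · simpa using hc

lemma IsStandardProcess.integrableOn_integrand (hX : IsStandardProcess X P ℱ) (hα : 0 < α)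
    {f : ℝ≥0 × E → ℝ} (hf : Measurable f) {C : ℝ} (hC : ∀ p, |f p| ≤ C) (s : ℝ≥0) (ω : Ω) :
    IntegrableOn (fun u : ℝ => Real.exp (-α * u) * f (s + u.toNNReal, X u.toNNReal ω)) (Ioi 0) := by
  refine ((integrableOn_exp_neg hα).const_mul C).mono' ?_ (ae_of_all _ fun u => ?_)
  · exact ((hX.measurable_integrand α hf s).comp
      (measurable_id.prodMk measurable_const)).aestronglyMeasurable
  · exact abs_exp_mul_le hC u _

open Classical in
lemma IsStandardProcess.integrableOn_integrand_ite (hX : IsStandardProcess X P ℱ) (hα : 0 < α)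
    {f : ℝ≥0 × E → ℝ} (hf : Measurable f) {C : ℝ} (hC : ∀ p, |f p| ≤ C) (s : ℝ≥0)
    (θ : WithTop ℝ≥0) (ω : Ω) :
    IntegrableOn (fun u : ℝ => if ((u.toNNReal : ℝ≥0) : WithTop ℝ≥0) < θ then
      Real.exp (-α * u) * f (s + u.toNNReal, X u.toNNReal ω) else 0) (Ioi 0) := by
  have := (hX.integrableOn_integrand hα hf hC s ω).indicator (measurableSet_lt_withTop θ)
  refine this.congr_fun (fun u _ => ?_) measurableSet_Ioi
  simp only [indicator_apply, mem_ofPred_eq]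

lemma abs_runningReward_le (hα : 0 < α)
    {f : ℝ≥0 × E → ℝ} {C : ℝ} (hC : ∀ p, |f p| ≤ C) (s : ℝ≥0) (θ : WithTop ℝ≥0) (ω : Ω) :
    |runningReward X α f s θ ω| ≤ C / α := by
  have hC0 : 0 ≤ C := (abs_nonneg _).trans (hC (s, X 0 ω))
  rw [runningReward_eq]
  rw [← Real.norm_eq_abs]
  refine (norm_integral_le_of_norm_le ((integrableOn_exp_neg hα).const_mul C)
    (ae_of_all _ fun u => ?_)).trans ?_
  · exact abs_ite_le (mul_nonneg hC0 (Real.exp_pos _).le) (abs_exp_mul_le hC u _)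
  rw [integral_const_mul, integral_exp_neg hα, mul_one_div]

/-- The running reward over `[θ, ∞)` is at most `C / α * e ^ (-α θ)`. -/
lemma IsStandardProcess.abs_runningReward_sub_le (hX : IsStandardProcess X P ℱ) (hα : 0 < α)
    {f : ℝ≥0 × E → ℝ} (hf : Measurable f) {C : ℝ} (hC : ∀ p, |f p| ≤ C) (s : ℝ≥0)
    {θ θ' : WithTop ℝ≥0} (hθ : θ ≤ θ') (hne : θ ≠ ⊤) (ω : Ω) :
    |runningReward X α f s θ' ω - runningReward X α f s θ ω| ≤
      C / α * Real.exp (-α * θ.untopA) := by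
  have hC0 : 0 ≤ C := (abs_nonneg _).trans (hC (s, X 0 ω))
  classical
  obtain ⟨a, rfl⟩ := WithTop.ne_top_iff_exists.1 hne
  rw [untopA_coe, runningReward_eq, runningReward_eq,
    ← integral_sub (hX.integrableOn_integrand_ite hα hf hC s θ' ω)
      (hX.integrableOn_integrand_ite hα hf hC s a ω)]
  have hint : IntegrableOn (fun u => C * Real.exp (-α * u)) (Ici (a : ℝ)) := by
    rw [integrableOn_Ici_iff_integrableOn_Ioi]
    exact (exp_neg_integrableOn_Ioi _ hα).const_mul C
  rw [← Real.norm_eq_abs]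
  refine (norm_integral_le_of_norm_le (hint.integrable_indicator measurableSet_Ici).integrableOn
    ((ae_restrict_iff' measurableSet_Ioi).2 (ae_of_all _ fun u hu => ?_))).trans ?_
  · by_cases hua : ((u.toNNReal : ℝ≥0) : WithTop ℝ≥0) < (a : WithTop ℝ≥0)
    · rw [if_pos (hua.trans_le hθ), if_pos hua, sub_self, norm_zero]
      exact indicator_nonneg (fun u _ => mul_nonneg hC0 (Real.exp_pos _).le) u
    · have : u ∈ Ici (a : ℝ) := by
        rw [WithTop.coe_lt_coe, not_lt] at hua
        exact (Real.le_toNNReal_iff_coe_le (le_of_lt hu)).1 hua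
      rw [if_neg hua, sub_zero, indicator_of_mem this]
      exact abs_ite_le (mul_nonneg hC0 (Real.exp_pos _).le) (abs_exp_mul_le hC u _)
  · rw [setIntegral_indicator measurableSet_Ici]
    calc ∫ u in Ioi (0 : ℝ) ∩ Ici (a : ℝ), C * Real.exp (-α * u)
        ≤ ∫ u in Ici (a : ℝ), C * Real.exp (-α * u) :=
          setIntegral_mono_set hint
            (ae_of_all _ fun u => mul_nonneg hC0 (Real.exp_pos _).le)
            (LE.le.eventuallyLE inter_subset_right)
      _ = C / α * Real.exp (-α * a) := by
          rw [integral_Ici_eq_integral_Ioi, integral_const_mul,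
            integral_exp_mul_Ioi (neg_lt_zero.2 hα)]
          field_simp

lemma runningReward_congr {f f' : ℝ≥0 × E → ℝ} {s : ℝ≥0} {θ : WithTop ℝ≥0} {ω : Ω}
    (h : ∀ u : ℝ≥0, (u : WithTop ℝ≥0) < θ → f (s + u, X u ω) = f' (s + u, X u ω)) :
    runningReward X α f s θ ω = runningReward X α f' s θ ω := by
  rw [runningReward_eq, runningReward_eq]
  refine integral_congr_ae (ae_of_all _ fun u => ?_)
  by_cases hu : ((u.toNNReal : ℝ≥0) : WithTop ℝ≥0) < θ
  · simp only [if_pos hu, h _ hu]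
  · simp only [if_neg hu]

lemma IsStandardProcess.runningReward_add (hX : IsStandardProcess X P ℱ) (hα : 0 < α)
    {f g : ℝ≥0 × E → ℝ} (hf : Measurable f) {C : ℝ} (hC : ∀ p, |f p| ≤ C) (hg : Measurable g)
    {C' : ℝ} (hC' : ∀ p, |g p| ≤ C') (s : ℝ≥0) (θ : WithTop ℝ≥0) (ω : Ω) :
    runningReward X α (fun p => f p + g p) s θ ω =
      runningReward X α f s θ ω + runningReward X α g s θ ω := by
  simp only [runningReward_eq]
  rw [← integral_add (hX.integrableOn_integrand_ite hα hf hC s θ ω)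
    (hX.integrableOn_integrand_ite hα hg hC' s θ ω)]
  refine integral_congr_ae (ae_of_all _ fun u => ?_)
  by_cases hu : ((u.toNNReal : ℝ≥0) : WithTop ℝ≥0) < θ
  · simp only [if_pos hu]; ring
  · simp only [if_neg hu, add_zero]

lemma runningReward_const_mul (c : ℝ) (f : ℝ≥0 × E → ℝ) (s : ℝ≥0) (θ : WithTop ℝ≥0) (ω : Ω) :
    runningReward X α (fun p => c * f p) s θ ω = c * runningReward X α f s θ ω := by
  simp only [runningReward_eq]
  rw [← integral_const_mul]
  refine integral_congr_ae (ae_of_all _ fun u => ?_)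
  by_cases hu : ((u.toNNReal : ℝ≥0) : WithTop ℝ≥0) < θ
  · simp only [if_pos hu]; ring
  · simp only [if_neg hu, mul_zero]

lemma IsStandardProcess.runningReward_mono (hX : IsStandardProcess X P ℱ) (hα : 0 < α)
    {f g : ℝ≥0 × E → ℝ} (hf : Measurable f) {C : ℝ} (hC : ∀ p, |f p| ≤ C) (hg : Measurable g)
    {C' : ℝ} (hC' : ∀ p, |g p| ≤ C') (hfg : ∀ p, f p ≤ g p) (s : ℝ≥0) (θ : WithTop ℝ≥0) (ω : Ω) :
    runningReward X α f s θ ω ≤ runningReward X α g s θ ω := by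
  simp only [runningReward_eq]
  refine integral_mono (hX.integrableOn_integrand_ite hα hf hC s θ ω)
    (hX.integrableOn_integrand_ite hα hg hC' s θ ω) fun u => ?_
  by_cases hu : ((u.toNNReal : ℝ≥0) : WithTop ℝ≥0) < θ
  · simp only [if_pos hu]
    exact mul_le_mul_of_nonneg_left (hfg _) (Real.exp_pos _).le
  · simp only [if_neg hu, le_refl]

lemma discountedPayoff_coe (X : ℝ≥0 → Ω → E) (α : ℝ) (h : ℝ≥0 × E → ℝ) (s t : ℝ≥0) (ω : Ω) :
    discountedPayoff X α h s t ω = Real.exp (-α * t) * h (s + t, X t ω) := by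
  rw [discountedPayoff, if_neg WithTop.coe_ne_top, untopA_coe]

@[simp] lemma discountedPayoff_top (X : ℝ≥0 → Ω → E) (α : ℝ) (h : ℝ≥0 × E → ℝ) (s : ℝ≥0)
    (ω : Ω) : discountedPayoff X α h s ⊤ ω = 0 := if_pos rfl

/-- The discount factor `e ^ (-α θ)`, equal to `0` at `θ = ⊤`. -/
noncomputable def discount (α : ℝ) (θ : WithTop ℝ≥0) : ℝ :=
  open Classical in if θ = ⊤ then 0 else Real.exp (-α * (θ.untopA : ℝ≥0))

@[simp] lemma discount_top : discount α ⊤ = 0 := if_pos rfl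

lemma discount_coe (t : ℝ≥0) : discount α t = Real.exp (-α * t) := by
  rw [discount, if_neg WithTop.coe_ne_top, untopA_coe]

lemma discount_nonneg (θ : WithTop ℝ≥0) : 0 ≤ discount α θ := by
  cases θ with
  | top => simp
  | coe t => rw [discount_coe]; exact (Real.exp_pos _).le

lemma discount_anti (hα : 0 < α) : Antitone (discount α) := by
  intro θ θ' h
  cases θ' with
  | top => simpa using discount_nonneg θ
  | coe t' =>
    obtain ⟨t, rfl⟩ := WithTop.ne_top_iff_exists.1 (ne_top_of_le_ne_top WithTop.coe_ne_top h)
    rw [discount_coe, discount_coe]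
    have : (t : ℝ) ≤ t' := NNReal.coe_le_coe.2 (WithTop.coe_le_coe.1 h)
    exact Real.exp_le_exp.2 (by nlinarith)

lemma discount_le_one (hα : 0 < α) (θ : WithTop ℝ≥0) : discount α θ ≤ 1 := by
  refine (discount_anti hα (zero_le (a := θ))).trans ?_
  have := discount_coe (α := α) 0
  simp at this
  rw [this]

lemma measurable_discount (hα : 0 < α) : Measurable (discount α) := (discount_anti hα).measurable

lemma abs_discountedPayoff_le {h : ℝ≥0 × E → ℝ} {C : ℝ} {s : ℝ≥0} {θ : WithTop ℝ≥0} {ω : Ω}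
    (hC : θ ≠ ⊤ → |h (s + θ.untopA, X θ.untopA ω)| ≤ C) :
    |discountedPayoff X α h s θ ω| ≤ C * discount α θ := by
  cases θ with
  | top => simp
  | coe t =>
    rw [discountedPayoff_coe, discount_coe, abs_mul, abs_of_pos (Real.exp_pos _), mul_comm]
    exact mul_le_mul_of_nonneg_right (hC WithTop.coe_ne_top) (Real.exp_pos _).le

lemma discountedPayoff_add (f g : ℝ≥0 × E → ℝ) (s : ℝ≥0) (θ : WithTop ℝ≥0) (ω : Ω) :
    discountedPayoff X α (fun p => f p + g p) s θ ω =
      discountedPayoff X α f s θ ω + discountedPayoff X α g s θ ω := by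
  cases θ with
  | top => simp
  | coe t => simp only [discountedPayoff_coe]; ring

lemma discountedPayoff_mono {f g : ℝ≥0 × E → ℝ} {s : ℝ≥0} {θ : WithTop ℝ≥0} {ω : Ω}
    (h : θ ≠ ⊤ → f (s + θ.untopA, X θ.untopA ω) ≤ g (s + θ.untopA, X θ.untopA ω)) :
    discountedPayoff X α f s θ ω ≤ discountedPayoff X α g s θ ω := by
  cases θ with
  | top => simp
  | coe t =>
    simp only [discountedPayoff_coe]
    exact mul_le_mul_of_nonneg_left (h WithTop.coe_ne_top) (Real.exp_pos _).le

lemma IsStandardProcess.measurable_discountedPayoff (hX : IsStandardProcess X P ℱ) (α : ℝ)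
    {h : ℝ≥0 × E → ℝ} (hh : Measurable h) (s : ℝ≥0) {θ : Ω → WithTop ℝ≥0} (hθ : Measurable θ) :
    Measurable fun ω => discountedPayoff X α h s (θ ω) ω := by
  have h1 : Measurable fun ω => (θ ω).untopA := hθ.untopA
  have h2 : Measurable fun ω => h (s + (θ ω).untopA, X (θ ω).untopA ω) :=
    hh.comp ((h1.const_add s).prodMk (hX.measurable_comp h1))
  refine Measurable.ite (hθ (measurableSet_singleton ⊤)) measurable_const ?_
  exact Measurable.mul (by fun_prop) h2

open Classical in
/-- The payoff of stopping at time `θ`, along one path: the integrand of `J`. -/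
noncomputable def pathPayoff (X : ℝ≥0 → Ω → E) (O : Set E) (α : ℝ) (f G H : ℝ≥0 × E → ℝ) (s : ℝ≥0)
    (θ : WithTop ℝ≥0) (ω : Ω) : ℝ :=
  runningReward X α f s (min θ (exitTime X O ω)) ω +
    if θ < exitTime X O ω then discountedPayoff X α G s θ ω
    else discountedPayoff X α H s (exitTime X O ω) ω

lemma J_eq (X : ℝ≥0 → Ω → E) (P : E → Measure Ω) (O : Set E) (α : ℝ) (f G H : ℝ≥0 × E → ℝ)
    (s : ℝ≥0) (x : E) (τ : Ω → WithTop ℝ≥0) :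
    J X P O α f G H s x τ = ∫ ω, pathPayoff X O α f G H s (τ ω) ω ∂P x := by
  rfl

end Payoff

/-! ### The functional `J` -/

section Functional

variable {E Ω : Type*} [MetricSpace E] [ProperSpace E] [MeasurableSpace E] [BorelSpace E]
  {mΩ : MeasurableSpace Ω} {X : ℝ≥0 → Ω → E} {P : E → Measure Ω} {ℱ : Filtration ℝ≥0 mΩ}
  {O : Set E} {α : ℝ}

lemma abs_apply_le (f : (ℝ≥0 × E) →ᵇ ℝ) (p : ℝ≥0 × E) : |f p| ≤ ‖f‖ := f.norm_coe_le_norm p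

lemma IsStandardProcess.measurable_pathPayoff (hX : IsStandardProcess X P ℱ) (hO : IsOpen O)
    (α : ℝ) {f G H : ℝ≥0 × E → ℝ} (hf : Measurable f) (hG : Measurable G) (hH : Measurable H)
    (s : ℝ≥0) {θ : Ω → WithTop ℝ≥0} (hθ : Measurable θ) :
    Measurable fun ω => pathPayoff X O α f G H s (θ ω) ω := by
  have hτ := (hX.isStoppingTime_exitTime hO).measurable'
  refine (hX.measurable_runningReward α hf s (hθ.min hτ)).add (Measurable.ite ?_ ?_ ?_)
  · exact measurableSet_lt hθ hτ
  · exact hX.measurable_discountedPayoff α hG s hθ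
  · exact hX.measurable_discountedPayoff α hH s hτ

lemma abs_pathPayoff_le (hα : 0 < α)
    (f G H : (ℝ≥0 × E) →ᵇ ℝ) (s : ℝ≥0) (θ : WithTop ℝ≥0) (ω : Ω) :
    |pathPayoff X O α f G H s θ ω| ≤ ‖f‖ / α + (‖G‖ + ‖H‖) := by
  refine (abs_add_le _ _).trans (add_le_add (abs_runningReward_le hα (abs_apply_le f) _ _ _) ?_)
  have h (h : (ℝ≥0 × E) →ᵇ ℝ) (θ : WithTop ℝ≥0) : |discountedPayoff X α h s θ ω| ≤ ‖h‖ :=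
    (abs_discountedPayoff_le fun _ => abs_apply_le h _).trans
      (mul_le_of_le_one_right (norm_nonneg _) (discount_le_one hα θ))
  split_ifs
  · exact (h G _).trans (by linarith [norm_nonneg H])
  · exact (h H _).trans (by linarith [norm_nonneg G])

lemma IsStandardProcess.integrable_pathPayoff (hX : IsStandardProcess X P ℱ) (hO : IsOpen O)
    (hα : 0 < α) (f G H : (ℝ≥0 × E) →ᵇ ℝ) (s : ℝ≥0) (x : E) {θ : Ω → WithTop ℝ≥0}
    (hθ : Measurable θ) : Integrable (fun ω => pathPayoff X O α f G H s (θ ω) ω) (P x) := by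
  have := hX.isProbabilityMeasure x
  refine Integrable.of_bound (hX.measurable_pathPayoff hO α f.continuous.measurable
    G.continuous.measurable H.continuous.measurable s hθ).aestronglyMeasurable _
    (ae_of_all _ fun ω => abs_pathPayoff_le hα f G H s (θ ω) ω)

lemma abs_integral_le_of_abs_le {μ : Measure Ω} [IsProbabilityMeasure μ] {Z : Ω → ℝ} {C : ℝ}
    (hZ : ∀ ω, |Z ω| ≤ C) : |∫ ω, Z ω ∂μ| ≤ C := by
  have := norm_integral_le_of_norm_le_const (μ := μ)
    (ae_of_all _ fun ω => show ‖Z ω‖ ≤ C from hZ ω)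
  simpa using this

lemma IsStandardProcess.abs_J_le (hX : IsStandardProcess X P ℱ) (hα : 0 < α)
    (f G H : (ℝ≥0 × E) →ᵇ ℝ) (s : ℝ≥0) (x : E) (τ : Ω → WithTop ℝ≥0) :
    |J X P O α f G H s x τ| ≤ ‖f‖ / α + (‖G‖ + ‖H‖) := by
  have := hX.isProbabilityMeasure x
  exact abs_integral_le_of_abs_le fun ω => abs_pathPayoff_le hα f G H s (τ ω) ω

lemma IsStandardProcess.J_add (hX : IsStandardProcess X P ℱ) (hO : IsOpen O)
    (hα : 0 < α) (f G H f' G' H' : (ℝ≥0 × E) →ᵇ ℝ) (s : ℝ≥0) (x : E) {τ : Ω → WithTop ℝ≥0}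
    (hτ : Measurable τ) :
    J X P O α (f + f' :) (G + G' :) (H + H' :) s x τ =
      J X P O α f G H s x τ + J X P O α f' G' H' s x τ := by
  rw [J_eq, J_eq, J_eq, ← integral_add (hX.integrable_pathPayoff hO hα f G H s x hτ)
    (hX.integrable_pathPayoff hO hα f' G' H' s x hτ)]
  refine integral_congr_ae (ae_of_all _ fun ω => ?_)
  simp only [pathPayoff, BoundedContinuousFunction.coe_add, Pi.add_def, discountedPayoff_add,
    hX.runningReward_add hα f.continuous.measurable (abs_apply_le f) f'.continuous.measurable
    (abs_apply_le f')]
  split_ifs <;> ring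

lemma IsStandardProcess.J_mono (hX : IsStandardProcess X P ℱ) (hO : IsOpen O)
    (hα : 0 < α) {f G H f' G' H' : (ℝ≥0 × E) →ᵇ ℝ} (hf : ∀ p, f p ≤ f' p) (hG : ∀ p, G p ≤ G' p)
    (hH : ∀ p, H p ≤ H' p) (s : ℝ≥0) (x : E) {τ : Ω → WithTop ℝ≥0} (hτ : Measurable τ) :
    J X P O α f G H s x τ ≤ J X P O α f' G' H' s x τ := by
  rw [J_eq, J_eq]
  refine integral_mono (hX.integrable_pathPayoff hO hα f G H s x hτ)
    (hX.integrable_pathPayoff hO hα f' G' H' s x hτ) fun ω => ?_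
  refine add_le_add (hX.runningReward_mono hα f.continuous.measurable (abs_apply_le f)
    f'.continuous.measurable (abs_apply_le f') hf _ _ _) ?_
  split_ifs
  · exact discountedPayoff_mono fun _ => hG _
  · exact discountedPayoff_mono fun _ => hH _

/-! ### The killed semigroup on space-time functions -/

open Classical in
/-- The semigroup of the space-time process killed at the exit from `O`. -/
noncomputable def killedSemigroup (X : ℝ≥0 → Ω → E) (P : E → Measure Ω) (O : Set E) (t : ℝ≥0)
    (h : ℝ≥0 × E → ℝ) (p : ℝ≥0 × E) : ℝ :=
  ∫ ω, (if (t : WithTop ℝ≥0) < exitTime X O ω then h (p.1 + t, X t ω) else 0) ∂P p.2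

/-- The resolvent of the space-time process killed at the exit from `O`: the expected running
reward up to the exit. -/
noncomputable def resolvent (X : ℝ≥0 → Ω → E) (P : E → Measure Ω) (O : Set E) (α : ℝ)
    (h : ℝ≥0 × E → ℝ) (p : ℝ≥0 × E) : ℝ :=
  ∫ ω, runningReward X α h p.1 (exitTime X O ω) ω ∂P p.2

open Classical in
lemma IsStandardProcess.measurable_killed (hX : IsStandardProcess X P ℱ) (hO : IsOpen O) (t : ℝ≥0)
    {h : ℝ≥0 × E → ℝ} (hh : Measurable h) (s : ℝ≥0) :
    Measurable fun ω =>
      if (t : WithTop ℝ≥0) < exitTime X O ω then h (s + t, X t ω) else 0 := by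
  refine Measurable.ite ?_ (hh.comp (measurable_const.prodMk (hX.measurable_at t)))
    measurable_const
  exact measurableSet_lt measurable_const (hX.isStoppingTime_exitTime hO).measurable'

open Classical in
lemma IsStandardProcess.integrable_killed (hX : IsStandardProcess X P ℱ) (hO : IsOpen O) (t : ℝ≥0)
    (h : (ℝ≥0 × E) →ᵇ ℝ) (s : ℝ≥0) (x : E) :
    Integrable (fun ω =>
      if (t : WithTop ℝ≥0) < exitTime X O ω then h (s + t, X t ω) else 0) (P x) := by
  have := hX.isProbabilityMeasure x
  exact Integrable.of_bound (hX.measurable_killed hO t h.continuous.measurable s).aestronglyMeasurable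
    ‖h‖ (ae_of_all _ fun ω => abs_ite_le (norm_nonneg _) (abs_apply_le h _))

lemma IsStandardProcess.abs_killedSemigroup_le (hX : IsStandardProcess X P ℱ) (t : ℝ≥0)
    (h : (ℝ≥0 × E) →ᵇ ℝ) (p : ℝ≥0 × E) : |killedSemigroup X P O t h p| ≤ ‖h‖ := by
  have := hX.isProbabilityMeasure p.2
  exact abs_integral_le_of_abs_le fun ω => abs_ite_le (norm_nonneg _) (abs_apply_le h _)

/-- A continuous function vanishing at infinity with values in `[0, 1]`, equal to `1` on the ball
of radius `k` about `c` and to `0` off the ball of radius `k + 1`. -/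
noncomputable def cutoff (c : E) (k : ℕ) : C₀(E, ℝ) where
  toFun y := max 0 (min 1 (k + 1 - dist y c))
  continuous_toFun := by fun_prop
  zero_at_infty' := by
    have h : Tendsto (fun y => dist y c) (cocompact E) atTop := tendsto_dist_right_cocompact_atTop c
    refine tendsto_const_nhds.congr' ?_
    filter_upwards [h.eventually_ge_atTop ((k : ℝ) + 1)] with y hy
    rw [max_eq_left]
    exact (min_le_right _ _).trans (by linarith)

lemma cutoff_apply (c : E) (k : ℕ) (y : E) :
    cutoff c k y = max 0 (min 1 (k + 1 - dist y c)) := rfl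

lemma cutoff_nonneg (c : E) (k : ℕ) (y : E) : 0 ≤ cutoff c k y := le_max_left _ _

lemma cutoff_le_one (c : E) (k : ℕ) (y : E) : cutoff c k y ≤ 1 :=
  max_le zero_le_one (min_le_left _ _)

lemma cutoff_eq_zero {c : E} {k : ℕ} {y : E} (hy : y ∉ Metric.closedBall c (k + 1)) :
    cutoff c k y = 0 := by
  rw [cutoff_apply, max_eq_left]
  rw [Metric.mem_closedBall, not_le] at hy
  exact (min_le_right _ _).trans (by linarith)

lemma tendsto_cutoff (c y : E) : Tendsto (fun k => cutoff c k y) atTop (𝓝 1) := by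
  refine tendsto_const_nhds.congr' ?_
  obtain ⟨n, hn⟩ := exists_nat_ge (dist y c)
  filter_upwards [eventually_ge_atTop n] with k hk
  have : (n : ℝ) ≤ k := by exact_mod_cast hk
  rw [cutoff_apply, min_eq_left (by linarith), max_eq_right zero_le_one]

lemma IsStandardProcess.tendsto_integral_cutoff (hX : IsStandardProcess X P ℱ) (t : ℝ≥0)
    (c x : E) : Tendsto (fun k => ∫ ω, cutoff c k (X t ω) ∂P x) atTop (𝓝 1) := by
  have := hX.isProbabilityMeasure x
  have h := tendsto_integral_of_dominated_convergence (μ := P x)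
    (F := fun k ω => cutoff c k (X t ω)) (f := fun _ => (1 : ℝ)) (fun _ => 1)
    (fun k => ((cutoff c k).continuous.measurable.comp
      (hX.measurable_at t)).aestronglyMeasurable) (integrable_const _)
    (fun k => ae_of_all _ fun ω => by
      rw [Real.norm_eq_abs, abs_of_nonneg (cutoff_nonneg _ _ _)]; exact cutoff_le_one _ _ _)
    (ae_of_all _ fun ω => tendsto_cutoff c _)
  simpa using h

lemma eventually_dist_lt_of_isCompact {β γ : Type*} [TopologicalSpace β] [TopologicalSpace γ]
    (h : β × γ → ℝ) (hh : Continuous h) {K : Set γ} (hK : IsCompact K) (b : β) {η : ℝ}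
    (hη : 0 < η) : ∀ᶠ b' in 𝓝 b, ∀ y ∈ K, |h (b', y) - h (b, y)| < η := by
  refine hK.eventually_forall_of_forall_eventually fun y _ => ?_
  have hc : Continuous fun q : β × γ => |h q - h (b, q.2)| := by fun_prop
  have : |h (b, y) - h (b, y)| < η := by simpa using hη
  exact hc.continuousAt.eventually (gt_mem_nhds this)

/-- The killed semigroup maps bounded continuous functions on space-time to continuous
functions. -/
lemma IsStandardProcess.continuous_killedSemigroup (hX : IsStandardProcess X P ℱ)
    (hF : IsWeakFeller X P) (hO : IsOpen O) (hA : StoppedSemigroupFeller X P O) {t : ℝ≥0}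
    (ht : 0 < t) (h : (ℝ≥0 × E) →ᵇ ℝ) : Continuous (killedSemigroup X P O t h) := by
  classical
  rw [continuous_iff_continuousAt]
  rintro ⟨s₀, x₀⟩
  rw [ContinuousAt, Metric.tendsto_nhds]
  intro ε hε
  have hprob := hX.isProbabilityMeasure
  set C := 2 * ‖h‖ + 1 with hC
  have hCpos : 0 < C := by positivity
  -- all but a small part of the mass of `X t` is caught by a cutoff function
  obtain ⟨k, hk⟩ : ∃ k, 1 - ε / (4 * C) < ∫ ω, cutoff x₀ k (X t ω) ∂P x₀ :=
    ((hX.tendsto_integral_cutoff t x₀ x₀).eventually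
      (lt_mem_nhds (by have : 0 < ε / (4 * C) := by positivity
                       linarith))).exists
  obtain ⟨g, hg⟩ := hF t (cutoff x₀ k)
  have h1 : ∀ᶠ x in 𝓝 x₀, 1 - ε / (4 * C) < ∫ ω, cutoff x₀ k (X t ω) ∂P x := by
    simp only [← hg] at hk ⊢
    exact g.continuous.continuousAt.eventually (lt_mem_nhds hk)
  let h₀ : E →ᵇ ℝ := h.compContinuous ⟨fun y => (s₀ + t, y), by fun_prop⟩
  obtain ⟨g₀, hg₀⟩ := hA t ht h₀
  have h2 : ∀ᶠ x in 𝓝 x₀, |g₀ x - g₀ x₀| < ε / 4 :=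
    Metric.tendsto_nhds.1 g₀.continuous.continuousAt (ε / 4) (by positivity)
  have h3 : ∀ᶠ s in 𝓝 s₀, ∀ y ∈ Metric.closedBall x₀ ((k : ℝ) + 1),
      |h (s + t, y) - h (s₀ + t, y)| < ε / 4 :=
    eventually_dist_lt_of_isCompact (fun q : ℝ≥0 × E => h (q.1 + t, q.2)) (by fun_prop)
      (isCompact_closedBall _ _) s₀ (by positivity)
  rw [nhds_prod_eq]
  filter_upwards [h3.prod_mk (h1.and h2)] with ⟨s, x⟩ ⟨hs, hx1, hx2⟩
  have hT₀ : ∀ x, killedSemigroup X P O t h (s₀, x) = g₀ x := fun x => (hg₀ x).symm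
  have hcut : Integrable (fun ω => cutoff x₀ k (X t ω)) (P x) :=
    Integrable.of_bound ((cutoff x₀ k).continuous.measurable.comp
      (hX.measurable_at t)).aestronglyMeasurable 1 (ae_of_all _ fun ω => by
      rw [Real.norm_eq_abs, abs_of_nonneg (cutoff_nonneg _ _ _)]; exact cutoff_le_one _ _ _)
  have hstep : |killedSemigroup X P O t h (s, x) - killedSemigroup X P O t h (s₀, x)| ≤
      ε / 4 + C * (1 - ∫ ω, cutoff x₀ k (X t ω) ∂P x) := by
    rw [killedSemigroup, killedSemigroup, ← integral_sub (hX.integrable_killed hO t h s x)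
      (hX.integrable_killed hO t h s₀ x), ← Real.norm_eq_abs]
    refine (norm_integral_le_of_norm_le (g := fun ω => ε / 4 + C * (1 - cutoff x₀ k (X t ω)))
      ?_ (ae_of_all _ fun ω => ?_)).trans (le_of_eq ?_)
    · exact (integrable_const _).add (((integrable_const _).sub hcut).const_mul C)
    · have hcut1 := cutoff_le_one x₀ k (X t ω)
      by_cases hω : (t : WithTop ℝ≥0) < exitTime X O ω
      · rw [if_pos hω, if_pos hω, Real.norm_eq_abs]
        by_cases hy : X t ω ∈ Metric.closedBall x₀ ((k : ℝ) + 1)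
        · exact (hs _ hy).le.trans (le_add_of_nonneg_right
            (mul_nonneg hCpos.le (by linarith)))
        · rw [cutoff_eq_zero hy]
          have := abs_sub (h (s + t, X t ω)) (h (s₀ + t, X t ω))
          have b1 := abs_apply_le h (s + t, X t ω)
          have b2 := abs_apply_le h (s₀ + t, X t ω)
          linarith
      · rw [if_neg hω, if_neg hω, sub_self, norm_zero]
        exact add_nonneg (by positivity) (mul_nonneg hCpos.le (by linarith))
    · have hsub : Integrable (fun ω => C * (1 - cutoff x₀ k (X t ω))) (P x) :=
        ((integrable_const _).sub hcut).const_mul C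
      rw [integral_add (integrable_const _) hsub, integral_const_mul, integral_sub (integrable_const _) hcut]
      simp
  have hsmall : C * (1 - ∫ ω, cutoff x₀ k (X t ω) ∂P x) < ε / 4 := by
    have : 1 - ∫ ω, cutoff x₀ k (X t ω) ∂P x < ε / (4 * C) := by linarith
    calc C * (1 - ∫ ω, cutoff x₀ k (X t ω) ∂P x) < C * (ε / (4 * C)) := by gcongr
      _ = ε / 4 := by field_simp
  rw [Real.dist_eq]
  rw [← hT₀, ← hT₀] at hx2
  calc |killedSemigroup X P O t h (s, x) - killedSemigroup X P O t h (s₀, x₀)|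
      ≤ |killedSemigroup X P O t h (s, x) - killedSemigroup X P O t h (s₀, x)| +
        |killedSemigroup X P O t h (s₀, x) - killedSemigroup X P O t h (s₀, x₀)| :=
        abs_sub_le _ _ _
    _ < ε := by linarith

/-- A weakly Feller process satisfies the continuity assumption for the whole space. -/
lemma IsStandardProcess.stoppedSemigroupFeller_univ (hX : IsStandardProcess X P ℱ)
    (hF : IsWeakFeller X P) : StoppedSemigroupFeller X P univ := by
  classical
  intro t _ h
  have hprob := hX.isProbabilityMeasure
  have hval : ∀ x, stoppedSemigroup X P univ t h x = ∫ ω, h (X t ω) ∂P x := fun x => by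
    simp only [stoppedSemigroup, exitTime_univ, WithTop.coe_lt_top, if_true]
  have hint : ∀ x, Integrable (fun ω => h (X t ω)) (P x) := fun x =>
    Integrable.of_bound (h.continuous.measurable.comp (hX.measurable_at t)).aestronglyMeasurable
      ‖h‖ (ae_of_all _ fun ω => h.norm_coe_le_norm _)
  have hcont : Continuous (stoppedSemigroup X P univ t h) := by
    rw [continuous_iff_continuousAt]
    intro x₀
    rw [ContinuousAt, Metric.tendsto_nhds]
    intro ε hε
    set C := ‖h‖ + 1 with hC
    have hCpos : 0 < C := by positivity
    obtain ⟨k, hk⟩ : ∃ k, 1 - ε / (4 * C) < ∫ ω, cutoff x₀ k (X t ω) ∂P x₀ :=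
      ((hX.tendsto_integral_cutoff t x₀ x₀).eventually
        (lt_mem_nhds (by have : 0 < ε / (4 * C) := by positivity
                         linarith))).exists
    obtain ⟨g, hg⟩ := hF t (cutoff x₀ k)
    have h1 : ∀ᶠ x in 𝓝 x₀, 1 - ε / (4 * C) < ∫ ω, cutoff x₀ k (X t ω) ∂P x := by
      simp only [← hg] at hk ⊢
      exact g.continuous.continuousAt.eventually (lt_mem_nhds hk)
    let hk₀ : C₀(E, ℝ) := ⟨⟨fun y => h y * cutoff x₀ k y,
      h.continuous.mul (cutoff x₀ k).continuous⟩, by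
        refine squeeze_zero_norm (a := fun y => ‖h‖ * cutoff x₀ k y) (fun y => ?_) ?_
        · rw [norm_mul, Real.norm_of_nonneg (cutoff_nonneg _ _ _)]
          exact mul_le_mul_of_nonneg_right (h.norm_coe_le_norm y) (cutoff_nonneg _ _ _)
        · simpa using (cutoff x₀ k).zero_at_infty'.const_mul ‖h‖⟩
    obtain ⟨g₀, hg₀⟩ := hF t hk₀
    have h2 : ∀ᶠ x in 𝓝 x₀, |g₀ x - g₀ x₀| < ε / 4 :=
      Metric.tendsto_nhds.1 g₀.continuous.continuousAt (ε / 4) (by positivity)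
    have hcut : ∀ x, Integrable (fun ω => cutoff x₀ k (X t ω)) (P x) := fun x =>
      Integrable.of_bound ((cutoff x₀ k).continuous.measurable.comp
        (hX.measurable_at t)).aestronglyMeasurable 1 (ae_of_all _ fun ω => by
        rw [Real.norm_eq_abs, abs_of_nonneg (cutoff_nonneg _ _ _)]; exact cutoff_le_one _ _ _)
    have hcut₀ : ∀ x, Integrable (fun ω => hk₀ (X t ω)) (P x) := fun x =>
      Integrable.of_bound (hk₀.continuous.measurable.comp
        (hX.measurable_at t)).aestronglyMeasurable ‖h‖ (ae_of_all _ fun ω => by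
        change ‖h (X t ω) * cutoff x₀ k (X t ω)‖ ≤ ‖h‖
        rw [norm_mul, Real.norm_of_nonneg (cutoff_nonneg _ _ _)]
        exact (mul_le_mul (h.norm_coe_le_norm _) (cutoff_le_one _ _ _) (cutoff_nonneg _ _ _)
          (norm_nonneg _)).trans (by simp))
    have key : ∀ x, 1 - ε / (4 * C) < ∫ ω, cutoff x₀ k (X t ω) ∂P x →
        |stoppedSemigroup X P univ t h x - g₀ x| < ε / 4 := by
      intro x hx
      rw [hval, hg₀, ← integral_sub (hint x) (hcut₀ x), ← Real.norm_eq_abs]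
      refine (norm_integral_le_of_norm_le (g := fun ω => C * (1 - cutoff x₀ k (X t ω)))
        (((integrable_const _).sub (hcut x)).const_mul C) (ae_of_all _ fun ω => ?_)).trans_lt ?_
      · change ‖h (X t ω) - h (X t ω) * cutoff x₀ k (X t ω)‖ ≤ _
        rw [← mul_one_sub, norm_mul,
          Real.norm_of_nonneg (r := 1 - cutoff x₀ k (X t ω)) (by linarith [cutoff_le_one x₀ k (X t ω)])]
        refine mul_le_mul_of_nonneg_right ?_ (by linarith [cutoff_le_one x₀ k (X t ω)])
        linarith [h.norm_coe_le_norm (X t ω)]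
      · rw [integral_const_mul, integral_sub (integrable_const _) (hcut x)]
        simp only [integral_const, probReal_univ, smul_eq_mul, mul_one]
        calc C * (1 - ∫ ω, cutoff x₀ k (X t ω) ∂P x) < C * (ε / (4 * C)) := by
              gcongr
              linarith
          _ = ε / 4 := by field_simp
    filter_upwards [h1, h2] with x hx1 hx2
    rw [Real.dist_eq]
    have e1 := key x hx1
    have e2 := key x₀ hk
    rw [abs_lt] at *
    constructor <;> linarith [e1.1, e1.2, e2.1, e2.2, hx2.1, hx2.2]
  refine ⟨BoundedContinuousFunction.ofNormedAddCommGroup _ hcont ‖h‖ fun x => ?_, fun x => rfl⟩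
  exact abs_integral_le_of_abs_le fun ω => abs_ite_le (norm_nonneg _) (h.norm_coe_le_norm _)

end Functional

/-! ### The resolvent of the killed process -/

section Resolvent

variable {E Ω : Type*} [MetricSpace E] [ProperSpace E] [MeasurableSpace E] [BorelSpace E]
  {mΩ : MeasurableSpace Ω} {X : ℝ≥0 → Ω → E} {P : E → Measure Ω} {ℱ : Filtration ℝ≥0 mΩ}
  {O : Set E} {α : ℝ}

lemma IsStandardProcess.killedSemigroup_rightContinuous (hX : IsStandardProcess X P ℱ)
    (hO : IsOpen O) (h : (ℝ≥0 × E) →ᵇ ℝ) (p : ℝ≥0 × E) (t : ℝ≥0) :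
    ContinuousWithinAt (fun r => killedSemigroup X P O r h p) (Ici t) t := by
  classical
  have := hX.isProbabilityMeasure p.2
  refine continuousWithinAt_of_dominated (bound := fun _ => ‖h‖)
    (Eventually.of_forall fun r =>
      (hX.measurable_killed hO r h.continuous.measurable p.1).aestronglyMeasurable)
    (Eventually.of_forall fun r => ae_of_all _ fun ω =>
      abs_ite_le (norm_nonneg _) (abs_apply_le h _)) (integrable_const _)
    (ae_of_all _ fun ω => ?_)
  by_cases ht : (t : WithTop ℝ≥0) < exitTime X O ω
  · have hopen : ∀ᶠ r : ℝ≥0 in 𝓝[≥] t, (r : WithTop ℝ≥0) < exitTime X O ω :=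
      mem_nhdsWithin_of_mem_nhds
        ((isOpen_Iio.preimage WithTop.continuous_coe).mem_nhds ht)
    have hc : ContinuousWithinAt (fun r => h (p.1 + r, X r ω)) (Ici t) t :=
      h.continuous.continuousAt.comp_continuousWithinAt (hX.spaceTime_rightContinuous p.1 ω t)
    refine hc.congr_of_eventuallyEq ?_ (if_pos ht)
    filter_upwards [hopen] with r hr
    exact if_pos hr
  · refine (continuousWithinAt_const (b := (0 : ℝ))).congr (fun r hr => if_neg fun h => ht ?_)
      (if_neg ht)
    exact lt_of_le_of_lt (WithTop.coe_le_coe.2 hr) h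

/-- The standing assumptions: a weakly Feller standard process and an open set `O` whose killed
semigroup preserves bounded continuous functions. -/
structure FellerData (X : ℝ≥0 → Ω → E) (P : E → Measure Ω) (ℱ : Filtration ℝ≥0 mΩ) (O : Set E) :
    Prop where
  std : IsStandardProcess X P ℱ
  feller : IsWeakFeller X P
  isOpen : IsOpen O
  killed : StoppedSemigroupFeller X P O

/-- The standing assumptions also hold for the process without killing: then `exitTime` is `⊤`. -/
lemma FellerData.unkilled (hD : FellerData X P ℱ O) : FellerData X P ℱ univ :=
  ⟨hD.std, hD.feller, isOpen_univ, hD.std.stoppedSemigroupFeller_univ hD.feller⟩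

lemma FellerData.measurable_exit (hD : FellerData X P ℱ O) : Measurable (exitTime X O) :=
  (hD.std.isStoppingTime_exitTime hD.isOpen).measurable'

lemma FellerData.measurable_killedSemigroup (hD : FellerData X P ℱ O) (h : (ℝ≥0 × E) →ᵇ ℝ)
    (t : ℝ≥0) : Measurable (killedSemigroup X P O t h) := by
  refine measurable_of_tendsto_metrizable
    (f := fun n p => killedSemigroup X P O (rightApprox n t) h p) (fun n => ?_)
    (tendsto_pi_nhds.2 fun p => ?_)
  · exact (hD.std.continuous_killedSemigroup hD.feller hD.isOpen hD.killed
      (lt_of_le_of_lt zero_le (lt_rightApprox n t)) h).measurable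
  · exact (hD.std.killedSemigroup_rightContinuous hD.isOpen h p t).tendsto.comp
      (tendsto_rightApprox t)

lemma FellerData.measurable_uncurry_killedSemigroup (hD : FellerData X P ℱ O)
    (h : (ℝ≥0 × E) →ᵇ ℝ) :
    Measurable fun q : ℝ≥0 × (ℝ≥0 × E) => killedSemigroup X P O q.1 h q.2 :=
  measurable_uncurry_of_rightContinuous (u := fun t p => killedSemigroup X P O t h p)
    (fun t => hD.measurable_killedSemigroup h t)
    fun p t => hD.std.killedSemigroup_rightContinuous hD.isOpen h p t

lemma integrable_of_abs_le_exp {μ : Measure Ω} [IsFiniteMeasure μ] (hα : 0 < α) {C : ℝ}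
    {F : ℝ × Ω → ℝ} (hF : Measurable F) (hb : ∀ q, |F q| ≤ C * Real.exp (-α * q.1)) :
    Integrable F ((volume.restrict (Ioi (0 : ℝ))).prod μ) := by
  have h1 : Integrable (fun q : ℝ × Ω => (C * Real.exp (-α * q.1)) * 1)
      ((volume.restrict (Ioi (0 : ℝ))).prod μ) :=
    Integrable.mul_prod (f := fun u : ℝ => C * Real.exp (-α * u)) (g := fun _ : Ω => (1 : ℝ))
      ((integrableOn_exp_neg hα).const_mul C) (integrable_const _)
  refine h1.mono' hF.aestronglyMeasurable (ae_of_all _ fun q => ?_)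
  rw [mul_one]
  exact hb q

lemma integral_swap_of_abs_le_exp {μ : Measure Ω} [IsFiniteMeasure μ] (hα : 0 < α) {C : ℝ}
    {F : ℝ → Ω → ℝ} (hF : Measurable fun q : ℝ × Ω => F q.1 q.2)
    (hb : ∀ u ω, |F u ω| ≤ C * Real.exp (-α * u)) :
    ∫ ω, (∫ u in Ioi (0 : ℝ), F u ω) ∂μ = ∫ u in Ioi (0 : ℝ), ∫ ω, F u ω ∂μ :=
  (integral_integral_swap (integrable_of_abs_le_exp hα hF fun q => hb q.1 q.2)).symm

/-- The resolvent is the Laplace transform of the killed semigroup. -/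
lemma FellerData.resolvent_eq (hD : FellerData X P ℱ O) (hα : 0 < α) (h : (ℝ≥0 × E) →ᵇ ℝ)
    (p : ℝ≥0 × E) : resolvent X P O α h p =
      ∫ u in Ioi (0 : ℝ), Real.exp (-α * u) * killedSemigroup X P O u.toNNReal h p := by
  classical
  have := hD.std.isProbabilityMeasure p.2
  have hm := hD.std.measurable_integrand_ite α h.continuous.measurable p.1 hD.measurable_exit
  simp only [resolvent, runningReward_eq]
  rw [integral_swap_of_abs_le_exp hα hm (C := ‖h‖) fun u ω =>
    abs_ite_le (mul_nonneg (norm_nonneg _) (Real.exp_pos _).le)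
      (abs_exp_mul_le (abs_apply_le h) u _)]
  refine integral_congr_ae (ae_of_all _ fun u => ?_)
  simp only [killedSemigroup]
  rw [← integral_const_mul]
  refine integral_congr_ae (ae_of_all _ fun ω => ?_)
  simp only [mul_ite, mul_zero]

lemma FellerData.measurable_laplace_integrand (hD : FellerData X P ℱ O) (α : ℝ)
    (h : (ℝ≥0 × E) →ᵇ ℝ) : Measurable fun q : ℝ × (ℝ≥0 × E) =>
      Real.exp (-α * q.1) * killedSemigroup X P O q.1.toNNReal h q.2 := by
  have := (hD.measurable_uncurry_killedSemigroup h).comp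
    (f := fun q : ℝ × (ℝ≥0 × E) => (q.1.toNNReal, q.2)) (by fun_prop)
  exact Measurable.mul (by fun_prop) this

lemma FellerData.abs_laplace_integrand_le (hD : FellerData X P ℱ O)
    (h : (ℝ≥0 × E) →ᵇ ℝ) (u : ℝ) (p : ℝ≥0 × E) :
    |Real.exp (-α * u) * killedSemigroup X P O u.toNNReal h p| ≤ ‖h‖ * Real.exp (-α * u) :=
  abs_exp_mul_le (f := killedSemigroup X P O u.toNNReal h)
    (fun p => hD.std.abs_killedSemigroup_le _ h p) u p

lemma FellerData.integrableOn_laplace_integrand (hD : FellerData X P ℱ O) (hα : 0 < α)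
    (h : (ℝ≥0 × E) →ᵇ ℝ) (p : ℝ≥0 × E) : IntegrableOn (fun u : ℝ =>
      Real.exp (-α * u) * killedSemigroup X P O u.toNNReal h p) (Ioi 0) :=
  ((integrableOn_exp_neg hα).const_mul ‖h‖).mono'
    ((hD.measurable_laplace_integrand α h).comp
      (measurable_id.prodMk measurable_const)).aestronglyMeasurable
    (ae_of_all _ fun u => hD.abs_laplace_integrand_le h u p)

/-- The Laplace transform does not see `t = 0`, where the killed semigroup need not preserve
continuity. -/
lemma FellerData.continuous_resolvent (hD : FellerData X P ℱ O) (hα : 0 < α)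
    (h : (ℝ≥0 × E) →ᵇ ℝ) : Continuous (resolvent X P O α h) := by
  have heq : resolvent X P O α h = fun p => ∫ u in Ioi (0 : ℝ),
      Real.exp (-α * u) * killedSemigroup X P O u.toNNReal h p :=
    funext fun p => hD.resolvent_eq hα h p
  rw [heq]
  refine continuous_of_dominated (bound := fun u => ‖h‖ * Real.exp (-α * u))
    (fun p => (hD.integrableOn_laplace_integrand hα h p).aestronglyMeasurable)
    (fun p => ae_of_all _ fun u => hD.abs_laplace_integrand_le h u p)
    ((integrableOn_exp_neg hα).const_mul _) ?_
  refine (ae_restrict_iff' measurableSet_Ioi).2 (ae_of_all _ fun u hu => ?_)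
  exact continuous_const.mul (hD.std.continuous_killedSemigroup hD.feller hD.isOpen hD.killed
    (Real.toNNReal_pos.2 hu) h)

lemma FellerData.abs_resolvent_le (hD : FellerData X P ℱ O) (hα : 0 < α)
    {h : ℝ≥0 × E → ℝ} {C : ℝ} (hC : ∀ p, |h p| ≤ C) (p : ℝ≥0 × E) :
    |resolvent X P O α h p| ≤ C / α := by
  have := hD.std.isProbabilityMeasure p.2
  exact abs_integral_le_of_abs_le fun ω => abs_runningReward_le hα hC _ _ _

/-- The resolvent as a map on bounded continuous functions. -/
noncomputable def FellerData.res (hD : FellerData X P ℱ O) (hα : 0 < α) (h : (ℝ≥0 × E) →ᵇ ℝ) :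
    (ℝ≥0 × E) →ᵇ ℝ :=
  BoundedContinuousFunction.ofNormedAddCommGroup _ (hD.continuous_resolvent hα h) (‖h‖ / α)
    fun p => hD.abs_resolvent_le hα (abs_apply_le h) p

lemma FellerData.res_apply (hD : FellerData X P ℱ O) (hα : 0 < α) (h : (ℝ≥0 × E) →ᵇ ℝ)
    (p : ℝ≥0 × E) : hD.res hα h p = resolvent X P O α h p := rfl

lemma FellerData.integrable_runningReward (hD : FellerData X P ℱ O) (hα : 0 < α)
    (h : (ℝ≥0 × E) →ᵇ ℝ) (s : ℝ≥0) (x : E) {θ : Ω → WithTop ℝ≥0} (hθ : Measurable θ) :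
    Integrable (fun ω => runningReward X α h s (θ ω) ω) (P x) := by
  have := hD.std.isProbabilityMeasure x
  exact Integrable.of_bound
    (hD.std.measurable_runningReward α h.continuous.measurable s hθ).aestronglyMeasurable _
    (ae_of_all _ fun ω => abs_runningReward_le hα (abs_apply_le h) _ _ _)

lemma FellerData.res_add (hD : FellerData X P ℱ O) (hα : 0 < α) (f g : (ℝ≥0 × E) →ᵇ ℝ) :
    hD.res hα (f + g) = hD.res hα f + hD.res hα g := by
  ext p
  simp only [hD.res_apply, BoundedContinuousFunction.coe_add, Pi.add_apply, resolvent]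
  rw [← integral_add (hD.integrable_runningReward hα f _ _ hD.measurable_exit)
    (hD.integrable_runningReward hα g _ _ hD.measurable_exit)]
  refine integral_congr_ae (ae_of_all _ fun ω => ?_)
  exact hD.std.runningReward_add hα f.continuous.measurable (abs_apply_le f)
    g.continuous.measurable (abs_apply_le g) _ _ _

lemma FellerData.res_smul (hD : FellerData X P ℱ O) (hα : 0 < α) (c : ℝ) (f : (ℝ≥0 × E) →ᵇ ℝ) :
    hD.res hα (c • f) = c • hD.res hα f := by
  ext p
  simp only [hD.res_apply, BoundedContinuousFunction.coe_smul, smul_eq_mul, resolvent]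
  rw [← integral_const_mul]
  refine integral_congr_ae (ae_of_all _ fun ω => ?_)
  exact runningReward_const_mul _ _ _ _ _

lemma FellerData.res_sub (hD : FellerData X P ℱ O) (hα : 0 < α) (f g : (ℝ≥0 × E) →ᵇ ℝ) :
    hD.res hα (f - g) = hD.res hα f - hD.res hα g := by
  have := hD.res_add hα (f - g) g
  rw [sub_add_cancel] at this
  rw [this, add_sub_cancel_right]

lemma FellerData.res_mono (hD : FellerData X P ℱ O) (hα : 0 < α) {f g : (ℝ≥0 × E) →ᵇ ℝ}
    (hfg : ∀ p, f p ≤ g p) (p : ℝ≥0 × E) : hD.res hα f p ≤ hD.res hα g p :=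
  integral_mono (hD.integrable_runningReward hα f _ _ hD.measurable_exit)
    (hD.integrable_runningReward hα g _ _ hD.measurable_exit) fun _ =>
      hD.std.runningReward_mono hα f.continuous.measurable (abs_apply_le f)
        g.continuous.measurable (abs_apply_le g) hfg _ _ _

open Classical in
/-- The running reward after time `θ`, up to the exit. -/
lemma IsStandardProcess.runningReward_tail (hX : IsStandardProcess X P ℱ) (hα : 0 < α)
    (h : (ℝ≥0 × E) →ᵇ ℝ) (s : ℝ≥0) (θ : WithTop ℝ≥0) (ω : Ω) :
    runningReward X α h s (exitTime X O ω) ω = runningReward X α h s (min θ (exitTime X O ω)) ω +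
      ∫ u in Ioi (0 : ℝ), if θ + (u.toNNReal : ℝ≥0) < exitTime X O ω then
        Real.exp (-α * u) * (Real.exp (-α * θ.untopA) *
          h (s + (θ.untopA + u.toNNReal), X (θ.untopA + u.toNNReal) ω)) else 0 := by
  set e := exitTime X O ω with he
  rcases lt_or_ge θ e with hθ | hθ
  · obtain ⟨a, rfl⟩ := WithTop.ne_top_iff_exists.1 (ne_top_of_lt hθ)
    rw [min_eq_left hθ.le, untopA_coe, runningReward_eq, runningReward_eq, ← sub_eq_iff_eq_add',
      ← integral_sub (hX.integrableOn_integrand_ite hα h.continuous.measurable (abs_apply_le h) s e ω)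
        (hX.integrableOn_integrand_ite hα h.continuous.measurable (abs_apply_le h) s a ω)]
    set g : ℝ → ℝ := fun u => Real.exp (-α * u) * h (s + u.toNNReal, X u.toNNReal ω) with hg
    set F : ℝ → ℝ := (Ioi (a : ℝ)).indicator fun u =>
      if ((u.toNNReal : ℝ≥0) : WithTop ℝ≥0) < e then g u else 0 with hF
    have h1 : ∀ u ∈ Ioi (0 : ℝ), u ≠ a → (if ((u.toNNReal : ℝ≥0) : WithTop ℝ≥0) < e then g u else 0) -
        (if ((u.toNNReal : ℝ≥0) : WithTop ℝ≥0) < (a : WithTop ℝ≥0) then g u else 0) = F u := by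
      intro u hu hua
      have hiff : ((u.toNNReal : ℝ≥0) : WithTop ℝ≥0) < (a : WithTop ℝ≥0) ↔ u < a := by
        rw [WithTop.coe_lt_coe, Real.toNNReal_lt_iff_lt_coe (le_of_lt hu)]
      rcases lt_or_gt_of_ne hua with hlt | hgt
      · rw [if_pos (hiff.2 hlt), if_pos ((hiff.2 hlt).trans hθ), sub_self, hF,
          indicator_of_notMem (by simpa using hlt.le)]
      · rw [if_neg (fun H => lt_asymm (hiff.1 H) hgt), sub_zero, hF, indicator_of_mem (show u ∈ Ioi (a : ℝ) from hgt)]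
    have h2 : ∀ u ∈ Ioi (0 : ℝ), (if (a : WithTop ℝ≥0) + (u.toNNReal : ℝ≥0) < e then
        Real.exp (-α * u) * (Real.exp (-α * a) *
          h (s + (a + u.toNNReal), X (a + u.toNNReal) ω)) else 0) = F (u + a) := by
      intro u hu
      have h0 : (u + a).toNNReal = a + u.toNNReal := by
        rw [Real.toNNReal_add (le_of_lt hu) (NNReal.coe_nonneg a), Real.toNNReal_coe, add_comm]
      rw [hF, indicator_of_mem (by simpa using hu), h0, hg]
      simp only [h0, ← WithTop.coe_add]
      congr 1
      rw [← mul_assoc, ← Real.exp_add]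
      congr 2
      ring
    have hae : ∀ᵐ u : ℝ ∂(volume.restrict (Ioi 0)), u ≠ (a : ℝ) :=
      ae_restrict_of_ae (Measure.ae_ne volume (a : ℝ))
    calc _ = ∫ u in Ioi (0 : ℝ), F u := by
          refine integral_congr_ae ?_
          filter_upwards [hae, ae_restrict_mem measurableSet_Ioi] with u hu hu0
          exact h1 u hu0 hu
      _ = ∫ u in Ioi (a : ℝ), F u := by
          rw [hF, setIntegral_indicator measurableSet_Ioi, setIntegral_indicator measurableSet_Ioi,
            inter_self, inter_eq_right.2 (Ioi_subset_Ioi (NNReal.coe_nonneg a))]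
      _ = ∫ u in Ioi (0 : ℝ), F (u + a) := by
          have := (measurePreserving_add_right volume (a : ℝ)).setIntegral_preimage_emb
            (measurableEmbedding_addRight _) F (Ioi (a : ℝ))
          rw [preimage_add_const_Ioi, sub_self] at this
          exact this.symm
      _ = _ := setIntegral_congr_fun measurableSet_Ioi fun u hu => (h2 u hu).symm
  · rw [min_eq_right hθ]
    have : ∀ u : ℝ, ¬ θ + ((u.toNNReal : ℝ≥0) : WithTop ℝ≥0) < e := fun u H =>
      absurd (lt_of_le_of_lt le_self_add H) (not_lt.2 hθ)
    simp only [this, if_false, integral_zero, add_zero]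

end Resolvent

section DynkinFormula

variable {E Ω : Type*} [MetricSpace E] [ProperSpace E] [MeasurableSpace E] [BorelSpace E]
  {mΩ : MeasurableSpace Ω} {X : ℝ≥0 → Ω → E} {P : E → Measure Ω} {ℱ : Filtration ℝ≥0 mΩ}
  {O : Set E} {α : ℝ}

/-! ### Dynkin's formula -/

lemma coe_add_lt_iff (θ e : WithTop ℝ≥0) (t : ℝ≥0) :
    θ + t < e ↔ θ ≠ ⊤ ∧ ((θ.untopA + t : ℝ≥0) : WithTop ℝ≥0) < e := by
  cases θ with
  | top => simp only [WithTop.top_add, not_top_lt, ne_eq, not_true_eq_false, false_and]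
  | coe a => simp only [untopA_coe, WithTop.coe_add, ne_eq, WithTop.coe_ne_top, not_false_eq_true,
      true_and]

lemma measurableSet_add_lt {θ e : Ω → WithTop ℝ≥0} (hθ : Measurable θ) (he : Measurable e) :
    MeasurableSet {q : ℝ × Ω | θ q.2 + ((q.1.toNNReal : ℝ≥0) : WithTop ℝ≥0) < e q.2} := by
  simp only [coe_add_lt_iff]
  refine MeasurableSet.inter (((hθ.comp measurable_snd) (measurableSet_singleton ⊤)).compl) ?_
  exact measurableSet_lt
    (((hθ.untopA.comp measurable_snd).add measurable_fst.real_toNNReal).withTop_coe)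
    (he.comp measurable_snd)

open Classical in
lemma FellerData.measurable_shifted (hD : FellerData X P ℱ O) (α : ℝ) (h : (ℝ≥0 × E) →ᵇ ℝ)
    (s : ℝ≥0) {τ : Ω → WithTop ℝ≥0} (hτ : Measurable τ) :
    Measurable fun q : ℝ × Ω => if τ q.2 + (q.1.toNNReal : ℝ≥0) < exitTime X O q.2 then
      Real.exp (-α * (τ q.2).untopA) * h (s + ((τ q.2).untopA + q.1.toNNReal),
        X ((τ q.2).untopA + q.1.toNNReal) q.2) else 0 := by
  have h1 : Measurable fun q : ℝ × Ω => (τ q.2).untopA := hτ.untopA.comp measurable_snd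
  have h2 : Measurable fun q : ℝ × Ω => (τ q.2).untopA + q.1.toNNReal :=
    h1.add measurable_fst.real_toNNReal
  have h3 : Measurable fun q : ℝ × Ω => X ((τ q.2).untopA + q.1.toNNReal) q.2 :=
    hD.std.measurable_uncurry.comp (h2.prodMk measurable_snd)
  refine Measurable.ite (measurableSet_add_lt hτ hD.measurable_exit) ?_ measurable_const
  refine Measurable.mul (by fun_prop) ?_
  exact h.continuous.measurable.comp ((h2.const_add s).prodMk h3)

open Classical in
lemma FellerData.measurable_killedSemigroup_stopped (hD : FellerData X P ℱ O) (α : ℝ)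
    (h : (ℝ≥0 × E) →ᵇ ℝ) (s : ℝ≥0) {τ : Ω → WithTop ℝ≥0} (hτ : Measurable τ) :
    Measurable fun q : ℝ × Ω => if τ q.2 < exitTime X O q.2 then
      Real.exp (-α * (τ q.2).untopA) * killedSemigroup X P O q.1.toNNReal h
        (s + (τ q.2).untopA, stoppedValue X τ q.2) else 0 := by
  have h1 : Measurable fun q : ℝ × Ω => (τ q.2).untopA := hτ.untopA.comp measurable_snd
  have h3 : Measurable fun q : ℝ × Ω => stoppedValue X τ q.2 :=
    hD.std.measurable_uncurry.comp (h1.prodMk measurable_snd)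
  refine Measurable.ite (measurableSet_lt (hτ.comp measurable_snd)
    (hD.measurable_exit.comp measurable_snd)) ?_ measurable_const
  refine Measurable.mul (by fun_prop) ?_
  exact (hD.measurable_uncurry_killedSemigroup h).comp
    (measurable_fst.real_toNNReal.prodMk ((h1.const_add s).prodMk h3))

lemma abs_exp_neg_mul_le (hα : 0 < α) (a : ℝ≥0) {c C : ℝ} (h : |c| ≤ C) :
    |Real.exp (-α * a) * c| ≤ C := by
  rw [abs_mul, abs_of_pos (Real.exp_pos _)]
  refine (mul_le_of_le_one_left (abs_nonneg _) ?_).trans h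
  exact Real.exp_le_one_iff.2 (by nlinarith [a.coe_nonneg])

open Classical in
/-- The strong Markov property of the killed process, for nonnegative functions. -/
lemma FellerData.integral_killed_of_nonneg (hD : FellerData X P ℱ O) (hα : 0 < α)
    (h : (ℝ≥0 × E) →ᵇ ℝ) (h0 : ∀ p, 0 ≤ h p) (s : ℝ≥0) (x : E) {τ : Ω → WithTop ℝ≥0}
    (hτ : IsStoppingTime ℱ τ) (t : ℝ) :
    ∫ ω, (if τ ω + (t.toNNReal : ℝ≥0) < exitTime X O ω then
      Real.exp (-α * (τ ω).untopA) * h (s + ((τ ω).untopA + t.toNNReal),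
        X ((τ ω).untopA + t.toNNReal) ω) else 0) ∂P x =
    ∫ ω, (if τ ω < exitTime X O ω then
      Real.exp (-α * (τ ω).untopA) * killedSemigroup X P O t.toNNReal h
        (s + (τ ω).untopA, stoppedValue X τ ω) else 0) ∂P x := by
  have hprob := hD.std.isProbabilityMeasure
  set r : ℝ≥0 := t.toNNReal with hr
  set h' : ℝ≥0 × E → ℝ≥0∞ := fun q =>
    ENNReal.ofReal (Real.exp (-α * ((q.1 : ℝ) - s - r)) * h q) with hh'
  have hh'm : Measurable h' := by
    have := h.continuous.measurable
    exact ENNReal.measurable_ofReal.comp (Measurable.mul (by fun_prop) this)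
  have hb : ∀ q, h' q ≤ ENNReal.ofReal (Real.exp (α * (s + r)) * ‖h‖) := by
    intro q
    refine ENNReal.ofReal_le_ofReal (mul_le_mul (Real.exp_le_exp.2 ?_)
      ((le_abs_self _).trans (abs_apply_le h q)) (h0 q) (Real.exp_pos _).le)
    nlinarith [mul_nonneg hα.le q.1.coe_nonneg]
  have key := hD.std.lintegral_killed hD.isOpen r hh'm ENNReal.ofReal_ne_top hb s x hτ
  have hexp : ∀ (a : ℝ≥0) (y : E), h' (s + (a + r), y) =
      ENNReal.ofReal (Real.exp (-α * a) * h (s + (a + r), y)) := by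
    intro a y
    rw [hh']
    simp only [NNReal.coe_add]
    congr 4
    ring
  have hT0 : ∀ p, 0 ≤ killedSemigroup X P O r h p := fun p =>
    integral_nonneg fun ω => by
      change (0 : ℝ) ≤ ite _ _ _
      split_ifs
      · exact h0 _
      · exact le_rfl
  rw [integral_eq_lintegral_of_nonneg_ae, integral_eq_lintegral_of_nonneg_ae]
  · congr 1
    refine Eq.trans (lintegral_congr fun ω => ?_) (key.trans (lintegral_congr fun ω => ?_))
    · split_ifs
      · rw [hexp]
      · exact ENNReal.ofReal_zero
    · split_ifs
      · rw [killedSemigroup, ← integral_const_mul, ofReal_integral_eq_lintegral_ofReal]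
        · refine lintegral_congr fun ω' => ?_
          split_ifs
          · rw [add_assoc, hexp]
          · rw [mul_zero, ENNReal.ofReal_zero]
        · exact (hD.std.integrable_killed hD.isOpen r h _ _).const_mul _
        · refine ae_of_all _ fun ω' => mul_nonneg (Real.exp_pos _).le ?_
          split_ifs
          · exact h0 _
          · exact le_rfl
      · exact ENNReal.ofReal_zero.symm
  · refine ae_of_all _ fun ω => ?_
    change (0 : ℝ) ≤ ite _ _ _
    split_ifs
    · exact mul_nonneg (Real.exp_pos _).le (hT0 _)
    · exact le_rfl
  · exact ((hD.measurable_killedSemigroup_stopped α h s hτ.measurable').comp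
      ((measurable_const (a := t)).prodMk measurable_id)).aestronglyMeasurable
  · refine ae_of_all _ fun ω => ?_
    change (0 : ℝ) ≤ ite _ _ _
    split_ifs
    · exact mul_nonneg (Real.exp_pos _).le (h0 _)
    · exact le_rfl
  · exact ((hD.measurable_shifted α h s hτ.measurable').comp
      ((measurable_const (a := t)).prodMk measurable_id)).aestronglyMeasurable

lemma FellerData.killedSemigroup_sub (hD : FellerData X P ℱ O) (t : ℝ≥0) (f g : (ℝ≥0 × E) →ᵇ ℝ)
    (p : ℝ≥0 × E) : killedSemigroup X P O t (f - g :) p =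
      killedSemigroup X P O t f p - killedSemigroup X P O t g p := by
  rw [killedSemigroup, killedSemigroup, killedSemigroup,
    ← integral_sub (hD.std.integrable_killed hD.isOpen t f p.1 p.2)
      (hD.std.integrable_killed hD.isOpen t g p.1 p.2)]
  refine integral_congr_ae (ae_of_all _ fun ω => ?_)
  simp only [BoundedContinuousFunction.coe_sub, Pi.sub_apply]
  split_ifs <;> simp

open Classical in
/-- The strong Markov property of the killed process. -/
lemma FellerData.integral_killed (hD : FellerData X P ℱ O) (hα : 0 < α)
    (h : (ℝ≥0 × E) →ᵇ ℝ) (s : ℝ≥0) (x : E) {τ : Ω → WithTop ℝ≥0}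
    (hτ : IsStoppingTime ℱ τ) (t : ℝ) :
    ∫ ω, (if τ ω + (t.toNNReal : ℝ≥0) < exitTime X O ω then
      Real.exp (-α * (τ ω).untopA) * h (s + ((τ ω).untopA + t.toNNReal),
        X ((τ ω).untopA + t.toNNReal) ω) else 0) ∂P x =
    ∫ ω, (if τ ω < exitTime X O ω then
      Real.exp (-α * (τ ω).untopA) * killedSemigroup X P O t.toNNReal h
        (s + (τ ω).untopA, stoppedValue X τ ω) else 0) ∂P x := by
  have hprob := hD.std.isProbabilityMeasure
  set c : (ℝ≥0 × E) →ᵇ ℝ := BoundedContinuousFunction.const _ ‖h‖ with hc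
  have hτm := hτ.measurable'
  have i1 : ∀ g : (ℝ≥0 × E) →ᵇ ℝ, Integrable (fun ω =>
      if τ ω + (t.toNNReal : ℝ≥0) < exitTime X O ω then
      Real.exp (-α * (τ ω).untopA) * g (s + ((τ ω).untopA + t.toNNReal),
        X ((τ ω).untopA + t.toNNReal) ω) else 0) (P x) := fun g =>
    Integrable.of_bound ((hD.measurable_shifted α g s hτm).comp
      ((measurable_const (a := t)).prodMk measurable_id)).aestronglyMeasurable ‖g‖
      (ae_of_all _ fun ω => abs_ite_le (norm_nonneg _)
        (abs_exp_neg_mul_le hα _ (abs_apply_le g _)))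
  have i2 : ∀ g : (ℝ≥0 × E) →ᵇ ℝ, Integrable (fun ω =>
      if τ ω < exitTime X O ω then
      Real.exp (-α * (τ ω).untopA) * killedSemigroup X P O t.toNNReal g
        (s + (τ ω).untopA, stoppedValue X τ ω) else 0) (P x) := fun g =>
    Integrable.of_bound ((hD.measurable_killedSemigroup_stopped α g s hτm).comp
      ((measurable_const (a := t)).prodMk measurable_id)).aestronglyMeasurable ‖g‖
      (ae_of_all _ fun ω => abs_ite_le (norm_nonneg _)
        (abs_exp_neg_mul_le hα _ (hD.std.abs_killedSemigroup_le _ g _)))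
  have e1 := hD.integral_killed_of_nonneg hα (h + c) (fun p => by
    have := (abs_le.1 (abs_apply_le h p)).1
    simp [hc]; linarith) s x hτ t
  have e2 := hD.integral_killed_of_nonneg hα c (fun p => norm_nonneg h) s x hτ t
  have hh : h = (h + c) - c := (add_sub_cancel_right _ _).symm
  rw [hh]
  generalize h + c = g at *
  calc _ = _ - _ := by
        rw [← integral_sub (i1 g) (i1 c)]
        refine integral_congr_ae (ae_of_all _ fun ω => ?_)
        simp only [BoundedContinuousFunction.coe_sub, Pi.sub_apply, mul_sub]
        split_ifs <;> simp
    _ = _ - _ := by rw [e1, e2]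
    _ = _ := by
        rw [← integral_sub (i2 g) (i2 c)]
        refine integral_congr_ae (ae_of_all _ fun ω => ?_)
        simp only [hD.killedSemigroup_sub, mul_sub]
        split_ifs <;> simp

/-- **Dynkin's formula**: the resolvent of the killed process is the expected running reward up to
a stopping time plus the discounted resolvent at that time. -/
lemma FellerData.J_res (hD : FellerData X P ℱ O) (hα : 0 < α)
    (h : (ℝ≥0 × E) →ᵇ ℝ) (s : ℝ≥0) (x : E) {τ : Ω → WithTop ℝ≥0}
    (hτ : IsStoppingTime ℱ τ) :
    J X P O α h (hD.res hα h) (0 : (ℝ≥0 × E) →ᵇ ℝ) s x τ = hD.res hα h (s, x) := by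
  classical
  have hprob := hD.std.isProbabilityMeasure
  have hτm := hτ.measurable'
  have hne : ∀ ω, τ ω < exitTime X O ω → τ ω ≠ ⊤ := fun ω h => ne_top_of_lt h
  -- the tail of the running reward, with the order of integration exchanged
  have hsw1 := integral_swap_of_abs_le_exp (μ := P x) hα (C := ‖h‖)
    (F := fun u ω => Real.exp (-α * u) * (if τ ω + (u.toNNReal : ℝ≥0) < exitTime X O ω then
      Real.exp (-α * (τ ω).untopA) * h (s + ((τ ω).untopA + u.toNNReal),
        X ((τ ω).untopA + u.toNNReal) ω) else 0))
    (Measurable.mul (by fun_prop) (hD.measurable_shifted α h s hτm)) (fun u ω => by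
      rw [abs_mul, abs_of_pos (Real.exp_pos _), mul_comm]
      exact mul_le_mul_of_nonneg_right (abs_ite_le (norm_nonneg _)
        (abs_exp_neg_mul_le hα _ (abs_apply_le h _))) (Real.exp_pos _).le)
  have hsw2 := integral_swap_of_abs_le_exp (μ := P x) hα (C := ‖h‖)
    (F := fun u ω => Real.exp (-α * u) * (if τ ω < exitTime X O ω then
      Real.exp (-α * (τ ω).untopA) * killedSemigroup X P O u.toNNReal h
        (s + (τ ω).untopA, stoppedValue X τ ω) else 0))
    (Measurable.mul (by fun_prop) (hD.measurable_killedSemigroup_stopped α h s hτm)) (fun u ω => by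
      rw [abs_mul, abs_of_pos (Real.exp_pos _), mul_comm]
      exact mul_le_mul_of_nonneg_right (abs_ite_le (norm_nonneg _)
        (abs_exp_neg_mul_le hα _ (hD.std.abs_killedSemigroup_le _ h _))) (Real.exp_pos _).le)
  have hmid : ∫ ω, (∫ u in Ioi (0 : ℝ), Real.exp (-α * u) *
      (if τ ω + (u.toNNReal : ℝ≥0) < exitTime X O ω then
      Real.exp (-α * (τ ω).untopA) * h (s + ((τ ω).untopA + u.toNNReal),
        X ((τ ω).untopA + u.toNNReal) ω) else 0)) ∂P x =
      ∫ ω, (if τ ω < exitTime X O ω then discountedPayoff X α (hD.res hα h) s (τ ω) ω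
        else discountedPayoff X α (0 : (ℝ≥0 × E) →ᵇ ℝ) s (exitTime X O ω) ω) ∂P x := by
    rw [hsw1]
    simp only [integral_const_mul, hD.integral_killed hα h s x hτ]
    simp only [← integral_const_mul]
    rw [← hsw2]
    refine integral_congr_ae (ae_of_all _ fun ω => ?_)
    by_cases hω : τ ω < exitTime X O ω
    · simp only [if_pos hω]
      rw [discountedPayoff, if_neg (hne ω hω), hD.res_apply, hD.resolvent_eq hα,
        ← integral_const_mul]
      refine integral_congr_ae (ae_of_all _ fun u => ?_)
      change _ * (_ * _) = _ * (_ * _)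
      rw [mul_left_comm]
      rfl
    · simp only [if_neg hω, mul_zero, integral_zero, discountedPayoff,
        BoundedContinuousFunction.coe_zero, Pi.zero_apply, ite_self]
  have i1 := hD.integrable_runningReward hα h s x (hτm.min hD.measurable_exit)
  have i2 : Integrable (fun ω => if τ ω < exitTime X O ω then
      discountedPayoff X α (hD.res hα h) s (τ ω) ω
        else discountedPayoff X α (0 : (ℝ≥0 × E) →ᵇ ℝ) s (exitTime X O ω) ω) (P x) := by
    have := (hD.std.integrable_pathPayoff hD.isOpen hα h (hD.res hα h) 0 s x hτm).sub i1
    refine this.congr (ae_of_all _ fun ω => ?_)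
    simp [pathPayoff]
  have i3 : Integrable (fun ω => ∫ u in Ioi (0 : ℝ), Real.exp (-α * u) *
      (if τ ω + (u.toNNReal : ℝ≥0) < exitTime X O ω then
      Real.exp (-α * (τ ω).untopA) * h (s + ((τ ω).untopA + u.toNNReal),
        X ((τ ω).untopA + u.toNNReal) ω) else 0)) (P x) := by
    have := (hD.integrable_runningReward hα h s x hD.measurable_exit).sub i1
    refine this.congr (ae_of_all _ fun ω => ?_)
    simp only [Pi.sub_apply, hD.std.runningReward_tail hα h s (τ ω) ω, add_sub_cancel_left,
      mul_ite, mul_zero]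
  rw [J, integral_add i1 i2, ← hmid, ← integral_add i1 i3, hD.res_apply, resolvent]
  refine integral_congr_ae (ae_of_all _ fun ω => ?_)
  simp only [hD.std.runningReward_tail hα h s (τ ω) ω, mul_ite, mul_zero]

end DynkinFormula

/-! ### The resolvent identity -/

section ResolventIdentity

variable {E Ω : Type*} [MetricSpace E] [ProperSpace E] [MeasurableSpace E] [BorelSpace E]
  {mΩ : MeasurableSpace Ω} {X : ℝ≥0 → Ω → E} {P : E → Measure Ω} {ℱ : Filtration ℝ≥0 mΩ}
  {O : Set E} {α : ℝ}

lemma pathPayoff_univ (f G H : ℝ≥0 × E → ℝ) (s : ℝ≥0) (θ : WithTop ℝ≥0) (ω : Ω) :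
    pathPayoff X univ α f G H s θ ω =
      runningReward X α f s θ ω + discountedPayoff X α G s θ ω := by
  rw [pathPayoff, exitTime_univ, min_eq_left le_top]
  split_ifs with h
  · rfl
  · rw [not_lt, top_le_iff] at h
    rw [h, discountedPayoff_top, discountedPayoff_top]

lemma pathPayoff_self (f H : ℝ≥0 × E → ℝ) (s : ℝ≥0) (θ : WithTop ℝ≥0) (ω : Ω) :
    pathPayoff X O α f H H s θ ω = runningReward X α f s (min θ (exitTime X O ω)) ω +
      discountedPayoff X α H s (min θ (exitTime X O ω)) ω := by
  rw [pathPayoff]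
  split_ifs with h
  · rw [min_eq_left h.le]
  · rw [min_eq_right (not_lt.1 h)]

/-- Dynkin's formula for the process without killing. -/
lemma FellerData.integral_dynkin_univ (hD : FellerData X P ℱ O) (hα : 0 < α)
    (k : (ℝ≥0 × E) →ᵇ ℝ) (s : ℝ≥0) (x : E) {θ : Ω → WithTop ℝ≥0} (hθ : IsStoppingTime ℱ θ) :
    ∫ ω, (runningReward X α k s (θ ω) ω + discountedPayoff X α (hD.unkilled.res hα k) s (θ ω) ω) ∂P x =
      hD.unkilled.res hα k (s, x) := by
  rw [← hD.unkilled.J_res hα k s x hθ, J_eq]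
  simp only [pathPayoff_univ]

/-- An unkilled resolvent is reproduced by the functional `J` when it is the payoff both at the
stopping time and at the exit. -/
lemma FellerData.J_res_univ (hD : FellerData X P ℱ O) (hα : 0 < α)
    (k : (ℝ≥0 × E) →ᵇ ℝ) (s : ℝ≥0) (x : E) {τ : Ω → WithTop ℝ≥0}
    (hτ : IsStoppingTime ℱ τ) :
    J X P O α k (hD.unkilled.res hα k) (hD.unkilled.res hα k) s x τ = hD.unkilled.res hα k (s, x) := by
  rw [← hD.integral_dynkin_univ hα k s x (hτ.min (hD.std.isStoppingTime_exitTime hD.isOpen)), J_eq]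
  simp only [pathPayoff_self]

/-- If the unkilled resolvent of `q` is nonpositive, it lies below the killed resolvent of `q`. -/
lemma FellerData.res_univ_le_res (hD : FellerData X P ℱ O) (hα : 0 < α)
    (q : (ℝ≥0 × E) →ᵇ ℝ) (hq : ∀ p, hD.unkilled.res hα q p ≤ 0) (p : ℝ≥0 × E) :
    hD.unkilled.res hα q p ≤ hD.res hα q p := by
  have := hD.std.isProbabilityMeasure p.2
  have hst := hD.std.isStoppingTime_exitTime hD.isOpen
  have h1 := hD.integral_dynkin_univ hα q p.1 p.2 hst
  rw [show hD.unkilled.res hα q p = hD.unkilled.res hα q (p.1, p.2) from rfl, ← h1, hD.res_apply, resolvent]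
  have i1 := hD.integrable_runningReward hα q p.1 p.2 hst.measurable'
  refine integral_mono ?_ i1 fun ω => ?_
  · have := hD.unkilled.std.integrable_pathPayoff isOpen_univ hα q (hD.unkilled.res hα q) 0 p.1 p.2
      hst.measurable'
    simpa only [pathPayoff_univ] using this
  · have : discountedPayoff X α (hD.unkilled.res hα q) p.1 (exitTime X O ω) ω ≤
        discountedPayoff X α (fun _ => 0) p.1 (exitTime X O ω) ω :=
      discountedPayoff_mono fun _ => hq _
    have h0 : discountedPayoff X α (fun _ => 0) p.1 (exitTime X O ω) ω = 0 := by
      simp [discountedPayoff]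
    simp only
    linarith

/-- The killed semigroup applied to a resolvent is the tail of the Laplace transform. -/
lemma FellerData.killedSemigroup_res (hD : FellerData X P ℱ O) {b : ℝ} (hb : 0 < b)
    (h : (ℝ≥0 × E) →ᵇ ℝ) (p : ℝ≥0 × E) {t : ℝ} (ht : 0 < t) :
    Real.exp (-b * t) * killedSemigroup X P O t.toNNReal (hD.res hb h) p =
      ∫ u in Ioi (0 : ℝ), if u < t then 0 else
        Real.exp (-b * u) * killedSemigroup X P O u.toNNReal h p := by
  classical
  have := hD.std.isProbabilityMeasure p.2
  set r := t.toNNReal with hr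
  have hrt : (r : ℝ) = t := Real.coe_toNNReal t ht.le
  have hJ := hD.J_res hb h p.1 p.2 (isStoppingTime_const ℱ r)
  rw [J] at hJ
  have i1 := hD.integrable_runningReward hb h p.1 p.2
    ((measurable_const (a := (r : WithTop ℝ≥0))).min hD.measurable_exit)
  have hite : ∀ ω, (if (r : WithTop ℝ≥0) < exitTime X O ω then
      discountedPayoff X b (hD.res hb h) p.1 r ω
      else discountedPayoff X b (0 : (ℝ≥0 × E) →ᵇ ℝ) p.1 (exitTime X O ω) ω) =
      Real.exp (-b * t) * (if (r : WithTop ℝ≥0) < exitTime X O ω then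
        hD.res hb h (p.1 + r, X r ω) else 0) := by
    intro ω
    split_ifs
    · rw [discountedPayoff_coe, hrt]
    · simp [discountedPayoff]
  simp only [hite] at hJ
  rw [integral_add i1 ((hD.std.integrable_killed hD.isOpen r (hD.res hb h) p.1 p.2).const_mul _),
    integral_const_mul] at hJ
  change _ + _ * killedSemigroup X P O r (hD.res hb h) p = _ at hJ
  rw [← eq_sub_iff_add_eq'] at hJ
  rw [hJ]
  have hrun : ∫ ω, runningReward X b h p.1 (min (r : WithTop ℝ≥0) (exitTime X O ω)) ω ∂P p.2 =
      ∫ u in Ioi (0 : ℝ), if u < t then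
        Real.exp (-b * u) * killedSemigroup X P O u.toNNReal h p else 0 := by
    simp only [runningReward_eq]
    rw [integral_swap_of_abs_le_exp hb (C := ‖h‖) (hD.std.measurable_integrand_ite b
      h.continuous.measurable p.1 (measurable_const.min hD.measurable_exit)) fun u ω =>
      abs_ite_le (mul_nonneg (norm_nonneg _) (Real.exp_pos _).le)
        (abs_exp_mul_le (abs_apply_le h) u _)]
    refine setIntegral_congr_fun measurableSet_Ioi fun u hu => ?_
    have hiff : ((u.toNNReal : ℝ≥0) : WithTop ℝ≥0) < r ↔ u < t := by
      rw [WithTop.coe_lt_coe, hr, Real.toNNReal_lt_toNNReal_iff ht]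
    by_cases hut : u < t
    · simp only [lt_min_iff, hiff, hut, true_and, if_true]
      rw [killedSemigroup, ← integral_const_mul]
      refine integral_congr_ae (ae_of_all _ fun ω => ?_)
      simp only [mul_ite, mul_zero]
    · simp only [lt_min_iff, hiff, hut, false_and, if_false, integral_zero]
  rw [hrun, show hD.res hb h (p.1, p.2) = resolvent X P O b h p from rfl, hD.resolvent_eq hb,
    ← integral_sub (hD.integrableOn_laplace_integrand hb h p)]
  · refine integral_congr_ae (ae_of_all _ fun u => ?_)
    simp only
    split_ifs <;> simp
  · have := (hD.integrableOn_laplace_integrand hb h p).indicator (measurableSet_Iio (a := t))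
    refine this.congr (ae_of_all _ fun u => ?_)
    simp only [indicator_apply, mem_Iio]

lemma integral_ite_lt_exp (c : ℝ) {u : ℝ} (hu : 0 < u) :
    ∫ t in Ioi (0 : ℝ), (if u < t then 0 else c * Real.exp (c * t)) = Real.exp (c * u) - 1 := by
  have h1 : ∀ t, (if u < t then 0 else c * Real.exp (c * t)) =
      (Iic u).indicator (fun t => c * Real.exp (c * t)) t := by
    intro t
    rw [indicator_apply]
    by_cases h : u < t
    · rw [if_pos h, if_neg (by simpa using h)]
    · rw [if_neg h, if_pos (by simpa using h)]
  simp only [h1]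
  rw [setIntegral_indicator measurableSet_Iic, Ioi_inter_Iic,
    ← intervalIntegral.integral_of_le hu.le,
    intervalIntegral.integral_eq_sub_of_hasDerivAt (f := fun t => Real.exp (c * t))]
  · simp
  · intro t _
    have := ((hasDerivAt_id t).const_mul c).exp
    simpa [mul_comm] using this
  · exact Continuous.intervalIntegrable (by fun_prop) _ _

/-- The resolvent identity. -/
lemma FellerData.res_res (hD : FellerData X P ℱ O) {a b : ℝ} (ha : 0 < a) (hb : 0 < b)
    (h : (ℝ≥0 × E) →ᵇ ℝ) :
    (b - a) • hD.res ha (hD.res hb h) = hD.res ha h - hD.res hb h := by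
  ext p
  simp only [BoundedContinuousFunction.coe_smul, smul_eq_mul, BoundedContinuousFunction.coe_sub,
    Pi.sub_apply, hD.res_apply]
  rw [hD.resolvent_eq ha, hD.resolvent_eq ha, hD.resolvent_eq hb]
  set K : ℝ → ℝ := fun u => killedSemigroup X P O u.toNNReal h p with hK
  have hKm : Measurable K := (hD.measurable_uncurry_killedSemigroup h).comp
    (f := fun u : ℝ => (u.toNNReal, p)) (by fun_prop)
  have hKb : ∀ u, |K u| ≤ ‖h‖ := fun u => hD.std.abs_killedSemigroup_le _ h p
  have h1 : ∀ t ∈ Ioi (0 : ℝ),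
      (b - a) * (Real.exp (-a * t) * killedSemigroup X P O t.toNNReal (hD.res hb h) p) =
      ∫ u in Ioi (0 : ℝ), (if u < t then 0 else (b - a) * Real.exp ((b - a) * t)) *
        (Real.exp (-b * u) * K u) := by
    intro t ht
    have e1 : Real.exp (-a * t) = Real.exp ((b - a) * t) * Real.exp (-b * t) := by
      rw [← Real.exp_add]; congr 1; ring
    rw [e1, mul_assoc, hD.killedSemigroup_res hb h p ht, ← integral_const_mul, ← integral_const_mul]
    refine integral_congr_ae (ae_of_all _ fun u => ?_)
    simp only
    split_ifs
    · ring
    · ring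
  -- integrability over the product, from the decay of `e ^ (-a t - b (u - t))` for `t ≤ u`
  set m := min a b / 2 with hm
  have hm0 : 0 < m := by positivity
  have hint : Integrable (fun q : ℝ × ℝ => (if q.2 < q.1 then 0 else
      (b - a) * Real.exp ((b - a) * q.1)) * (Real.exp (-b * q.2) * K q.2))
      ((volume.restrict (Ioi (0 : ℝ))).prod (volume.restrict (Ioi (0 : ℝ)))) := by
    have hdom := (Integrable.mul_prod (integrableOn_exp_neg hm0) (integrableOn_exp_neg hm0)).const_mul
      (|b - a| * ‖h‖)
    refine hdom.mono' ?_ ?_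
    · refine (Measurable.mul (Measurable.ite (measurableSet_lt measurable_snd measurable_fst)
        measurable_const (by fun_prop)) (Measurable.mul (by fun_prop)
        (hKm.comp measurable_snd))).aestronglyMeasurable
    · rw [Measure.prod_restrict]
      refine (ae_restrict_iff' (measurableSet_Ioi.prod measurableSet_Ioi)).2
        (ae_of_all _ fun q hq => ?_)
      have hq1 : 0 < q.1 := hq.1
      rw [Real.norm_eq_abs]
      split_ifs with hlt
      · rw [zero_mul, abs_zero]
        positivity
      · rw [abs_mul, abs_mul, abs_mul, abs_of_pos (Real.exp_pos _), abs_of_pos (Real.exp_pos _),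
          ← Real.exp_add]
        have e1 : Real.exp ((b - a) * q.1) * Real.exp (-b * q.2) ≤
            Real.exp (-m * q.1 + -m * q.2) := by
          rw [← Real.exp_add]
          refine Real.exp_le_exp.2 ?_
          have ma : 2 * m ≤ a := by rw [hm]; linarith [min_le_left a b]
          have mb : 2 * m ≤ b := by rw [hm]; linarith [min_le_right a b]
          have : 0 ≤ q.2 - q.1 := by linarith
          nlinarith [mul_nonneg (sub_nonneg.2 ma) hq1.le, mul_nonneg (sub_nonneg.2 mb) this,
            mul_nonneg hm0.le this]
        calc _ = |b - a| * |K q.2| * (Real.exp ((b - a) * q.1) * Real.exp (-b * q.2)) := by ring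
          _ ≤ |b - a| * ‖h‖ * Real.exp (-m * q.1 + -m * q.2) := by
            have := hKb q.2
            gcongr
  rw [← integral_const_mul, setIntegral_congr_fun measurableSet_Ioi h1,
    integral_integral_swap hint, ← integral_sub (hD.integrableOn_laplace_integrand ha h p)
      (hD.integrableOn_laplace_integrand hb h p)]
  refine setIntegral_congr_fun measurableSet_Ioi fun u hu => ?_
  rw [integral_mul_const, integral_ite_lt_exp _ hu, sub_mul, one_mul, ← mul_assoc, ← Real.exp_add]
  congr 4
  ring

end ResolventIdentity

/-! ### Local tightness and localized estimates -/

section Tightness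

variable {E Ω : Type*} [MetricSpace E] [ProperSpace E] [MeasurableSpace E] [BorelSpace E]
  {mΩ : MeasurableSpace Ω} {X : ℝ≥0 → Ω → E} {P : E → Measure Ω} {ℱ : Filtration ℝ≥0 mΩ}
  {O : Set E} {α : ℝ}

lemma killedSemigroup_univ (t : ℝ≥0) (h : ℝ≥0 × E → ℝ) (p : ℝ≥0 × E) :
    killedSemigroup X P univ t h p = ∫ ω, h (p.1 + t, X t ω) ∂P p.2 := by
  simp only [killedSemigroup, exitTime_univ, WithTop.coe_lt_top, if_true]

lemma FellerData.res_univ_const (hD : FellerData X P ℱ O) (hα : 0 < α) (c : ℝ) (p : ℝ≥0 × E) :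
    hD.unkilled.res hα (BoundedContinuousFunction.const _ c) p = c / α := by
  have := hD.std.isProbabilityMeasure p.2
  rw [hD.unkilled.res_apply, hD.unkilled.resolvent_eq hα]
  simp only [killedSemigroup_univ, BoundedContinuousFunction.const_apply, integral_const,
    probReal_univ, one_smul]
  rw [integral_mul_const, integral_exp_neg hα]
  ring

/-- A function of the state vanishing at infinity, seen as a function on space-time. -/
noncomputable def liftZero (φ : C₀(E, ℝ)) : (ℝ≥0 × E) →ᵇ ℝ :=
  φ.toBCF.compContinuous ⟨Prod.snd, continuous_snd⟩

lemma liftZero_apply (φ : C₀(E, ℝ)) (p : ℝ≥0 × E) : liftZero φ p = φ p.2 := rfl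

lemma FellerData.res_liftZero (hD : FellerData X P ℱ O) (hα : 0 < α) (φ : C₀(E, ℝ))
    (p : ℝ≥0 × E) : hD.unkilled.res hα (liftZero φ) p =
      ∫ u in Ioi (0 : ℝ), Real.exp (-α * u) * ∫ ω, φ (X u.toNNReal ω) ∂P p.2 := by
  rw [hD.unkilled.res_apply, hD.unkilled.resolvent_eq hα]
  simp only [killedSemigroup_univ, liftZero_apply]

lemma laplace_liftZero (φ : C₀(E, ℝ)) (p : ℝ≥0 × E) (u : ℝ) :
    Real.exp (-α * u) * ∫ ω, φ (X u.toNNReal ω) ∂P p.2 =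
      Real.exp (-α * u) * killedSemigroup X P univ u.toNNReal (liftZero φ) p := by
  simp only [killedSemigroup_univ, liftZero_apply]

lemma isCountablyGenerated_cocompact : IsCountablyGenerated (cocompact E) := by
  rcases isEmpty_or_nonempty E with h | ⟨⟨c⟩⟩
  · rw [filter_eq_bot_of_isEmpty (cocompact E)]
    infer_instance
  · rw [← Metric.cobounded_eq_cocompact, ← Metric.comap_dist_right_atTop c]
    infer_instance

/-- Resolvents of functions vanishing at infinity vanish at infinity in the state variable,
uniformly in time. -/
lemma FellerData.tendsto_res_liftZero (hD : FellerData X P ℱ O) (hα : 0 < α) (φ : C₀(E, ℝ)) :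
    Tendsto (fun y => hD.unkilled.res hα (liftZero φ) (0, y)) (cocompact E) (𝓝 0) := by
  have := isCountablyGenerated_cocompact (E := E)
  simp only [hD.res_liftZero]
  suffices Tendsto (fun y => ∫ u in Ioi (0 : ℝ), Real.exp (-α * u) * ∫ ω, φ (X u.toNNReal ω) ∂P y)
      (cocompact E) (𝓝 (∫ u in Ioi (0 : ℝ), Real.exp (-α * u) * 0)) by simpa using this
  refine tendsto_integral_filter_of_dominated_convergence
    (fun u => ‖liftZero φ‖ * Real.exp (-α * u)) (Eventually.of_forall fun y => ?_)
    (Eventually.of_forall fun y => ae_of_all _ fun u => ?_)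
    ((integrableOn_exp_neg hα).const_mul _) (ae_of_all _ fun u => ?_)
  · simp only [laplace_liftZero φ (0, y)]
    exact (hD.unkilled.integrableOn_laplace_integrand hα (liftZero φ) (0, y)).aestronglyMeasurable
  · rw [laplace_liftZero φ (0, y)]
    exact hD.unkilled.abs_laplace_integrand_le (liftZero φ) u (0, y)
  · obtain ⟨g, hg⟩ := hD.feller u.toNNReal φ
    simp only [← hg]
    exact g.zero_at_infty'.const_mul _

lemma FellerData.tendsto_res_cutoff (hD : FellerData X P ℱ O) (hα : 0 < α) (c : E)
    (p : ℝ≥0 × E) :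
    Tendsto (fun k => hD.unkilled.res hα (liftZero (cutoff c k)) p) atTop (𝓝 (1 / α)) := by
  simp only [hD.res_liftZero]
  have h0 : 1 / α = ∫ u in Ioi (0 : ℝ), Real.exp (-α * u) * 1 := by
    simp only [mul_one]; rw [integral_exp_neg hα]
  rw [h0]
  have hprob := hD.std.isProbabilityMeasure
  refine tendsto_integral_of_dominated_convergence
    (fun u => 1 * Real.exp (-α * u)) (fun k => ?_) ((integrableOn_exp_neg hα).const_mul _)
    (fun k => ae_of_all _ fun u => ?_) (ae_of_all _ fun u => ?_)
  · simp only [laplace_liftZero _ p]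
    exact (hD.unkilled.integrableOn_laplace_integrand hα _ p).aestronglyMeasurable
  · rw [Real.norm_eq_abs, abs_mul, abs_of_pos (Real.exp_pos _), mul_comm]
    refine mul_le_mul_of_nonneg_right (abs_integral_le_of_abs_le fun ω => ?_) (Real.exp_pos _).le
    rw [abs_of_nonneg (cutoff_nonneg _ _ _)]
    exact cutoff_le_one _ _ _
  · exact (hD.std.tendsto_integral_cutoff u.toNNReal c p.2).const_mul _

/-- The discounted payoff of a resolvent of a nonnegative function decreases in mean. -/
lemma FellerData.integral_discountedPayoff_res_le (hD : FellerData X P ℱ O) (hα : 0 < α)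
    (ψ : (ℝ≥0 × E) →ᵇ ℝ) (hψ : ∀ p, 0 ≤ ψ p) (s : ℝ≥0) (x : E) {θ : Ω → WithTop ℝ≥0}
    (hθ : IsStoppingTime ℱ θ) :
    ∫ ω, discountedPayoff X α (hD.unkilled.res hα ψ) s (θ ω) ω ∂P x ≤ hD.unkilled.res hα ψ (s, x) := by
  have := hD.std.isProbabilityMeasure x
  rw [← hD.integral_dynkin_univ hα ψ s x hθ]
  refine integral_mono ?_ ?_ fun ω => ?_
  · refine Integrable.of_bound (hD.std.measurable_discountedPayoff α
      (hD.unkilled.res hα ψ).continuous.measurable s hθ.measurable').aestronglyMeasurable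
      ‖hD.unkilled.res hα ψ‖ (ae_of_all _ fun ω => ?_)
    exact (abs_discountedPayoff_le fun _ => abs_apply_le _ _).trans
      (mul_le_of_le_one_right (norm_nonneg _) (discount_le_one hα _))
  · have := hD.unkilled.std.integrable_pathPayoff isOpen_univ hα ψ (hD.unkilled.res hα ψ) 0 s x
      hθ.measurable'
    simpa only [pathPayoff_univ] using this
  · have h1 : runningReward X α (0 : (ℝ≥0 × E) →ᵇ ℝ) s (θ ω) ω ≤ runningReward X α ψ s (θ ω) ω :=
      hD.std.runningReward_mono hα (0 : (ℝ≥0 × E) →ᵇ ℝ).continuous.measurable (abs_apply_le _)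
        ψ.continuous.measurable (abs_apply_le _) hψ _ _ _
    have h0 : runningReward X α (0 : (ℝ≥0 × E) →ᵇ ℝ) s (θ ω) ω = 0 := by
      simp [runningReward]
    simp only
    linarith

lemma integrable_discount {μ : Measure Ω} [IsFiniteMeasure μ] (hα : 0 < α) {σ : Ω → WithTop ℝ≥0}
    (hσ : Measurable σ) : Integrable (fun ω => discount α (σ ω)) μ :=
  Integrable.of_bound ((measurable_discount hα).comp hσ).aestronglyMeasurable 1
    (ae_of_all _ fun ω => by
      rw [Real.norm_eq_abs, abs_of_nonneg (discount_nonneg _)]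
      exact discount_le_one hα _)

/-- Started near `x₀`, the process needs a long time to leave a large ball. -/
lemma FellerData.exists_ball_integral_discount_le (hD : FellerData X P ℱ O) (hα : 0 < α) (x₀ : E)
    {η : ℝ} (hη : 0 < η) : ∃ R : ℝ, 1 ≤ R ∧ ∀ᶠ x in 𝓝 x₀,
      ∫ ω, discount α (exitTime X (Metric.ball x₀ R) ω) ∂P x ≤ η := by
  have hprob := hD.std.isProbabilityMeasure
  -- test with `ψ = 1 - φ` for a cutoff function `φ`
  obtain ⟨k, hk⟩ := ((hD.tendsto_res_cutoff hα x₀ (0, x₀)).eventually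
    (lt_mem_nhds (show 1 / α - η / (2 * α) < 1 / α by
      have : 0 < η / (2 * α) := by positivity
      linarith))).exists
  set ψ : (ℝ≥0 × E) →ᵇ ℝ := BoundedContinuousFunction.const _ 1 - liftZero (cutoff x₀ k) with hψ
  have hψ0 : ∀ p, 0 ≤ ψ p := fun p => sub_nonneg.2 (cutoff_le_one _ _ _)
  have hval : ∀ p, hD.unkilled.res hα ψ p = 1 / α - hD.unkilled.res hα (liftZero (cutoff x₀ k)) p := by
    intro p
    rw [hψ, hD.unkilled.res_sub, BoundedContinuousFunction.coe_sub, Pi.sub_apply, hD.res_univ_const]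
  have hsmall : ∀ᶠ x in 𝓝 x₀, hD.unkilled.res hα ψ (0, x) < η / (2 * α) := by
    have hc : Continuous fun x => hD.unkilled.res hα ψ (0, x) :=
      (hD.unkilled.res hα ψ).continuous.comp (by fun_prop)
    refine hc.continuousAt.eventually (gt_mem_nhds ?_)
    beta_reduce
    rw [hval]; linarith
  have hfar : ∀ᶠ y in cocompact E, hD.unkilled.res hα (liftZero (cutoff x₀ k)) (0, y) < 1 / (2 * α) :=
    (hD.tendsto_res_liftZero hα _).eventually (gt_mem_nhds (by positivity))
  obtain ⟨K, hK, hKsub⟩ := mem_cocompact.1 hfar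
  obtain ⟨R₀, hR₀⟩ := hK.isBounded.subset_ball x₀
  refine ⟨max R₀ 1, le_max_right _ _, ?_⟩
  set B := Metric.ball x₀ (max R₀ 1) with hB
  have hKB : K ⊆ B := hR₀.trans (Metric.ball_subset_ball (le_max_left _ _))
  have hσ := hD.std.isStoppingTime_exitTime (O := B) Metric.isOpen_ball
  filter_upwards [hsmall] with x hx
  have h1 := hD.integral_discountedPayoff_res_le hα ψ hψ0 0 x hσ
  have h2 : ∫ ω, 1 / (2 * α) * discount α (exitTime X B ω) ∂P x ≤
      ∫ ω, discountedPayoff X α (hD.unkilled.res hα ψ) 0 (exitTime X B ω) ω ∂P x := by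
    refine integral_mono ((integrable_discount hα hσ.measurable').const_mul _) ?_ fun ω => ?_
    · refine Integrable.of_bound (hD.std.measurable_discountedPayoff α
        (hD.unkilled.res hα ψ).continuous.measurable 0 hσ.measurable').aestronglyMeasurable
        ‖hD.unkilled.res hα ψ‖ (ae_of_all _ fun ω => ?_)
      exact (abs_discountedPayoff_le fun _ => abs_apply_le _ _).trans
        (mul_le_of_le_one_right (norm_nonneg _) (discount_le_one hα _))
    · have hle : discountedPayoff X α (fun _ => 1 / (2 * α)) 0 (exitTime X B ω) ω ≤
          discountedPayoff X α (hD.unkilled.res hα ψ) 0 (exitTime X B ω) ω := by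
        refine discountedPayoff_mono fun hne => ?_
        have hnot : X (exitTime X B ω).untopA ω ∉ K := fun h =>
          hD.std.notMem_exitTime Metric.isOpen_ball hne (hKB h)
        have hlt : hD.unkilled.res hα (liftZero (cutoff x₀ k)) (0, X (exitTime X B ω).untopA ω) <
          1 / (2 * α) := hKsub hnot
        rw [zero_add, hval]
        have e2 : hD.unkilled.res hα (liftZero (cutoff x₀ k))
            ((exitTime X B ω).untopA, X (exitTime X B ω).untopA ω) =
            hD.unkilled.res hα (liftZero (cutoff x₀ k)) (0, X (exitTime X B ω).untopA ω) := by
          rw [hD.res_liftZero, hD.res_liftZero]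
        rw [e2]
        have : 1 / α = 1 / (2 * α) + 1 / (2 * α) := by field_simp; norm_num
        linarith
      refine le_trans (le_of_eq ?_) hle
      cases hθ : exitTime X B ω with
      | top => simp
      | coe t => rw [discount_coe, discountedPayoff_coe, mul_comm]
  rw [integral_const_mul] at h2
  have h3 := h2.trans (h1.trans hx.le)
  have h4 : 1 / (2 * α) * ∫ ω, discount α (exitTime X B ω) ∂P x ≤ 1 / (2 * α) * η := by
    refine h3.trans (le_of_eq ?_); ring
  exact le_of_mul_le_mul_left h4 (by positivity)

/-- **Local tightness**: started near `p₀`, the space-time process stays in a compact set up to a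
stopping time whose expected discount factor is small. -/
lemma FellerData.exists_compact_stoppingTime (hD : FellerData X P ℱ O) (hα : 0 < α)
    (p₀ : ℝ≥0 × E) {η : ℝ} (hη : 0 < η) :
    ∃ L : Set (ℝ≥0 × E), IsCompact L ∧ ∃ σ : Ω → WithTop ℝ≥0, IsStoppingTime ℱ σ ∧
      ∀ᶠ p in 𝓝 p₀, p ∈ L ∧ (∀ ω (t : ℝ≥0), (t : WithTop ℝ≥0) < σ ω → (p.1 + t, X t ω) ∈ L) ∧
        ∫ ω, discount α (σ ω) ∂P p.2 ≤ η := by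
  have hprob := hD.std.isProbabilityMeasure
  obtain ⟨R, hR, hev⟩ := hD.exists_ball_integral_discount_le hα p₀.2 (half_pos hη)
  have hlim : Tendsto (fun n : ℕ => Real.exp (-α * n)) atTop (𝓝 0) := by
    refine Real.tendsto_exp_atBot.comp ?_
    exact tendsto_natCast_atTop_atTop.const_mul_atTop_of_neg (neg_lt_zero.2 hα)
  obtain ⟨n, hn⟩ := (hlim.eventually (gt_mem_nhds (half_pos hη))).exists
  set σB := exitTime X (Metric.ball p₀.2 R) with hσB
  have hσ := hD.std.isStoppingTime_exitTime (O := Metric.ball p₀.2 R) Metric.isOpen_ball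
  refine ⟨Icc 0 (p₀.1 + 1 + n) ×ˢ Metric.closedBall p₀.2 R,
    isCompact_Icc.prod (isCompact_closedBall _ _), fun ω => min (σB ω) ((n : ℝ≥0) : WithTop ℝ≥0),
    hσ.min (isStoppingTime_const ℱ (n : ℝ≥0)), ?_⟩
  have h1 : ∀ᶠ s in 𝓝 p₀.1, s < p₀.1 + 1 := gt_mem_nhds (lt_add_one _)
  have h2 : ∀ᶠ x in 𝓝 p₀.2, x ∈ Metric.ball p₀.2 R :=
    Metric.ball_mem_nhds _ (by linarith)
  have hnhds : 𝓝 p₀ = 𝓝 p₀.1 ×ˢ 𝓝 p₀.2 := nhds_prod_eq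
  rw [hnhds]
  filter_upwards [h1.prod_mk (h2.and hev)] with p ⟨hp1, hp2, hp3⟩
  refine ⟨⟨⟨zero_le, hp1.le.trans le_self_add⟩, Metric.ball_subset_closedBall hp2⟩,
    fun ω t ht => ⟨⟨zero_le, ?_⟩, ?_⟩, ?_⟩
  · have : t < n := WithTop.coe_lt_coe.1 (lt_of_lt_of_le ht (min_le_right _ _))
    exact add_le_add hp1.le this.le
  · exact Metric.ball_subset_closedBall
      (mem_of_lt_exitTime (lt_of_lt_of_le ht (min_le_left _ _)))
  · have hle : ∀ ω, discount α (min (σB ω) ((n : ℝ≥0) : WithTop ℝ≥0)) ≤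
        discount α (σB ω) + Real.exp (-α * n) := by
      intro ω
      rcases le_total (σB ω) ((n : ℝ≥0) : WithTop ℝ≥0) with h | h
      · rw [min_eq_left h]
        linarith [Real.exp_pos (-α * n)]
      · rw [min_eq_right h, discount_coe, NNReal.coe_natCast]
        linarith [discount_nonneg (α := α) (σB ω)]
    have i1 := integrable_discount (μ := P p.2) hα hσ.measurable'
    refine (integral_mono (integrable_discount hα
      (hσ.min (isStoppingTime_const ℱ (n : ℝ≥0))).measurable')
      (i1.add (integrable_const _)) hle).trans ?_
    simp only [Pi.add_apply]
    rw [integral_add i1 (integrable_const _)]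
    simp only [integral_const, probReal_univ, one_smul]
    linarith

/-- A running reward that is small as long as `t < σ` is small up to the discount at `σ`. -/
lemma IsStandardProcess.abs_runningReward_le_of_lt (hX : IsStandardProcess X P ℱ) (hα : 0 < α)
    {h : ℝ≥0 × E → ℝ} (hh : Measurable h) {C η : ℝ} (hη : 0 ≤ η) (hC : ∀ p, |h p| ≤ C)
    {s : ℝ≥0} {θ σ : WithTop ℝ≥0} {ω : Ω}
    (hσ : ∀ t : ℝ≥0, (t : WithTop ℝ≥0) < σ → |h (s + t, X t ω)| ≤ η) :
    |runningReward X α h s θ ω| ≤ η / α + C / α * discount α σ := by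
  have hC0 : 0 ≤ C := (abs_nonneg _).trans (hC (s, X 0 ω))
  have h1 : |runningReward X α h s (min θ σ) ω| ≤ η / α := by
    rw [runningReward_congr (f' := fun p => max (-η) (min (h p) η))]
    · refine abs_runningReward_le hα (fun p => abs_le.2 ⟨le_max_left _ _, ?_⟩) _ _ _
      exact max_le (by linarith) (min_le_right _ _)
    · intro u hu
      have := abs_le.1 (hσ u (lt_of_lt_of_le hu (min_le_right _ _)))
      rw [min_eq_left this.2, max_eq_right this.1]
  rcases le_total θ σ with hle | hle
  · rw [min_eq_left hle] at h1
    exact h1.trans (le_add_of_nonneg_right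
      (mul_nonneg (div_nonneg hC0 hα.le) (discount_nonneg _)))
  · rw [min_eq_right hle] at h1
    cases σ with
    | top =>
      rw [top_le_iff] at hle
      rw [hle]
      simpa using h1
    | coe a =>
      have h2 := hX.abs_runningReward_sub_le hα hh hC s hle WithTop.coe_ne_top ω
      rw [untopA_coe, ← discount_coe] at h2
      have := abs_add_le (runningReward X α h s a ω)
        (runningReward X α h s θ ω - runningReward X α h s a ω)
      rw [add_sub_cancel] at this
      linarith

lemma abs_discountedPayoff_sub_le (hα : 0 < α) {G G' : ℝ≥0 × E → ℝ} {C η : ℝ} (hη : 0 ≤ η)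
    (hG : ∀ p, |G p| ≤ C) (hG' : ∀ p, |G' p| ≤ C) {s : ℝ≥0} {θ σ : WithTop ℝ≥0} {ω : Ω}
    (hσ : ∀ t : ℝ≥0, (t : WithTop ℝ≥0) < σ → |G (s + t, X t ω) - G' (s + t, X t ω)| ≤ η) :
    |discountedPayoff X α G s θ ω - discountedPayoff X α G' s θ ω| ≤
      η + 2 * C * discount α σ := by
  have hC0 : 0 ≤ C := (abs_nonneg _).trans (hG (s, X 0 ω))
  have hd := discount_nonneg (α := α) σ
  rcases lt_or_ge θ σ with h | h
  · obtain ⟨a, rfl⟩ := WithTop.ne_top_iff_exists.1 (ne_top_of_lt h)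
    rw [discountedPayoff_coe, discountedPayoff_coe, ← mul_sub]
    have := abs_exp_neg_mul_le hα a (hσ a h)
    nlinarith [mul_nonneg hC0 hd]
  · have h1 := abs_discountedPayoff_le (X := X) (α := α) (h := G) (s := s) (θ := θ) (ω := ω)
      fun _ => hG _
    have h2 := abs_discountedPayoff_le (X := X) (α := α) (h := G') (s := s) (θ := θ) (ω := ω)
      fun _ => hG' _
    have h3 := mul_le_mul_of_nonneg_left (discount_anti hα h) hC0
    have := abs_sub (discountedPayoff X α G s θ ω) (discountedPayoff X α G' s θ ω)
    linarith

/-- Changing the terminal payoffs by little as long as `t < σ` changes the payoff by little, up to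
the discount at `σ`. -/
lemma abs_pathPayoff_sub_le (hα : 0 < α) (f : ℝ≥0 × E → ℝ) {G G' H H' : ℝ≥0 × E → ℝ} {C η : ℝ}
    (hη : 0 ≤ η) (hG : ∀ p, |G p| ≤ C) (hG' : ∀ p, |G' p| ≤ C) (hH : ∀ p, |H p| ≤ C)
    (hH' : ∀ p, |H' p| ≤ C) {s : ℝ≥0} {θ σ : WithTop ℝ≥0} {ω : Ω}
    (hσ : ∀ t : ℝ≥0, (t : WithTop ℝ≥0) < σ → |G (s + t, X t ω) - G' (s + t, X t ω)| ≤ η ∧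
      |H (s + t, X t ω) - H' (s + t, X t ω)| ≤ η) :
    |pathPayoff X O α f G H s θ ω - pathPayoff X O α f G' H' s θ ω| ≤
      η + 2 * C * discount α σ := by
  rw [pathPayoff, pathPayoff, add_sub_add_left_eq_sub]
  split_ifs
  · exact abs_discountedPayoff_sub_le hα hη hG hG' fun t ht => (hσ t ht).1
  · exact abs_discountedPayoff_sub_le hα hη hH hH' fun t ht => (hσ t ht).2

/-- Stopping no later than `σ` changes the payoff by at most a multiple of the discount at `σ`. -/
lemma IsStandardProcess.abs_pathPayoff_min_sub_le (hX : IsStandardProcess X P ℱ) (hα : 0 < α)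
    (f G H : (ℝ≥0 × E) →ᵇ ℝ) (s : ℝ≥0) (θ σ : WithTop ℝ≥0) (ω : Ω) :
    |pathPayoff X O α f G H s (min θ σ) ω - pathPayoff X O α f G H s θ ω| ≤
      (‖f‖ / α + 2 * (‖G‖ + ‖H‖)) * discount α σ := by
  have hnn : 0 ≤ (‖f‖ / α + 2 * (‖G‖ + ‖H‖)) * discount α σ :=
    mul_nonneg (by positivity) (discount_nonneg σ)
  rcases le_or_gt θ σ with h | h
  · rw [min_eq_left h, sub_self, abs_zero]
    exact hnn
  rw [min_eq_right h.le]
  rcases le_or_gt (exitTime X O ω) σ with he | he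
  · rw [pathPayoff, pathPayoff, min_eq_right he, min_eq_right (he.trans h.le), if_neg (not_lt.2 he),
      if_neg (not_lt.2 (he.trans h.le)), sub_self, abs_zero]
    exact hnn
  · have hne : σ ≠ ⊤ := ne_top_of_lt h
    have hd : Real.exp (-α * σ.untopA) = discount α σ := (if_neg hne).symm
    have h1 := hX.abs_runningReward_sub_le hα f.continuous.measurable (abs_apply_le f) s
      (le_min h.le he.le) hne ω
    rw [hd, abs_sub_comm] at h1
    have hp : ∀ (h : (ℝ≥0 × E) →ᵇ ℝ) (θ' : WithTop ℝ≥0), σ ≤ θ' →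
        |discountedPayoff X α h s θ' ω| ≤ ‖h‖ * discount α σ := fun h θ' hθ' =>
      (abs_discountedPayoff_le fun _ => abs_apply_le h _).trans
        (mul_le_mul_of_nonneg_left (discount_anti hα hθ') (norm_nonneg _))
    rw [pathPayoff, pathPayoff, min_eq_left he.le, if_pos he, add_sub_add_comm]
    refine (abs_add_le _ _).trans ?_
    have hG := hp G σ le_rfl
    have hd0 := discount_nonneg (α := α) σ
    have hGd := mul_nonneg (norm_nonneg G) hd0
    have hHd := mul_nonneg (norm_nonneg H) hd0
    split_ifs
    · have := (abs_sub _ _).trans (add_le_add hG (hp G θ h.le))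
      linarith
    · have := (abs_sub _ _).trans (add_le_add hG (hp H _ he.le))
      linarith

end Tightness

/-! ### Approximation by resolvents, locally uniformly -/

section Ray

variable {E Ω : Type*} [MetricSpace E] [ProperSpace E] [MeasurableSpace E] [BorelSpace E]
  {mΩ : MeasurableSpace Ω} {X : ℝ≥0 → Ω → E} {P : E → Measure Ω} {ℱ : Filtration ℝ≥0 mΩ}
  {O : Set E} {α : ℝ}

/-- The approximation `(n + 1) R_{n + 1} G` of `G`, with `R` the resolvent of the process without
killing. -/
noncomputable def FellerData.smooth (hD : FellerData X P ℱ O) (n : ℕ) (G : (ℝ≥0 × E) →ᵇ ℝ) :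
    (ℝ≥0 × E) →ᵇ ℝ :=
  ((n : ℝ) + 1) • hD.unkilled.res (Nat.cast_add_one_pos n) G

lemma FellerData.smooth_apply (hD : FellerData X P ℱ O) (n : ℕ) (G : (ℝ≥0 × E) →ᵇ ℝ)
    (p : ℝ≥0 × E) :
    hD.smooth n G p = ((n : ℝ) + 1) * hD.unkilled.res (Nat.cast_add_one_pos n) G p := rfl

lemma FellerData.abs_smooth_le (hD : FellerData X P ℱ O) (n : ℕ) (G : (ℝ≥0 × E) →ᵇ ℝ)
    (p : ℝ≥0 × E) : |hD.smooth n G p| ≤ ‖G‖ := by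
  have hn : (0 : ℝ) < n + 1 := Nat.cast_add_one_pos n
  rw [hD.smooth_apply, abs_mul, abs_of_pos hn]
  have := hD.unkilled.abs_resolvent_le hn (abs_apply_le G) p
  rw [le_div_iff₀ hn, mul_comm] at this
  exact this

lemma FellerData.smooth_mono (hD : FellerData X P ℱ O) (n : ℕ) {G H : (ℝ≥0 × E) →ᵇ ℝ}
    (h : ∀ p, G p ≤ H p) (p : ℝ≥0 × E) : hD.smooth n G p ≤ hD.smooth n H p :=
  mul_le_mul_of_nonneg_left (hD.unkilled.res_mono (Nat.cast_add_one_pos n) h p)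
    (Nat.cast_add_one_pos n).le

lemma FellerData.smooth_sub (hD : FellerData X P ℱ O) (n : ℕ) (G H : (ℝ≥0 × E) →ᵇ ℝ) :
    hD.smooth n (G - H) = hD.smooth n G - hD.smooth n H := by
  rw [smooth, hD.unkilled.res_sub, smul_sub]; rfl

/-- By the resolvent identity, all resolvents have the same range. -/
lemma FellerData.exists_res_eq_smooth (hD : FellerData X P ℱ O) (hα : 0 < α) (n : ℕ)
    (G : (ℝ≥0 × E) →ᵇ ℝ) : ∃ g, hD.smooth n G = hD.unkilled.res hα g := by
  have hn : (0 : ℝ) < n + 1 := Nat.cast_add_one_pos n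
  refine ⟨((n : ℝ) + 1) • (G - ((n : ℝ) + 1 - α) • hD.unkilled.res hn G), ?_⟩
  rw [hD.unkilled.res_smul, hD.unkilled.res_sub, hD.unkilled.res_smul, hD.unkilled.res_res hα hn, sub_sub_cancel]
  rfl

lemma FellerData.tendsto_smooth (hD : FellerData X P ℱ O) (G : (ℝ≥0 × E) →ᵇ ℝ) (p : ℝ≥0 × E) :
    Tendsto (fun n => hD.smooth n G p) atTop (𝓝 (G p)) := by
  have hprob := hD.std.isProbabilityMeasure p.2
  set K : ℝ → ℝ := fun u => killedSemigroup X P univ u.toNNReal G p with hK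
  have hKm : Measurable K := (hD.unkilled.measurable_uncurry_killedSemigroup G).comp
    (f := fun u : ℝ => (u.toNNReal, p)) (by fun_prop)
  have hKb : ∀ u, |K u| ≤ ‖G‖ := fun u => hD.std.abs_killedSemigroup_le _ G p
  have hval : ∀ n, hD.smooth n G p =
      ∫ r in Ioi (0 : ℝ), Real.exp (-1 * r) * K (r / ((n : ℝ) + 1)) := by
    intro n
    have hn : (0 : ℝ) < n + 1 := Nat.cast_add_one_pos n
    have h1 := integral_comp_mul_left_Ioi' (fun r => Real.exp (-1 * r) * K (r / ((n : ℝ) + 1)))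
      0 hn
    rw [mul_zero] at h1
    rw [hD.smooth_apply, hD.unkilled.res_apply, hD.unkilled.resolvent_eq hn, ← h1, smul_eq_mul]
    congr 1
    refine integral_congr_ae (ae_of_all _ fun u => ?_)
    simp only
    rw [mul_div_cancel_left₀ _ hn.ne']
    congr 2
    ring
  simp only [hval]
  have hlim : G p = ∫ r in Ioi (0 : ℝ), Real.exp (-1 * r) * G p := by
    rw [integral_mul_const, integral_exp_neg one_pos]; simp
  rw [hlim]
  refine tendsto_integral_of_dominated_convergence (fun r => ‖G‖ * Real.exp (-1 * r))
    (fun n => ?_) ((integrableOn_exp_neg one_pos).const_mul _)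
    (fun n => ae_of_all _ fun r => ?_) (ae_of_all _ fun r => ?_)
  · exact (Measurable.mul (by fun_prop) (hKm.comp (by fun_prop))).aestronglyMeasurable
  · rw [Real.norm_eq_abs, abs_mul, abs_of_pos (Real.exp_pos _), mul_comm]
    exact mul_le_mul_of_nonneg_right (hKb _) (Real.exp_pos _).le
  · refine Tendsto.const_mul _ ?_
    have h0 : killedSemigroup X P univ 0 G p = G p := by
      rw [killedSemigroup_univ]
      have : (fun ω => G (p.1 + 0, X 0 ω)) =ᵐ[P p.2] fun _ => G p := by
        filter_upwards [hD.std.start p.2] with ω hω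
        rw [hω, add_zero]
      rw [integral_congr_ae this]
      simp
    have hc := hD.unkilled.std.killedSemigroup_rightContinuous isOpen_univ G p 0
    rw [ContinuousWithinAt, h0, show Ici (0 : ℝ≥0) = univ from
      Set.eq_univ_of_forall fun _ => mem_Ici.2 zero_le, nhdsWithin_univ] at hc
    refine hc.comp ?_
    have h1 : Tendsto (fun n : ℕ => r / ((n : ℝ) + 1)) atTop (𝓝 0) :=
      tendsto_const_nhds.div_atTop (tendsto_atTop_add_const_right _ _ tendsto_natCast_atTop_atTop)
    have h2 := (continuous_real_toNNReal.tendsto 0).comp h1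
    rwa [Real.toNNReal_zero] at h2

/-- A bounded continuous function is `1`-excessive if `b R_{b + 1} v ≤ v` for all `b ≥ 0`, with `R`
the resolvent of the process without killing. -/
def IsExcessive (X : ℝ≥0 → Ω → E) (P : E → Measure Ω) (v : (ℝ≥0 × E) →ᵇ ℝ) : Prop :=
  ∀ b : ℝ, 0 ≤ b → ∀ p, b * resolvent X P univ (b + 1) v p ≤ v p

lemma FellerData.isExcessive_res (hD : FellerData X P ℱ O) {φ : (ℝ≥0 × E) →ᵇ ℝ}
    (hφ : ∀ p, 0 ≤ φ p) : IsExcessive X P (hD.unkilled.res one_pos φ) := by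
  intro b hb p
  have hb1 : (0 : ℝ) < b + 1 := by linarith
  rw [← hD.unkilled.res_apply hb1]
  have h1 := DFunLike.congr_fun (hD.unkilled.res_res hb1 one_pos φ) p
  simp only [BoundedContinuousFunction.coe_smul, smul_eq_mul, BoundedContinuousFunction.coe_sub,
    Pi.sub_apply] at h1
  have h2 : 0 ≤ hD.unkilled.res hb1 φ p := by
    have := hD.unkilled.res_mono hb1 (f := BoundedContinuousFunction.const _ 0) (g := φ) hφ p
    rwa [hD.res_univ_const, zero_div] at this
  linarith

lemma FellerData.isExcessive_const (hD : FellerData X P ℱ O) {c : ℝ} (hc : 0 ≤ c) :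
    IsExcessive X P (BoundedContinuousFunction.const _ c) := by
  intro b hb p
  have hb1 : (0 : ℝ) < b + 1 := by linarith
  rw [← hD.unkilled.res_apply hb1, hD.res_univ_const, BoundedContinuousFunction.const_apply,
    mul_div_assoc', div_le_iff₀ hb1]
  nlinarith

lemma FellerData.isExcessive_add (hD : FellerData X P ℱ O) {v w : (ℝ≥0 × E) →ᵇ ℝ}
    (hv : IsExcessive X P v) (hw : IsExcessive X P w) : IsExcessive X P (v + w) := by
  intro b hb p
  have hb1 : (0 : ℝ) < b + 1 := by linarith
  rw [← hD.unkilled.res_apply hb1, hD.unkilled.res_add, BoundedContinuousFunction.coe_add,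
    BoundedContinuousFunction.coe_add, Pi.add_apply, Pi.add_apply, mul_add]
  exact add_le_add (hv b hb p) (hw b hb p)

lemma FellerData.isExcessive_smul (hD : FellerData X P ℱ O) {v : (ℝ≥0 × E) →ᵇ ℝ}
    (hv : IsExcessive X P v) {c : ℝ} (hc : 0 ≤ c) : IsExcessive X P (c • v) := by
  intro b hb p
  have hb1 : (0 : ℝ) < b + 1 := by linarith
  rw [← hD.unkilled.res_apply hb1, hD.unkilled.res_smul, BoundedContinuousFunction.coe_smul,
    BoundedContinuousFunction.coe_smul]
  simp only [smul_eq_mul]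
  rw [mul_left_comm]
  exact mul_le_mul_of_nonneg_left (hv b hb p) hc

lemma FellerData.isExcessive_inf (hD : FellerData X P ℱ O) {v w : (ℝ≥0 × E) →ᵇ ℝ}
    (hv : IsExcessive X P v) (hw : IsExcessive X P w) : IsExcessive X P (v ⊓ w) := by
  intro b hb p
  have hb1 : (0 : ℝ) < b + 1 := by linarith
  have h1 := hD.unkilled.res_mono hb1 (f := v ⊓ w) (g := v) (fun p => min_le_left _ _) p
  have h2 := hD.unkilled.res_mono hb1 (f := v ⊓ w) (g := w) (fun p => min_le_right _ _) p
  exact le_min ((mul_le_mul_of_nonneg_left h1 hb).trans (hv b hb p))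
    ((mul_le_mul_of_nonneg_left h2 hb).trans (hw b hb p))

/-- For excessive functions the approximation is monotone, hence locally uniform by Dini's
theorem. -/
lemma FellerData.tendstoLocallyUniformly_smooth_of_isExcessive (hD : FellerData X P ℱ O)
    {v : (ℝ≥0 × E) →ᵇ ℝ} (hv : IsExcessive X P v) :
    TendstoLocallyUniformly (fun n => ⇑(hD.smooth n v)) v atTop := by
  have hpos : ∀ n : ℕ, (0 : ℝ) < n + 1 := Nat.cast_add_one_pos
  set r : ℕ → (ℝ≥0 × E) → ℝ := fun n p => hD.unkilled.res (hpos n) v p with hr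
  have hsmall : TendstoUniformly r (fun _ => 0) atTop := by
    rw [Metric.tendstoUniformly_iff]
    intro ε hε
    have hlim : Tendsto (fun n : ℕ => ‖v‖ / ((n : ℝ) + 1)) atTop (𝓝 0) :=
      tendsto_const_nhds.div_atTop (tendsto_atTop_add_const_right _ _ tendsto_natCast_atTop_atTop)
    filter_upwards [hlim.eventually (gt_mem_nhds hε)] with n hn p
    rw [dist_comm, dist_zero_right]
    exact (hD.unkilled.abs_resolvent_le (hpos n) (abs_apply_le v) p).trans_lt hn
  have hdini : TendstoLocallyUniformly (fun (n : ℕ) p => (n : ℝ) * r n p) v atTop := by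
    refine Monotone.tendstoLocallyUniformly_of_forall_tendsto (fun n => ?_) (fun n m hnm p => ?_)
      v.continuous fun p => ?_
    · exact continuous_const.mul (hD.unkilled.res (hpos n) v).continuous
    · have hnm' : (n : ℝ) ≤ m := by exact_mod_cast hnm
      have h1 := DFunLike.congr_fun (hD.unkilled.res_res (hpos m) (hpos n) v) p
      have h2 := hD.unkilled.res_mono (hpos m) (f := (n : ℝ) • hD.unkilled.res (hpos n) v) (g := v)
        (fun p => hv n n.cast_nonneg p) p
      rw [hD.unkilled.res_smul] at h2
      simp only [BoundedContinuousFunction.coe_smul, smul_eq_mul,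
        BoundedContinuousFunction.coe_sub, Pi.sub_apply] at h1 h2
      simp only [hr]
      nlinarith [mul_le_mul_of_nonneg_left h2 (sub_nonneg.2 hnm')]
    · have h1 := (hD.tendsto_smooth v p).sub (hsmall.tendsto_at p)
      rw [sub_zero] at h1
      refine h1.congr fun n => ?_
      simp only [hr, hD.smooth_apply]
      ring
  have := hdini.add hsmall.tendstoLocallyUniformly
  have e1 : (⇑v + fun _ : ℝ≥0 × E => (0 : ℝ)) = ⇑v := add_zero ⇑v
  rw [e1] at this
  refine this.congr fun n p => ?_
  simp only [hr, Pi.add_apply, hD.smooth_apply]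
  ring

/-- Differences of excessive functions. -/
def IsExcessiveDiff (X : ℝ≥0 → Ω → E) (P : E → Measure Ω) (g : (ℝ≥0 × E) →ᵇ ℝ) : Prop :=
  ∃ v w, IsExcessive X P v ∧ IsExcessive X P w ∧ g = v - w

lemma FellerData.tendstoLocallyUniformly_smooth_of_isExcessiveDiff (hD : FellerData X P ℱ O)
    {g : (ℝ≥0 × E) →ᵇ ℝ} (hg : IsExcessiveDiff X P g) :
    TendstoLocallyUniformly (fun n => ⇑(hD.smooth n g)) g atTop := by
  obtain ⟨v, w, hv, hw, rfl⟩ := hg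
  have := (hD.tendstoLocallyUniformly_smooth_of_isExcessive hv).sub
    (hD.tendstoLocallyUniformly_smooth_of_isExcessive hw)
  refine this.congr fun n p => ?_
  rw [hD.smooth_sub]
  rfl

lemma IsExcessiveDiff.neg {g : (ℝ≥0 × E) →ᵇ ℝ} (hg : IsExcessiveDiff X P g) :
    IsExcessiveDiff X P (-g) := by
  obtain ⟨v, w, hv, hw, rfl⟩ := hg
  exact ⟨w, v, hw, hv, neg_sub _ _⟩

lemma FellerData.isExcessiveDiff_const (hD : FellerData X P ℱ O) (c : ℝ) :
    IsExcessiveDiff X P (BoundedContinuousFunction.const _ c) := by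
  refine ⟨_, _, hD.isExcessive_const (le_max_left 0 c), hD.isExcessive_const (le_max_left 0 (-c)), ?_⟩
  ext p
  simp only [BoundedContinuousFunction.const_apply, BoundedContinuousFunction.coe_sub, Pi.sub_apply]
  rcases le_total 0 c with h | h
  · rw [max_eq_right h, max_eq_left (by linarith), sub_zero]
  · rw [max_eq_left h, max_eq_right (by linarith)]; ring

lemma FellerData.isExcessiveDiff_add (hD : FellerData X P ℱ O) {g h : (ℝ≥0 × E) →ᵇ ℝ}
    (hg : IsExcessiveDiff X P g) (hh : IsExcessiveDiff X P h) : IsExcessiveDiff X P (g + h) := by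
  obtain ⟨v, w, hv, hw, rfl⟩ := hg
  obtain ⟨v', w', hv', hw', rfl⟩ := hh
  exact ⟨_, _, hD.isExcessive_add hv hv', hD.isExcessive_add hw hw', sub_add_sub_comm _ _ _ _⟩

lemma FellerData.isExcessiveDiff_smul (hD : FellerData X P ℱ O) {g : (ℝ≥0 × E) →ᵇ ℝ}
    (hg : IsExcessiveDiff X P g) (c : ℝ) : IsExcessiveDiff X P (c • g) := by
  have key : ∀ (c : ℝ) (g : (ℝ≥0 × E) →ᵇ ℝ), 0 ≤ c → IsExcessiveDiff X P g →
      IsExcessiveDiff X P (c • g) := by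
    rintro c _ hc ⟨v, w, hv, hw, rfl⟩
    exact ⟨_, _, hD.isExcessive_smul hv hc, hD.isExcessive_smul hw hc, smul_sub _ _ _⟩
  rcases le_total 0 c with h | h
  · exact key c g h hg
  · have := key (-c) (-g) (by linarith) hg.neg
    rwa [neg_smul_neg] at this

lemma FellerData.isExcessiveDiff_inf (hD : FellerData X P ℱ O) {g h : (ℝ≥0 × E) →ᵇ ℝ}
    (hg : IsExcessiveDiff X P g) (hh : IsExcessiveDiff X P h) : IsExcessiveDiff X P (g ⊓ h) := by
  obtain ⟨v, w, hv, hw, rfl⟩ := hg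
  obtain ⟨v', w', hv', hw', rfl⟩ := hh
  refine ⟨(v + w') ⊓ (v' + w), w + w', hD.isExcessive_inf (hD.isExcessive_add hv hw')
    (hD.isExcessive_add hv' hw), hD.isExcessive_add hw hw', ?_⟩
  ext p
  change min (v p - w p) (v' p - w' p) = min (v p + w' p) (v' p + w p) - (w p + w' p)
  rw [← min_sub_sub_right]
  congr 1 <;> ring

lemma FellerData.isExcessiveDiff_sup (hD : FellerData X P ℱ O) {g h : (ℝ≥0 × E) →ᵇ ℝ}
    (hg : IsExcessiveDiff X P g) (hh : IsExcessiveDiff X P h) : IsExcessiveDiff X P (g ⊔ h) := by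
  have := (hD.isExcessiveDiff_inf hg.neg hh.neg).neg
  rwa [neg_inf, neg_neg, neg_neg] at this

lemma FellerData.isExcessiveDiff_res (hD : FellerData X P ℱ O) (φ : (ℝ≥0 × E) →ᵇ ℝ) :
    IsExcessiveDiff X P (hD.unkilled.res one_pos φ) := by
  refine ⟨hD.unkilled.res one_pos (φ + BoundedContinuousFunction.const _ ‖φ‖),
    hD.unkilled.res one_pos (BoundedContinuousFunction.const _ ‖φ‖), hD.isExcessive_res fun p => ?_,
    hD.isExcessive_res fun p => norm_nonneg φ, ?_⟩
  · have := (abs_le.1 (abs_apply_le φ p)).1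
    change 0 ≤ φ p + ‖φ‖
    linarith
  · rw [← hD.unkilled.res_sub, add_sub_cancel_right]

lemma FellerData.exists_isExcessiveDiff_ne (hD : FellerData X P ℱ O) {p q : ℝ≥0 × E}
    (hpq : p ≠ q) : ∃ g, IsExcessiveDiff X P g ∧ g p ≠ g q := by
  set φ : (ℝ≥0 × E) →ᵇ ℝ := BoundedContinuousFunction.ofNormedAddCommGroup
    (fun z => min 1 (dist z p)) (by fun_prop) 1 (fun z => by
      rw [Real.norm_eq_abs, abs_of_nonneg (le_min zero_le_one dist_nonneg)]
      exact min_le_left _ _) with hφ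
  have hne : φ p ≠ φ q := by
    change min 1 (dist p p) ≠ min 1 (dist q p)
    have : 0 < min 1 (dist q p) := lt_min one_pos (dist_pos.2 hpq.symm)
    rw [dist_self, min_eq_right zero_le_one]
    exact this.ne
  by_contra! hcon
  refine hne (tendsto_nhds_unique (hD.tendsto_smooth φ p) ?_)
  refine (hD.tendsto_smooth φ q).congr fun n => ?_
  obtain ⟨g, hg⟩ := hD.exists_res_eq_smooth one_pos n φ
  rw [hg]
  exact (hcon _ (hD.isExcessiveDiff_res g)).symm

/-- On a compact set, every bounded continuous function is approximated by differences of excessive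
functions, without increasing the bound. -/
lemma FellerData.exists_isExcessiveDiff_near (hD : FellerData X P ℱ O) (G : (ℝ≥0 × E) →ᵇ ℝ)
    {L : Set (ℝ≥0 × E)} (hL : IsCompact L) {η : ℝ} (hη : 0 < η) :
    ∃ g, IsExcessiveDiff X P g ∧ (∀ p ∈ L, |g p - G p| ≤ η) ∧ ∀ p, |g p| ≤ ‖G‖ := by
  have : CompactSpace L := isCompact_iff_compactSpace.1 hL
  let ρ : ((ℝ≥0 × E) →ᵇ ℝ) → C(L, ℝ) := fun g => ⟨fun z => g z, by fun_prop⟩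
  have hcl := ContinuousMap.sublattice_closure_eq_top (ρ '' {g | IsExcessiveDiff X P g})
    ⟨_, mem_image_of_mem ρ (hD.isExcessiveDiff_const 0)⟩
    (by
      rintro _ ⟨g, hg, rfl⟩ _ ⟨h, hh, rfl⟩
      exact ⟨g ⊓ h, hD.isExcessiveDiff_inf hg hh, rfl⟩)
    (by
      rintro _ ⟨g, hg, rfl⟩ _ ⟨h, hh, rfl⟩
      exact ⟨g ⊔ h, hD.isExcessiveDiff_sup hg hh, rfl⟩)
    (by
      intro v x y
      by_cases hxy : x = y
      · subst hxy
        exact ⟨_, ⟨_, hD.isExcessiveDiff_const (v x), rfl⟩, rfl, rfl⟩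
      obtain ⟨g, hg, hne⟩ := hD.exists_isExcessiveDiff_ne (fun h => hxy (Subtype.ext h))
      -- the affine function of `g` taking the prescribed values
      have hne' : g y - g x ≠ 0 := sub_ne_zero.2 hne.symm
      set c := (v y - v x) / (g y - g x) with hc
      refine ⟨_, ⟨c • g + BoundedContinuousFunction.const _ (v x - c * g x),
        hD.isExcessiveDiff_add (hD.isExcessiveDiff_smul hg c) (hD.isExcessiveDiff_const _), rfl⟩,
        ?_, ?_⟩
      · change c * g x + (v x - c * g x) = v x
        ring
      · change c * g y + (v x - c * g x) = v y
        have : c * (g y - g x) = v y - v x := div_mul_cancel₀ _ hne'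
        linarith)
  have hmem : ρ G ∈ closure (ρ '' {g | IsExcessiveDiff X P g}) := by rw [hcl]; trivial
  obtain ⟨_, ⟨g, hg, rfl⟩, hdist⟩ := Metric.mem_closure_iff.1 hmem η hη
  have hclose : ∀ p ∈ L, |g p - G p| ≤ η := by
    intro p hp
    have := (ContinuousMap.dist_apply_le_dist (f := ρ G) (g := ρ g) ⟨p, hp⟩).trans hdist.le
    rw [Real.dist_eq, abs_sub_comm] at this
    exact this
  have hdc := hD.isExcessiveDiff_const
  refine ⟨(g ⊓ BoundedContinuousFunction.const _ ‖G‖) ⊔ BoundedContinuousFunction.const _ (-‖G‖),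
    hD.isExcessiveDiff_sup (hD.isExcessiveDiff_inf hg (hdc _)) (hdc _), fun p hp => ?_, fun p => ?_⟩
  · change |max (min (g p) ‖G‖) (-‖G‖) - G p| ≤ η
    have h1 := abs_le.1 (hclose p hp)
    have h2 := abs_le.1 (abs_apply_le G p)
    rw [abs_le]
    constructor
    · have := le_max_left (min (g p) ‖G‖) (-‖G‖)
      have h3 : G p - η ≤ min (g p) ‖G‖ := le_min (by linarith) (by linarith)
      linarith
    · have : max (min (g p) ‖G‖) (-‖G‖) ≤ G p + η :=
        max_le ((min_le_left _ _).trans (by linarith)) (by linarith)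
      linarith
  · change |max (min (g p) ‖G‖) (-‖G‖)| ≤ ‖G‖
    have := norm_nonneg G
    exact abs_le.2 ⟨le_max_right _ _, max_le (min_le_right _ _) (by linarith)⟩

/-- A function that is small on a compact set in which the process stays up to `σ` is mapped by
`(n + 1) R_{n + 1}` to a small one. -/
lemma FellerData.abs_smooth_le_of_lt (hD : FellerData X P ℱ O) (n : ℕ) (h : (ℝ≥0 × E) →ᵇ ℝ)
    {C η : ℝ} (hη : 0 ≤ η) (hC : ∀ p, |h p| ≤ C) {p : ℝ≥0 × E} {σ : Ω → WithTop ℝ≥0}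
    (hσm : Measurable σ)
    (hσ : ∀ ω (t : ℝ≥0), (t : WithTop ℝ≥0) < σ ω → |h (p.1 + t, X t ω)| ≤ η) :
    |hD.smooth n h p| ≤ η + C * ∫ ω, discount 1 (σ ω) ∂P p.2 := by
  have hprob := hD.std.isProbabilityMeasure p.2
  have hC0 : 0 ≤ C := (abs_nonneg _).trans (hC p)
  have hn : (0 : ℝ) < n + 1 := Nat.cast_add_one_pos n
  have hmono : ∀ θ : WithTop ℝ≥0, discount ((n : ℝ) + 1) θ ≤ discount 1 θ := by
    intro θ
    cases θ with
    | top => simp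
    | coe t =>
      rw [discount_coe, discount_coe]
      refine Real.exp_le_exp.2 ?_
      have : (0 : ℝ) ≤ n := n.cast_nonneg
      nlinarith [mul_nonneg this t.coe_nonneg]
  have hpt : ∀ ω, ‖runningReward X ((n : ℝ) + 1) h p.1 (exitTime X univ ω) ω‖ ≤
      η / ((n : ℝ) + 1) + C / ((n : ℝ) + 1) * discount 1 (σ ω) := fun ω =>
    (hD.std.abs_runningReward_le_of_lt hn h.continuous.measurable hη hC (hσ ω)).trans
      (add_le_add_right (mul_le_mul_of_nonneg_left (hmono _) (div_nonneg hC0 hn.le)) _)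
  have hi := (integrable_discount (μ := P p.2) one_pos hσm).const_mul (C / ((n : ℝ) + 1))
  have h1 := norm_integral_le_of_norm_le ((integrable_const _).add hi) (ae_of_all _ hpt)
  simp only [Pi.add_apply] at h1
  rw [integral_add (integrable_const _) hi, integral_const_mul] at h1
  simp only [integral_const, probReal_univ, one_smul] at h1
  rw [hD.smooth_apply, hD.unkilled.res_apply, resolvent, abs_mul, abs_of_pos hn]
  refine (mul_le_mul_of_nonneg_left h1 hn.le).trans (le_of_eq ?_)
  field_simp

/-- The approximation `(n + 1) R_{n + 1} G → G` is locally uniform. -/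
lemma FellerData.tendstoLocallyUniformly_smooth (hD : FellerData X P ℱ O) (G : (ℝ≥0 × E) →ᵇ ℝ) :
    TendstoLocallyUniformly (fun n => ⇑(hD.smooth n G)) G atTop := by
  rw [Metric.tendstoLocallyUniformly_iff]
  intro ε hε p₀
  have hη : 0 < ε / (8 * (‖G‖ + 1)) := by positivity
  obtain ⟨L, hL, σ, hσ, hev⟩ := hD.exists_compact_stoppingTime one_pos p₀ hη
  obtain ⟨g, hg, hgL, hgb⟩ := hD.exists_isExcessiveDiff_near G hL (show 0 < ε / 8 by positivity)
  obtain ⟨t, ht, htn⟩ := Metric.tendstoLocallyUniformly_iff.1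
    (hD.tendstoLocallyUniformly_smooth_of_isExcessiveDiff hg) (ε / 4) (by positivity) p₀
  refine ⟨t ∩ {p | _}, inter_mem ht hev, ?_⟩
  filter_upwards [htn] with n hn p ⟨hpt, hpL, hpσ, hpd⟩
  have h1 := hn p hpt
  have h2 := hgL p hpL
  have h3 := hD.abs_smooth_le_of_lt n (G - g) (C := 2 * ‖G‖) (η := ε / 8) (by positivity)
    (fun q => (abs_sub _ _).trans (by linarith [abs_apply_le G q, hgb q]))
    hσ.measurable' (p := p) fun ω u hu => by
      have := hgL _ (hpσ ω u hu)
      rw [abs_sub_comm] at this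
      exact this
  rw [hD.smooth_sub, BoundedContinuousFunction.coe_sub, Pi.sub_apply] at h3
  have h4 : 2 * ‖G‖ * ∫ ω, discount 1 (σ ω) ∂P p.2 ≤ ε / 4 := by
    calc 2 * ‖G‖ * ∫ ω, discount 1 (σ ω) ∂P p.2
        ≤ 2 * (‖G‖ + 1) * (ε / (8 * (‖G‖ + 1))) := by
          refine mul_le_mul (by linarith) hpd (integral_nonneg fun ω => discount_nonneg _)
            (by positivity)
      _ = ε / 4 := by field_simp; norm_num
  rw [Real.dist_eq] at h1 ⊢
  have h5 := abs_lt.1 h1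
  have h6 := abs_le.1 h2
  have h7 := abs_le.1 h3
  exact abs_lt.2 ⟨by linarith, by linarith⟩

end Ray

/-! ### Penalization and continuity of the value function -/

section Value

variable {E Ω : Type*} [MetricSpace E] [ProperSpace E] [MeasurableSpace E] [BorelSpace E]
  {mΩ : MeasurableSpace Ω} {X : ℝ≥0 → Ω → E} {P : E → Measure Ω} {ℱ : Filtration ℝ≥0 mΩ}
  {O : Set E} {α : ℝ}

lemma FellerData.contracting_penalization (hD : FellerData X P ℱ O) (hα : 0 < α) {β : ℝ}
    (hβ : 0 < β) (f G : (ℝ≥0 × E) →ᵇ ℝ) :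
    ContractingWith (β / (α + β)).toNNReal
      fun v => hD.res (add_pos hα hβ) (f + β • (v ⊔ G)) := by
  have hb := add_pos hα hβ
  have hnn : 0 ≤ β / (α + β) := by positivity
  refine ⟨?_, LipschitzWith.of_dist_le_mul fun v w => ?_⟩
  · rw [← Real.toNNReal_one, Real.toNNReal_lt_toNNReal_iff one_pos, div_lt_one hb]
    linarith
  · rw [Real.coe_toNNReal _ hnn, dist_eq_norm, ← hD.res_sub, add_sub_add_left_eq_sub,
      ← smul_sub β (v ⊔ G) (w ⊔ G),
      dist_eq_norm]
    refine (BoundedContinuousFunction.norm_le (mul_nonneg hnn (norm_nonneg _))).2 fun p => ?_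
    have h1 : ∀ q, |(β • (v ⊔ G - w ⊔ G)) q| ≤ β * ‖v - w‖ := by
      intro q
      change |β * (max (v q) (G q) - max (w q) (G q))| ≤ _
      rw [abs_mul, abs_of_pos hβ]
      refine mul_le_mul_of_nonneg_left ?_ hβ.le
      exact (abs_max_sub_max_le_abs _ _ _).trans (abs_apply_le (v - w) q)
    have := hD.abs_resolvent_le hb h1 p
    rwa [mul_div_right_comm] at this

/-- **Penalization.** If the payoffs `G = U g ≤ H = U k` are resolvents of the process without
killing, then up to `ε` there is a function `u ≥ G - ε` which solves the stopping problem with an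
additional running reward `q ≥ 0` that is only paid where `u < G`. -/
lemma FellerData.exists_penalized (hD : FellerData X P ℱ O) (hα : 0 < α)
    (f g k : (ℝ≥0 × E) →ᵇ ℝ) (hgk : ∀ p, hD.unkilled.res hα g p ≤ hD.unkilled.res hα k p)
    {ε : ℝ} (hε : 0 < ε) : ∃ u q : (ℝ≥0 × E) →ᵇ ℝ, (∀ p, 0 ≤ q p) ∧
      (∀ p, hD.unkilled.res hα g p ≤ u p → q p = 0) ∧
      (∀ p, hD.unkilled.res hα g p - ε ≤ u p) ∧
      ∀ s x τ, IsStoppingTime ℱ τ →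
        J X P O α (f + q :) u (hD.unkilled.res hα k) s x τ = u (s, x) := by
  -- subtracting `H` reduces the problem to the exit payoff `0`
  set f' := f - k with hf'
  set g' := g - k with hg'
  set G' := hD.unkilled.res hα g' with hG'
  have hG'eq : ∀ p, G' p = hD.unkilled.res hα g p - hD.unkilled.res hα k p := by
    intro p
    rw [hG', hg', hD.unkilled.res_sub]
    rfl
  have hG'0 : ∀ p, G' p ≤ 0 := fun p => by rw [hG'eq]; linarith [hgk p]
  set β := (‖f' - g'‖ + 1) / ε with hβdef
  have hβ : 0 < β := by positivity
  have hb := add_pos hα hβ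
  have hT := hD.contracting_penalization hα hβ f' G'
  -- `v` solves `v = R (f' + β (G' - v)⁺)` with `R` the resolvent at `α`, in contraction form
  obtain ⟨v, hv⟩ : ∃ v, hD.res hb (f' + β • (v ⊔ G')) = v :=
    ⟨_, hT.fixedPoint_isFixedPt⟩
  set m := f' + β • (v ⊔ G') with hm
  set q := β • (v ⊔ G' - v) with hq
  have hq0 : ∀ p, 0 ≤ q p := fun p =>
    mul_nonneg hβ.le (sub_nonneg.2 (le_max_left (v p) (G' p)))
  have hvres : hD.res hα (f' + q) = v := by
    have h1 := hD.res_res hα hb m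
    rw [hv, add_sub_cancel_left, ← hD.res_smul] at h1
    have h2 : f' + q = m - β • v := by rw [hq, hm, smul_sub, add_sub_assoc]
    rw [h2, hD.res_sub, h1, sub_sub_cancel]
  -- `G' = U (g' + β G')` with `U` the unkilled resolvent at `α + β`; killing only increases it, as
  -- `G' ≤ 0`, so that `G' - v` is at most the killed resolvent of `g' - f'`
  have hvG : ∀ p, G' p - ε ≤ v p := by
    intro p
    have h1 : G' = hD.unkilled.res hb (g' + β • G') := by
      have := hD.unkilled.res_res hb hα g'
      rw [sub_add_cancel_left, neg_smul β (hD.unkilled.res hb (hD.unkilled.res hα g')),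
        ← hD.unkilled.res_smul, ← hG', neg_eq_iff_eq_neg, neg_sub] at this
      rw [hD.unkilled.res_add, this, add_sub_cancel]
    have h2 : G' p ≤ hD.res hb (g' + β • G') p := by
      have := hD.res_univ_le_res hb (g' + β • G') (fun r => by rw [← h1]; exact hG'0 r) p
      rwa [← h1] at this
    have h3 : hD.res hb (g' + β • G' - m) p ≤ ‖f' - g'‖ / (α + β) := by
      have hc : ∀ r, (g' + β • G' - m) r ≤ BoundedContinuousFunction.const _ ‖f' - g'‖ r := by
        intro r
        have e1 := neg_le_of_abs_le (abs_apply_le (f' - g') r)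
        have e2 := mul_le_mul_of_nonneg_left (le_max_right (v r) (G' r)) hβ.le
        change g' r + β * G' r - (f' r + β * max (v r) (G' r)) ≤ ‖f' - g'‖
        change -‖f' - g'‖ ≤ f' r - g' r at e1
        linarith
      refine (hD.res_mono hb hc p).trans ((le_abs_self _).trans ?_)
      exact hD.abs_resolvent_le hb (fun _ => (abs_of_nonneg (norm_nonneg (f' - g'))).le) p
    rw [hD.res_sub, hv, BoundedContinuousFunction.coe_sub, Pi.sub_apply] at h3
    have h4 : ‖f' - g'‖ / (α + β) ≤ ε := by
      rw [div_le_iff₀ hb]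
      have : ε * β = ‖f' - g'‖ + 1 := by rw [hβdef]; field_simp
      nlinarith [mul_pos hε hα]
    linarith
  refine ⟨v + hD.unkilled.res hα k, q, hq0, fun p hp => ?_, fun p => ?_, fun s x τ hτ => ?_⟩
  · change _ ≤ v p + hD.unkilled.res hα k p at hp
    have h1 : G' p ≤ v p := by rw [hG'eq]; linarith
    change β * (max (v p) (G' p) - v p) = 0
    rw [max_eq_left h1, sub_self, mul_zero]
  · change _ ≤ v p + hD.unkilled.res hα k p
    have := hvG p
    rw [hG'eq] at this
    linarith
  · have h1 := hD.J_res hα (f' + q) s x hτ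
    have h2 := hD.J_res_univ hα k s x hτ
    have h3 := hD.std.J_add hD.isOpen hα (f' + q) (hD.res hα (f' + q)) 0 k
      (hD.unkilled.res hα k) (hD.unkilled.res hα k) s x hτ.measurable'
    rw [h1, h2, hvres, zero_add, hf', add_right_comm, sub_add_cancel] at h3
    exact h3

/-! ### Comparison of functionals and of value functions -/

/-- If two pairs of terminal payoffs are close as long as the process has not reached `σ`, then the
functionals are close, uniformly over stopping times, up to the expected discount at `σ`. -/
lemma FellerData.abs_J_sub_le (hD : FellerData X P ℱ O) (hα : 0 < α)
    (f G H G' H' : (ℝ≥0 × E) →ᵇ ℝ) {C η : ℝ} (hη : 0 ≤ η) (hG : ∀ p, |G p| ≤ C)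
    (hG' : ∀ p, |G' p| ≤ C) (hH : ∀ p, |H p| ≤ C) (hH' : ∀ p, |H' p| ≤ C) {s : ℝ≥0} {x : E}
    {τ σ : Ω → WithTop ℝ≥0} (hτ : Measurable τ) (hσ : Measurable σ)
    (hL : ∀ ω (t : ℝ≥0), (t : WithTop ℝ≥0) < σ ω → |G (s + t, X t ω) - G' (s + t, X t ω)| ≤ η ∧
      |H (s + t, X t ω) - H' (s + t, X t ω)| ≤ η) :
    |J X P O α f G H s x τ - J X P O α f G' H' s x τ| ≤
      η + 2 * C * ∫ ω, discount α (σ ω) ∂P x := by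
  have hprob := hD.std.isProbabilityMeasure x
  rw [J_eq, J_eq, ← integral_sub (hD.std.integrable_pathPayoff hD.isOpen hα f G H s x hτ)
    (hD.std.integrable_pathPayoff hD.isOpen hα f G' H' s x hτ), ← Real.norm_eq_abs]
  have hi := (integrable_discount (μ := P x) hα hσ).const_mul (2 * C)
  refine (norm_integral_le_of_norm_le ((integrable_const η).add hi) (ae_of_all _ fun ω =>
    abs_pathPayoff_sub_le hα f hη hG hG' hH hH' (hL ω))).trans (le_of_eq ?_)
  simp only [Pi.add_apply]
  rw [integral_add (integrable_const _) hi, integral_const_mul]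
  simp

lemma FellerData.abs_J_sub_le_of_forall (hD : FellerData X P ℱ O) (hα : 0 < α)
    (f G H G' H' : (ℝ≥0 × E) →ᵇ ℝ) {η : ℝ} (hη : 0 ≤ η) (hG : ∀ p, |G p - G' p| ≤ η)
    (hH : ∀ p, |H p - H' p| ≤ η) (s : ℝ≥0) (x : E) {τ : Ω → WithTop ℝ≥0} (hτ : Measurable τ) :
    |J X P O α f G H s x τ - J X P O α f G' H' s x τ| ≤ η := by
  have hC : ∀ F : (ℝ≥0 × E) →ᵇ ℝ, ‖F‖ ≤ ‖G‖ + ‖G'‖ + ‖H‖ + ‖H'‖ → ∀ p, |F p| ≤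
    ‖G‖ + ‖G'‖ + ‖H‖ + ‖H'‖ := fun F hF p => (abs_apply_le F p).trans hF
  have n1 := norm_nonneg G
  have n2 := norm_nonneg G'
  have n3 := norm_nonneg H
  have n4 := norm_nonneg H'
  have := hD.abs_J_sub_le hα f G H G' H' (s := s) (x := x) hη (hC G (by linarith))
    (hC G' (by linarith)) (hC H (by linarith)) (hC H' (by linarith)) hτ
    (measurable_const (a := (⊤ : WithTop ℝ≥0))) fun ω t _ => ⟨hG _, hH _⟩
  simpa using this

lemma FellerData.bddAbove_J (hD : FellerData X P ℱ O) (hα : 0 < α)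
    (f G H : (ℝ≥0 × E) →ᵇ ℝ) (p : ℝ≥0 × E) :
    BddAbove (range fun τ : {τ : Ω → WithTop ℝ≥0 // IsStoppingTime ℱ τ} =>
      J X P O α f G H p.1 p.2 τ) :=
  ⟨_, by rintro _ ⟨τ, rfl⟩; exact (le_abs_self _).trans (hD.std.abs_J_le hα f G H _ _ _)⟩

lemma FellerData.J_le_valueFunction (hD : FellerData X P ℱ O) (hα : 0 < α)
    (f G H : (ℝ≥0 × E) →ᵇ ℝ) (s : ℝ≥0) (x : E) {τ : Ω → WithTop ℝ≥0} (hτ : IsStoppingTime ℱ τ) :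
    J X P O α f G H s x τ ≤ valueFunction X P ℱ O α f G H (s, x) :=
  le_ciSup (hD.bddAbove_J hα f G H (s, x)) ⟨τ, hτ⟩

lemma valueFunction_le {f G H : ℝ≥0 × E → ℝ} {s : ℝ≥0} {x : E} {c : ℝ}
    (h : ∀ τ, IsStoppingTime ℱ τ → J X P O α f G H s x τ ≤ c) :
    valueFunction X P ℱ O α f G H (s, x) ≤ c := by
  have : Nonempty {τ : Ω → WithTop ℝ≥0 // IsStoppingTime ℱ τ} := ⟨⟨_, isStoppingTime_top ℱ⟩⟩
  exact ciSup_le fun τ => h τ.1 τ.2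

lemma FellerData.abs_valueFunction_sub_le (hD : FellerData X P ℱ O) (hα : 0 < α)
    (f G H G' H' : (ℝ≥0 × E) →ᵇ ℝ) {s : ℝ≥0} {x : E} {δ : ℝ}
    (h : ∀ τ, IsStoppingTime ℱ τ →
      |J X P O α f G H s x τ - J X P O α f G' H' s x τ| ≤ δ) :
    |valueFunction X P ℱ O α f G H (s, x) - valueFunction X P ℱ O α f G' H' (s, x)| ≤ δ := by
  rw [abs_sub_le_iff]
  constructor
  · rw [sub_le_iff_le_add]
    refine valueFunction_le fun τ hτ => ?_
    linarith [(abs_le.1 (h τ hτ)).2, hD.J_le_valueFunction hα f G' H' s x hτ]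
  · rw [sub_le_iff_le_add]
    refine valueFunction_le fun τ hτ => ?_
    linarith [(abs_le.1 (h τ hτ)).1, hD.J_le_valueFunction hα f G H s x hτ]

lemma FellerData.abs_valueFunction_le (hD : FellerData X P ℱ O) (hα : 0 < α)
    (f G H : (ℝ≥0 × E) →ᵇ ℝ) (p : ℝ≥0 × E) :
    |valueFunction X P ℱ O α f G H p| ≤ ‖f‖ / α + (‖G‖ + ‖H‖) := by
  refine abs_le.2 ⟨?_, valueFunction_le fun τ _ =>
    (le_abs_self _).trans (hD.std.abs_J_le hα f G H p.1 p.2 τ)⟩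
  exact (neg_le_of_abs_le (hD.std.abs_J_le hα f G H p.1 p.2 _)).trans
    (hD.J_le_valueFunction hα f G H p.1 p.2 (isStoppingTime_top ℱ))

lemma pathPayoff_congr_running {f f' G H : ℝ≥0 × E → ℝ} {s : ℝ≥0} {θ : WithTop ℝ≥0} {ω : Ω}
    (h : ∀ u : ℝ≥0, (u : WithTop ℝ≥0) < θ → f (s + u, X u ω) = f' (s + u, X u ω)) :
    pathPayoff X O α f G H s θ ω = pathPayoff X O α f' G H s θ ω := by
  rw [pathPayoff, pathPayoff,
    runningReward_congr fun u hu => h u (lt_of_lt_of_le hu (min_le_left _ _))]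

/-- A penalized solution `u ≥ G - ε` is within `ε` of the value function: the penalty does not lower
the value, and stopping as soon as `u ≤ G` avoids it. -/
lemma FellerData.abs_valueFunction_sub_le_of_penalized (hD : FellerData X P ℱ O) (hα : 0 < α)
    (f G H u q : (ℝ≥0 × E) →ᵇ ℝ) {ε : ℝ} (hε : 0 ≤ ε) (hq : ∀ p, 0 ≤ q p)
    (hqu : ∀ p, G p ≤ u p → q p = 0) (hGu : ∀ p, G p - ε ≤ u p)
    (hJ : ∀ s x τ, IsStoppingTime ℱ τ → J X P O α (f + q :) u H s x τ = u (s, x)) (s : ℝ≥0)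
    (x : E) : |valueFunction X P ℱ O α f G H (s, x) - u (s, x)| ≤ ε := by
  rw [abs_sub_le_iff]
  constructor
  · rw [sub_le_iff_le_add]
    refine valueFunction_le fun τ hτ => ?_
    have h1 : J X P O α f G H s x τ ≤ J X P O α (f + q :) (G ⊔ u :) H s x τ :=
      hD.std.J_mono hD.isOpen hα (fun p => le_add_of_nonneg_right (hq p))
        (fun p => le_max_left (G p) (u p)) (fun p => le_rfl) s x hτ.measurable'
    have h2 := hD.abs_J_sub_le_of_forall hα (f + q) (G ⊔ u) H u H hε (fun p => by
      change |max (G p) (u p) - u p| ≤ ε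
      rw [abs_of_nonneg (sub_nonneg.2 (le_max_right _ _)), sub_le_iff_le_add]
      exact max_le (by linarith [hGu p]) (by linarith)) (fun p => by simpa using hε) s x
      hτ.measurable'
    rw [hJ s x τ hτ] at h2
    linarith [(abs_le.1 h2).2]
  · -- stop when `u ≤ G`; until then nothing is paid for the penalty
    set D : Set (ℝ≥0 × E) := {p | u p ≤ G p} with hDdef
    have hDc : IsClosed D := isClosed_le u.continuous G.continuous
    set τ := hittingAfter (spaceTime X s) D 0 with hτdef
    have hτ : IsStoppingTime ℱ τ := hD.std.isStoppingTime_hittingAfter s hDc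
    have h1 : u (s, x) ≤ J X P O α f G H s x τ := by
      rw [← hJ s x τ hτ, J_eq, J_eq]
      refine integral_mono
        (hD.std.integrable_pathPayoff hD.isOpen hα (f + q) u H s x hτ.measurable')
        (hD.std.integrable_pathPayoff hD.isOpen hα f G H s x hτ.measurable') fun ω => ?_
      simp only
      rw [pathPayoff_congr_running (f' := f) fun r hr => ?_]
      · refine add_le_add le_rfl ?_
        split_ifs
        · exact discountedPayoff_mono fun hne =>
            mem_of_hittingAfter_ne_top hDc (hD.std.spaceTime_rightContinuous s ω) hne
        · exact le_rfl
      · have hnot : ¬ u (s + r, X r ω) ≤ G (s + r, X r ω) := by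
          have : spaceTime X s r ω ∉ D := notMem_of_lt_hittingAfter hr zero_le
          exact this
        change f (s + r, X r ω) + q (s + r, X r ω) = f (s + r, X r ω)
        rw [hqu _ (not_le.1 hnot).le, add_zero]
    linarith [hD.J_le_valueFunction hα f G H s x hτ]

/-- Penalized solutions of stopping problems with smoothed payoffs, which approximate the value
function locally uniformly. -/
lemma FellerData.exists_penalized_seq (hD : FellerData X P ℱ O) (hα : 0 < α)
    (f G H : (ℝ≥0 × E) →ᵇ ℝ) (hGH : ∀ p, G p ≤ H p) :
    ∃ u q : ℕ → (ℝ≥0 × E) →ᵇ ℝ, (∀ n p, hD.smooth n G p ≤ u n p → q n p = 0) ∧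
      (∀ n s x τ, IsStoppingTime ℱ τ →
        J X P O α (f + q n :) (u n) (hD.smooth n H) s x τ = u n (s, x)) ∧
      (∀ n p, |u n p| ≤ ‖f‖ / α + (‖G‖ + ‖H‖) + 1) ∧
      TendstoLocallyUniformly (fun n => ⇑(u n)) (valueFunction X P ℱ O α f G H) atTop := by
  have hex : ∀ n : ℕ, ∃ u q : (ℝ≥0 × E) →ᵇ ℝ, (∀ p, 0 ≤ q p) ∧
      (∀ p, hD.smooth n G p ≤ u p → q p = 0) ∧
      (∀ p, hD.smooth n G p - 1 / ((n : ℝ) + 1) ≤ u p) ∧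
      ∀ s x τ, IsStoppingTime ℱ τ →
        J X P O α (f + q :) u (hD.smooth n H) s x τ = u (s, x) := by
    intro n
    obtain ⟨g, hg⟩ := hD.exists_res_eq_smooth hα n G
    obtain ⟨k, hk⟩ := hD.exists_res_eq_smooth hα n H
    have := hD.exists_penalized hα f g k (fun p => by
      rw [← hg, ← hk]; exact hD.smooth_mono n hGH p) (ε := 1 / ((n : ℝ) + 1)) (by positivity)
    rwa [← hg, ← hk] at this
  choose u q hq hqu hGu hJ using hex
  have hbound : ∀ n p, |u n p| ≤ ‖f‖ / α + (‖G‖ + ‖H‖) + 1 := by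
    intro n p
    have h1 := hD.abs_valueFunction_sub_le_of_penalized hα f (hD.smooth n G) (hD.smooth n H) (u n)
      (q n) (by positivity) (hq n) (hqu n) (hGu n) (hJ n) p.1 p.2
    have h2 := hD.abs_valueFunction_le hα f (hD.smooth n G) (hD.smooth n H) p
    have hG : ‖hD.smooth n G‖ ≤ ‖G‖ :=
      (BoundedContinuousFunction.norm_le (norm_nonneg _)).2 (hD.abs_smooth_le n G)
    have hH : ‖hD.smooth n H‖ ≤ ‖H‖ :=
      (BoundedContinuousFunction.norm_le (norm_nonneg _)).2 (hD.abs_smooth_le n H)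
    have h3 : 1 / ((n : ℝ) + 1) ≤ 1 := by
      rw [div_le_one (Nat.cast_add_one_pos n)]
      linarith [(n.cast_nonneg : (0 : ℝ) ≤ n)]
    rw [abs_le] at h1 h2 ⊢
    constructor <;> linarith [h1.1, h1.2, h2.1, h2.2]
  refine ⟨u, q, hqu, hJ, hbound, ?_⟩
  rw [Metric.tendstoLocallyUniformly_iff]
  intro ε hε p₀
  set C := ‖G‖ + ‖H‖ + 1 with hC
  have hC0 : 0 < C := by positivity
  have hCG : ∀ p, |G p| ≤ C := fun p => (abs_apply_le G p).trans (by linarith [norm_nonneg H])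
  have hCH : ∀ p, |H p| ≤ C := fun p => (abs_apply_le H p).trans (by linarith [norm_nonneg G])
  have hCG' : ∀ n p, |hD.smooth n G p| ≤ C := fun n p =>
    (hD.abs_smooth_le n G p).trans (by linarith [norm_nonneg H])
  have hCH' : ∀ n p, |hD.smooth n H p| ≤ C := fun n p =>
    (hD.abs_smooth_le n H p).trans (by linarith [norm_nonneg G])
  obtain ⟨L, hL, σ, hσ, hev⟩ := hD.exists_compact_stoppingTime hα p₀
    (show 0 < ε / (8 * C) by positivity)
  refine ⟨_, hev, ?_⟩
  have hGL := (tendstoLocallyUniformlyOn_iff_tendstoUniformlyOn_of_compact hL).1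
    (hD.tendstoLocallyUniformly_smooth G).tendstoLocallyUniformlyOn
  have hHL := (tendstoLocallyUniformlyOn_iff_tendstoUniformlyOn_of_compact hL).1
    (hD.tendstoLocallyUniformly_smooth H).tendstoLocallyUniformlyOn
  rw [Metric.tendstoUniformlyOn_iff] at hGL hHL
  filter_upwards [hGL (ε / 4) (by positivity), hHL (ε / 4) (by positivity),
    tendsto_one_div_add_atTop_nhds_zero_nat.eventually (gt_mem_nhds (show 0 < ε / 4 by positivity))]
    with n hnG hnH hn p ⟨_, hpσ, hpd⟩
  have h1 := hD.abs_valueFunction_sub_le_of_penalized hα f (hD.smooth n G) (hD.smooth n H) (u n)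
    (q n) (by positivity) (hq n) (hqu n) (hGu n) (hJ n) p.1 p.2
  have h2 : |valueFunction X P ℱ O α f G H (p.1, p.2) -
      valueFunction X P ℱ O α f (hD.smooth n G) (hD.smooth n H) (p.1, p.2)| ≤ ε / 2 := by
    refine hD.abs_valueFunction_sub_le hα f G H _ _ fun τ hτ => ?_
    refine (hD.abs_J_sub_le hα f G H (hD.smooth n G) (hD.smooth n H) (show 0 ≤ ε / 4 by positivity)
      hCG (hCG' n) hCH (hCH' n) hτ.measurable' hσ.measurable' fun ω t ht =>
      ⟨(hnG _ (hpσ ω t ht)).le, (hnH _ (hpσ ω t ht)).le⟩).trans ?_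
    have : 2 * C * ∫ ω, discount α (σ ω) ∂P p.2 ≤ 2 * C * (ε / (8 * C)) :=
      mul_le_mul_of_nonneg_left hpd (by positivity)
    have e : 2 * C * (ε / (8 * C)) = ε / 4 := by field_simp; norm_num
    linarith
  change dist (valueFunction X P ℱ O α f G H (p.1, p.2)) (u n (p.1, p.2)) < ε
  rw [Real.dist_eq]
  have := abs_sub_le (valueFunction X P ℱ O α f G H (p.1, p.2))
    (valueFunction X P ℱ O α f (hD.smooth n G) (hD.smooth n H) (p.1, p.2)) (u n (p.1, p.2))
  linarith

lemma FellerData.continuous_valueFunction (hD : FellerData X P ℱ O) (hα : 0 < α)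
    (f G H : (ℝ≥0 × E) →ᵇ ℝ) (hGH : ∀ p, G p ≤ H p) :
    Continuous (valueFunction X P ℱ O α f G H) := by
  obtain ⟨u, q, -, -, -, h⟩ := hD.exists_penalized_seq hα f G H hGH
  exact h.continuous (Frequently.of_forall fun n => (u n).continuous)

end Value

/-! ### Optimality of the first entrance time -/

section Optimality

variable {E Ω : Type*} [MetricSpace E] [ProperSpace E] [MeasurableSpace E] [BorelSpace E]
  {mΩ : MeasurableSpace Ω} {X : ℝ≥0 → Ω → E} {P : E → Measure Ω} {ℱ : Filtration ℝ≥0 mΩ}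
  {O : Set E} {α : ℝ}

/-- The value function as a bounded continuous function. -/
noncomputable def FellerData.value (hD : FellerData X P ℱ O) (hα : 0 < α)
    (f G H : (ℝ≥0 × E) →ᵇ ℝ) (hGH : ∀ p, G p ≤ H p) : (ℝ≥0 × E) →ᵇ ℝ :=
  BoundedContinuousFunction.ofNormedAddCommGroup _ (hD.continuous_valueFunction hα f G H hGH) _
    (hD.abs_valueFunction_le hα f G H)

/-- The value function is reproduced along the process as long as it exceeds the payoff `G` by a
fixed amount. -/
lemma FellerData.J_value (hD : FellerData X P ℱ O) (hα : 0 < α) (f G H : (ℝ≥0 × E) →ᵇ ℝ)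
    (hGH : ∀ p, G p ≤ H p) (s : ℝ≥0) (x : E) {θ : Ω → WithTop ℝ≥0} (hθ : IsStoppingTime ℱ θ)
    {ε : ℝ} (hε : 0 < ε) (hlt : ∀ ω (t : ℝ≥0), (t : WithTop ℝ≥0) < θ ω →
      G (s + t, X t ω) + ε < hD.value hα f G H hGH (s + t, X t ω)) :
    J X P O α f (hD.value hα f G H hGH) H s x θ = hD.value hα f G H hGH (s, x) := by
  have hprob := hD.std.isProbabilityMeasure x
  set W := hD.value hα f G H hGH with hW
  obtain ⟨u, q, hqu, hJ, hub, hconv⟩ := hD.exists_penalized_seq hα f G H hGH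
  refine eq_of_abs_sub_le_all fun δ hδ => ?_
  set C := ‖f‖ / α + (‖G‖ + ‖H‖) + 1 + ‖W‖ with hC
  set C' := ‖f‖ / α + 2 * (‖W‖ + ‖H‖) with hC'
  have hfα : 0 ≤ ‖f‖ / α := by positivity
  have n1 := norm_nonneg G
  have n2 := norm_nonneg H
  have n3 := norm_nonneg W
  set M := 2 * C + C' + 1 with hM
  have hM0 : 0 < M := by positivity
  obtain ⟨L, hL, σ, hσ, hev⟩ := hD.exists_compact_stoppingTime hα (s, x)
    (show 0 < δ / (4 * M) by positivity)
  obtain ⟨hpL, hpσ, hpd⟩ := hev.self_of_nhds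
  have unif : ∀ {F : ℕ → ℝ≥0 × E → ℝ} {F' : ℝ≥0 × E → ℝ},
      TendstoLocallyUniformly F F' atTop → ∀ η : ℝ, 0 < η →
      ∀ᶠ n in atTop, ∀ p ∈ L, dist (F' p) (F n p) < η := fun h =>
    Metric.tendstoUniformlyOn_iff.1
      ((tendstoLocallyUniformlyOn_iff_tendstoUniformlyOn_of_compact hL).1
        h.tendstoLocallyUniformlyOn)
  obtain ⟨n, hnW, hnG, hnH⟩ := ((unif hconv (min (ε / 2) (δ / 4)) (by positivity)).and
    ((unif (hD.tendstoLocallyUniformly_smooth G) (ε / 2) (by positivity)).and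
      (unif (hD.tendstoLocallyUniformly_smooth H) (δ / 4) (by positivity)))).exists
  have hnW1 : ∀ p ∈ L, |W p - u n p| < ε / 2 := fun p hp => (hnW p hp).trans_le (min_le_left _ _)
  have hnW2 : ∀ p ∈ L, |W p - u n p| < δ / 4 := fun p hp => (hnW p hp).trans_le (min_le_right _ _)
  have hmin : IsStoppingTime ℱ fun ω => min (θ ω) (σ ω) := hθ.min hσ
  -- up to `θ ∧ σ` the penalty vanishes
  have e1 : J X P O α f (u n) (hD.smooth n H) s x (fun ω => min (θ ω) (σ ω)) = u n (s, x) := by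
    rw [← hJ n s x _ hmin, J_eq, J_eq]
    refine integral_congr_ae (ae_of_all _ fun ω => ?_)
    refine pathPayoff_congr_running fun t ht => ?_
    have hYL := hpσ ω t (lt_of_lt_of_le ht (min_le_right _ _))
    have hW1 := hlt ω t (lt_of_lt_of_le ht (min_le_left _ _))
    have h1 := (abs_lt.1 (hnW1 _ hYL)).2
    have h2 := (abs_lt.1 (hnG _ hYL)).1
    change f (s + t, X t ω) = f (s + t, X t ω) + q n (s + t, X t ω)
    rw [hqu n _ (by linarith), add_zero]
  have e2 := hD.abs_J_sub_le hα f W H (u n) (hD.smooth n H) (C := C) (η := δ / 4) (s := s) (x := x)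
    (by positivity) (fun p => (abs_apply_le W p).trans (by linarith))
    (fun p => (hub n p).trans (by linarith))
    (fun p => (abs_apply_le H p).trans (by linarith))
    (fun p => (hD.abs_smooth_le n H p).trans (by linarith)) hmin.measurable' hσ.measurable'
    fun ω t ht => ⟨(hnW2 _ (hpσ ω t ht)).le, (hnH _ (hpσ ω t ht)).le⟩
  have e3 : |J X P O α f W H s x (fun ω => min (θ ω) (σ ω)) - J X P O α f W H s x θ| ≤
      C' * ∫ ω, discount α (σ ω) ∂P x := by
    rw [J_eq, J_eq, ← integral_sub
      (hD.std.integrable_pathPayoff hD.isOpen hα f W H s x hmin.measurable')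
      (hD.std.integrable_pathPayoff hD.isOpen hα f W H s x hθ.measurable'), ← Real.norm_eq_abs,
      ← integral_const_mul]
    exact norm_integral_le_of_norm_le ((integrable_discount hα hσ.measurable').const_mul _)
      (ae_of_all _ fun ω => hD.std.abs_pathPayoff_min_sub_le hα f W H s (θ ω) (σ ω) ω)
  have e4 := hnW2 _ hpL
  rw [e1] at e2
  have hsmall : (2 * C + C') * ∫ ω, discount α (σ ω) ∂P x ≤ δ / 4 := by
    calc (2 * C + C') * ∫ ω, discount α (σ ω) ∂P x ≤ M * (δ / (4 * M)) :=
          mul_le_mul (by linarith) hpd (integral_nonneg fun ω => discount_nonneg _) hM0.le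
      _ = δ / 4 := by field_simp
  rw [abs_le] at e2 e3 ⊢
  rw [abs_lt] at e4
  constructor <;> nlinarith [e2.1, e2.2, e3.1, e3.2, e4.1, e4.2]

/-! ### Convergence along times increasing to their limit -/

lemma tendsto_discount_of_iSup_eq_top (hα : 0 < α) {θ : ℕ → WithTop ℝ≥0} (hθ : Monotone θ)
    (h : ⨆ k, θ k = ⊤) : Tendsto (fun k => discount α (θ k)) atTop (𝓝 0) := by
  rw [Metric.tendsto_nhds]
  intro ε hε
  have hlim : Tendsto (fun n : ℕ => Real.exp (-α * n)) atTop (𝓝 0) :=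
    Real.tendsto_exp_atBot.comp
      (tendsto_natCast_atTop_atTop.const_mul_atTop_of_neg (neg_lt_zero.2 hα))
  obtain ⟨n, hn⟩ := (hlim.eventually (gt_mem_nhds hε)).exists
  obtain ⟨k, hk⟩ := lt_iSup_iff.1 (h ▸ WithTop.coe_lt_top (n : ℝ≥0))
  filter_upwards [eventually_ge_atTop k] with j hj
  rw [Real.dist_eq, sub_zero, abs_of_nonneg (discount_nonneg _)]
  refine lt_of_le_of_lt (discount_anti hα (hk.le.trans (hθ hj))) ?_
  rwa [discount_coe, NNReal.coe_natCast]

lemma IsStandardProcess.tendsto_runningReward (hX : IsStandardProcess X P ℱ) (hα : 0 < α)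
    (f : (ℝ≥0 × E) →ᵇ ℝ) (s : ℝ≥0) {θ : ℕ → WithTop ℝ≥0} (hθ : Monotone θ) (ω : Ω) :
    Tendsto (fun k => runningReward X α f s (θ k) ω) atTop
      (𝓝 (runningReward X α f s (⨆ k, θ k) ω)) := by
  classical
  simp only [runningReward_eq]
  refine tendsto_integral_of_dominated_convergence (fun u => ‖f‖ * Real.exp (-α * u))
    (fun k => (hX.integrableOn_integrand_ite hα f.continuous.measurable
      (abs_apply_le f) s (θ k) ω).aestronglyMeasurable)
    ((integrableOn_exp_neg hα).const_mul _)
    (fun k => ae_of_all _ fun u => abs_ite_le (mul_nonneg (norm_nonneg _) (Real.exp_pos _).le)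
      (abs_exp_mul_le (abs_apply_le f) u _)) (ae_of_all _ fun u => ?_)
  refine tendsto_const_nhds.congr' ?_
  by_cases hu : ((u.toNNReal : ℝ≥0) : WithTop ℝ≥0) < ⨆ k, θ k
  · obtain ⟨k, hk⟩ := lt_iSup_iff.1 hu
    filter_upwards [eventually_ge_atTop k] with j hj
    rw [if_pos hu, if_pos (hk.trans_le (hθ hj))]
  · refine Eventually.of_forall fun j => ?_
    rw [if_neg hu]
    exact (if_neg fun h => hu (lt_of_lt_of_le h (le_iSup θ j))).symm

lemma tendsto_discountedPayoff (hα : 0 < α) (h : (ℝ≥0 × E) →ᵇ ℝ) (s : ℝ≥0)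
    {θ : ℕ → WithTop ℝ≥0} (hθ : Monotone θ) {ω : Ω}
    (hXθ : ⨆ k, θ k ≠ ⊤ → Tendsto (fun k => X (θ k).untopA ω) atTop
      (𝓝 (X (⨆ k, θ k).untopA ω))) :
    Tendsto (fun k => discountedPayoff X α h s (θ k) ω) atTop
      (𝓝 (discountedPayoff X α h s (⨆ k, θ k) ω)) := by
  by_cases htop : ⨆ k, θ k = ⊤
  · rw [htop, discountedPayoff_top]
    refine squeeze_zero_norm (fun k => abs_discountedPayoff_le fun _ => abs_apply_le h _) ?_
    simpa using (tendsto_discount_of_iSup_eq_top hα hθ htop).const_mul ‖h‖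
  · have hk : ∀ k, θ k ≠ ⊤ := fun k hk => htop (top_le_iff.1 (hk ▸ le_iSup θ k))
    have ht := tendsto_untopA_of_monotone hθ htop
    simp only [discountedPayoff, htop, hk, if_false]
    refine Tendsto.mul ?_ ?_
    · exact (Real.continuous_exp.tendsto _).comp
        ((NNReal.continuous_coe.tendsto _).comp ht |>.const_mul _)
    · exact (h.continuous.tendsto _).comp ((ht.const_add s).prodMk_nhds (hXθ htop))

lemma FellerData.isClosed_stoppingSet (hD : FellerData X P ℱ O) (hα : 0 < α)
    (f G H : (ℝ≥0 × E) →ᵇ ℝ) (hGH : ∀ p, G p ≤ H p) (ε : ℝ) :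
    IsClosed {p | valueFunction X P ℱ O α f G H p ≤ G p + ε ∨ p.2 ∉ O} :=
  (isClosed_le (hD.continuous_valueFunction hα f G H hGH) (by fun_prop)).union
    (hD.isOpen.isClosed_compl.preimage continuous_snd)

lemma FellerData.isStoppingTime_optimalTime (hD : FellerData X P ℱ O) (hα : 0 < α)
    (f G H : (ℝ≥0 × E) →ᵇ ℝ) (hGH : ∀ p, G p ≤ H p) (s : ℝ≥0) :
    IsStoppingTime ℱ (optimalTime X P ℱ O α f G H s) := by
  have := hD.isClosed_stoppingSet hα f G H hGH 0
  simp only [add_zero] at this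
  exact hD.std.isStoppingTime_hittingAfter s this

/-- The entrance times into `{w ≤ G + 1 / (k + 1)}` are nearly optimal and increase to the time
`optimalTime`. In the limit the payoff does not drop, because `G ≤ H` at the exit. -/
lemma FellerData.valueFunction_le_J_optimalTime (hD : FellerData X P ℱ O) (hα : 0 < α)
    (f G H : (ℝ≥0 × E) →ᵇ ℝ) (hGH : ∀ p, G p ≤ H p) (s : ℝ≥0) (x : E) :
    valueFunction X P ℱ O α f G H (s, x) ≤
      J X P O α f G H s x (optimalTime X P ℱ O α f G H s) := by
  classical
  have hprob := hD.std.isProbabilityMeasure x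
  set w := valueFunction X P ℱ O α f G H with hw
  set W := hD.value hα f G H hGH with hW
  set D : ℕ → Set (ℝ≥0 × E) := fun k => {p | w p ≤ G p + 1 / ((k : ℝ) + 1) ∨ p.2 ∉ O} with hDk
  have hDc : ∀ k, IsClosed (D k) := fun k => hD.isClosed_stoppingSet hα f G H hGH _
  have hDanti : Antitone D := fun i j hij p hp => hp.imp_left fun h =>
    h.trans (add_le_add_right (one_div_le_one_div_of_le (Nat.cast_add_one_pos i)
      (by simpa using hij)) _)
  have hDinter : ⋂ k, D k = {p | w p ≤ G p ∨ p.2 ∉ O} := by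
    ext p
    rw [mem_iInter]
    constructor
    · intro hp
      by_cases hpO : p.2 ∈ O
      · left
        have h1 : ∀ k : ℕ, w p ≤ G p + 1 / ((k : ℝ) + 1) := fun k =>
          (hp k).resolve_right (not_not.2 hpO)
        have h2 := (tendsto_one_div_add_atTop_nhds_zero_nat (𝕜 := ℝ)).const_add (G p)
        rw [add_zero] at h2
        exact ge_of_tendsto' h2 h1
      · exact Or.inr hpO
    · intro hp k
      refine hp.imp_left fun h => h.trans ?_
      have : (0 : ℝ) ≤ 1 / ((k : ℝ) + 1) := by positivity
      linarith
  set τ : ℕ → Ω → WithTop ℝ≥0 := fun k => hittingAfter (spaceTime X s) (D k) 0 with hτ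
  set τs := optimalTime X P ℱ O α f G H s with hτs
  have hτst : ∀ k, IsStoppingTime ℱ (τ k) := fun k =>
    hD.std.isStoppingTime_hittingAfter s (hDc k)
  have hτsst : IsStoppingTime ℱ τs := hD.isStoppingTime_optimalTime hα f G H hGH s
  have hmono : ∀ ω, Monotone fun k => τ k ω := fun ω i j hij =>
    hittingAfter_zero_anti (hDanti hij)
  have hle : ∀ k ω, τ k ω ≤ τs ω := fun k ω =>
    hittingAfter_zero_anti (hDinter ▸ iInter_subset D k)
  have hse : ∀ ω, τs ω ≤ exitTime X O ω := fun ω => by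
    rw [exitTime_eq_hittingAfter X O s]
    exact hittingAfter_zero_anti fun p hp => Or.inr hp
  have hae := hD.std.ae_tendsto_hittingAfter s hDanti hDc hDinter x
  -- the entrance times are nearly optimal
  have hnear : ∀ k : ℕ, w (s, x) ≤ J X P O α f G H s x (τ k) + 1 / ((k : ℝ) + 1) := by
    intro k
    have hk : (0 : ℝ) < 1 / ((k : ℝ) + 1) := by positivity
    set Gk : (ℝ≥0 × E) →ᵇ ℝ := G + BoundedContinuousFunction.const _ (1 / ((k : ℝ) + 1)) with hGk
    have h1 : J X P O α f W H s x (τ k) = w (s, x) := by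
      refine hD.J_value hα f G H hGH s x (hτst k) hk fun ω t ht => ?_
      have : spaceTime X s t ω ∉ D k := notMem_of_lt_hittingAfter ht zero_le
      exact not_le.1 fun h => this (Or.inl h)
    have h2 : J X P O α f W H s x (τ k) ≤ J X P O α f Gk H s x (τ k) := by
      rw [J_eq, J_eq]
      refine integral_mono
        (hD.std.integrable_pathPayoff hD.isOpen hα f W H s x (hτst k).measurable')
        (hD.std.integrable_pathPayoff hD.isOpen hα f Gk H s x (hτst k).measurable') fun ω => ?_
      refine add_le_add le_rfl ?_
      split_ifs with hlt
      · refine discountedPayoff_mono fun hne => ?_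
        have hmem : spaceTime X s (τ k ω).untopA ω ∈ D k :=
          mem_of_hittingAfter_ne_top (hDc k) (hD.std.spaceTime_rightContinuous s ω) hne
        refine hmem.resolve_right (not_not.2 ?_)
        refine mem_of_lt_exitTime ?_
        rwa [WithTop.untopA_eq_untop hne, WithTop.coe_untop]
      · exact le_rfl
    have h3 := hD.abs_J_sub_le_of_forall hα f Gk H G H hk.le (fun p => by
      change |G p + 1 / ((k : ℝ) + 1) - G p| ≤ _
      rw [add_sub_cancel_left, abs_of_pos hk]) (fun p => by simpa using hk.le) s x
      (hτst k).measurable'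
    linarith [(abs_le.1 h3).2]
  -- an upper bound for the payoff at `τ k` that converges to the payoff at `τs`: where `τs` is the
  -- exit time, `G` is replaced by `H`
  set Z : WithTop ℝ≥0 → Ω → ℝ := fun θ ω => runningReward X α f s θ ω +
    if τs ω < exitTime X O ω then discountedPayoff X α G s θ ω
    else discountedPayoff X α H s θ ω with hZ
  have hZm : ∀ {θ : Ω → WithTop ℝ≥0}, Measurable θ → Measurable fun ω => Z (θ ω) ω := fun hθ =>
    (hD.std.measurable_runningReward α f.continuous.measurable s hθ).add
      (Measurable.ite (measurableSet_lt hτsst.measurable' hD.measurable_exit)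
        (hD.std.measurable_discountedPayoff α G.continuous.measurable s hθ)
        (hD.std.measurable_discountedPayoff α H.continuous.measurable s hθ))
  have hZb : ∀ θ ω, ‖Z θ ω‖ ≤ ‖f‖ / α + (‖G‖ + ‖H‖) := by
    intro θ ω
    have hp : ∀ h : (ℝ≥0 × E) →ᵇ ℝ, |discountedPayoff X α h s θ ω| ≤ ‖h‖ := fun h =>
      (abs_discountedPayoff_le fun _ => abs_apply_le h _).trans
        (mul_le_of_le_one_right (norm_nonneg _) (discount_le_one hα θ))
    refine (abs_add_le _ _).trans
      (add_le_add (abs_runningReward_le hα (abs_apply_le f) _ _ _) ?_)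
    split_ifs
    · linarith [hp G, norm_nonneg H]
    · linarith [hp H, norm_nonneg G]
  have hZJ : ∀ k, J X P O α f G H s x (τ k) ≤ ∫ ω, Z (τ k ω) ω ∂P x := by
    intro k
    rw [J_eq]
    refine integral_mono
      (hD.std.integrable_pathPayoff hD.isOpen hα f G H s x (hτst k).measurable')
      (Integrable.of_bound (hZm (hτst k).measurable').aestronglyMeasurable _
        (ae_of_all _ fun ω => hZb _ _)) fun ω => ?_
    have hke : τ k ω ≤ exitTime X O ω := (hle k ω).trans (hse ω)
    simp only [hZ, pathPayoff, min_eq_left hke]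
    refine add_le_add le_rfl ?_
    by_cases h1 : τs ω < exitTime X O ω
    · rw [if_pos h1, if_pos ((hle k ω).trans_lt h1)]
    · rw [if_neg h1]
      by_cases h2 : τ k ω < exitTime X O ω
      · rw [if_pos h2]
        exact discountedPayoff_mono fun _ => hGH _
      · rw [if_neg h2, le_antisymm hke (not_lt.1 h2)]
  have hZs : ∫ ω, Z (τs ω) ω ∂P x = J X P O α f G H s x τs := by
    rw [J_eq]
    refine integral_congr_ae (ae_of_all _ fun ω => ?_)
    simp only [hZ, pathPayoff, min_eq_left (hse ω)]
    by_cases h1 : τs ω < exitTime X O ω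
    · rw [if_pos h1, if_pos h1]
    · rw [if_neg h1, if_neg h1, le_antisymm (hse ω) (not_lt.1 h1)]
  have hlim : Tendsto (fun k => ∫ ω, Z (τ k ω) ω ∂P x) atTop (𝓝 (∫ ω, Z (τs ω) ω ∂P x)) := by
    refine tendsto_integral_of_dominated_convergence (fun _ => ‖f‖ / α + (‖G‖ + ‖H‖))
      (fun k => (hZm (hτst k).measurable').aestronglyMeasurable) (integrable_const _)
      (fun k => ae_of_all _ fun ω => hZb _ _) ?_
    filter_upwards [hae] with ω ⟨hsup, hconv⟩
    have hsup' : τs ω = ⨆ k, τ k ω := hsup.symm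
    have hconv' : ⨆ k, τ k ω ≠ ⊤ → Tendsto (fun k => X (τ k ω).untopA ω) atTop
        (𝓝 (X (⨆ k, τ k ω).untopA ω)) := by
      rw [← hsup']
      exact hconv
    simp only [hZ]
    refine Tendsto.add ?_ ?_
    · rw [hsup']
      exact hD.std.tendsto_runningReward hα f s (hmono ω) ω
    · split_ifs
      · rw [hsup']
        exact tendsto_discountedPayoff hα G s (hmono ω) hconv'
      · rw [hsup']
        exact tendsto_discountedPayoff hα H s (hmono ω) hconv'
  rw [← hZs]
  have hlim' := hlim.add (tendsto_one_div_add_atTop_nhds_zero_nat (𝕜 := ℝ))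
  rw [add_zero] at hlim'
  exact ge_of_tendsto' hlim' fun k => (hnear k).trans (add_le_add (hZJ k) le_rfl)

end Optimality

end BoundaryStopping

theorem mainTheorem1 {E Ω : Type*} [MetricSpace E] [ProperSpace E] [MeasurableSpace E]
    [BorelSpace E] {mΩ : MeasurableSpace Ω} (X : ℝ≥0 → Ω → E) (P : E → Measure Ω)
    (ℱ : Filtration ℝ≥0 mΩ)
    (hX : BoundaryStopping.IsStandardProcess X P ℱ)
    (hFeller : BoundaryStopping.IsWeakFeller X P)
    (O : Set E) (hO : IsOpen O) (α : ℝ) (hα : 0 < α)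
    (f G H : (ℝ≥0 × E) →ᵇ ℝ)
    (hA1 : BoundaryStopping.StoppedSemigroupFeller X P O)
    (hGH : ∀ p, G p ≤ H p) :
    Continuous (BoundaryStopping.valueFunction X P ℱ O α f G H) ∧
      ∀ s : ℝ≥0,
        IsStoppingTime ℱ (BoundaryStopping.optimalTime X P ℱ O α f G H s) ∧
        ∀ x : E,
          BoundaryStopping.J X P O α f G H s x
              (BoundaryStopping.optimalTime X P ℱ O α f G H s) =
            BoundaryStopping.valueFunction X P ℱ O α f G H (s, x) ∧
          ∀ τ : Ω → WithTop ℝ≥0, IsStoppingTime ℱ τ →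
            BoundaryStopping.J X P O α f G H s x τ ≤
              BoundaryStopping.valueFunction X P ℱ O α f G H (s, x) := by
  have hD : BoundaryStopping.FellerData X P ℱ O := ⟨hX, hFeller, hO, hA1⟩
  refine ⟨hD.continuous_valueFunction hα f G H hGH, fun s =>
    ⟨hD.isStoppingTime_optimalTime hα f G H hGH s, fun x => ⟨le_antisymm ?_ ?_, fun τ hτ => ?_⟩⟩⟩
  · exact hD.J_le_valueFunction hα f G H s x (hD.isStoppingTime_optimalTime hα f G H hGH s)
  · exact hD.valueFunction_le_J_optimalTime hα f G H hGH s x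
  · exact hD.J_le_valueFunction hα f G H s x hτ
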